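/- Let $G_b=\mathbb Z_2^T=\{1,t\}$, $\mathcal G=\mathbb Z_2^F\times\mathbb Z_2^T$ with fermion parity $p$ generating $\mathbb Z_2^F$, the fixed splitting $s:G_b\to\mathcal G$, $s(g)=(1,g)$, the projection $b:\mathcal G\to G_b$, the projection $\tau:\mathcal G\to\mathbb Z/2$ onto the first factor ($\tau(p)=1$), and $x:G_b\to\mathbb Z/2$, $x(t)=1$ (also written $x$ for $x\circ b$). A $\mathcal G$-equivariant algebra is a complex algebra $A$ with an action $R$ of $\mathcal G$ by ring automorphisms, $R(g)$ being linear if $x(g)=0$ and antilinear if $x(g)=1$; it is a superalgebra through $R(p)$. A projective representation of a group with such an $x$ consists of unitary ($x(g)=0$) and anti-unitary ($x(g)=1$) operators $Q(g)$ on a nonzero finite-dimensional Hilbert space with $Q(1)=1$ and $Q(g)Q(h)=e^{2\pi i\omega(g,h)}Q(gh)$, $\omega(g,h)\in\mathbb R/\mathbb Z$. An SRE algebra is an equivariant algebra isomorphic to * an even algebra $\mathrm{End}(U)$, with $U$ a projective representation of $\mathcal G$ and $R(g)M=Q(g)MQ(g)^{-1}$, or * an odd algebra $\mathrm{End}(U_b)\otimes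 C\ell(1)$, with $U_b$ a projective representation of $G_b$, $\beta\in H^1(G_b,\mathbb Z/2)$, $C\ell(1)=\mathbb C[\Gamma]/(\Gamma^2-1)$ and $R(g)(M\otimes\Gamma^m)=(-1)^{(\beta(b(g))+\tau(g))m}\,Q(b(g))MQ(b(g))^{-1}\otimes\Gamma^m$ (extended antilinearly if $x(g)=1$). A fermionic SRE phase with BDI symmetry is a class of SRE algebras under $\mathcal G$-equivariant Morita equivalence (mutually inverse equivariant bimodules). Stacking is the supertensor product $A\mathbin{\widehat\otimes}B$ with the action $R_A(g)\otimes R_B(g)$. The invariants of an SRE algebra are $([\alpha],[\beta],\gamma)\in H^2(G_b,U(1)_T)\times H^1(G_b,\mathbb Z/2)\times\mathbb Z/2$, where $g$ acts on $U(1)_T=\mathbb R/\mathbb Z$ by $(-1)^{x(g)}$: for an even algebra $\gamma=0$, $\alpha=s^*\omega$ and $\tfrac12\beta(b(g))=\omega(g,p)-\omega(p,g)+x(g)\,\omega(p,p)$; for an odd algebra $\gamma=1$, $\alpha=\omega$ and $\beta$ is the class in the action. A real superalgebra $D$ gives the equivariant algebra $D\otimes_{\mathbb R}\mathbb C$, where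 $p$ acts as the parity of $D$ and $t$ as complex conjugation. $C\ell_{m,n}\mathbb R$ has $m$ generators of square $+1$ and $n$ of square $-1$. A central real super-division algebra is a nonzero finite-dimensional real superalgebra in which every nonzero homogeneous element is invertible and whose supercenter is $\mathbb R$. Then: 1. Equivariant Morita equivalence is an equivalence relation on SRE algebras, the supertensor product of SRE algebras is an SRE algebra, stacking is well defined on phases, there are exactly eight SRE phases, and under stacking they form a group isomorphic to $\mathbb Z/8$. 2. $H^2(G_b,U(1)_T)$ and $H^1(G_b,\mathbb Z/2)$ both have two elements. The invariants are well defined and give a bijection from phases to $H^2(G_b,U(1)_T)\times H^1(G_b,\mathbb Z/2)\times\mathbb Z/2$, under which stacking becomes $$(\alpha_1,\beta_1,0)\cdot(\alpha_2,\beta_2,0)=(\alpha_1+\alpha_2+\tfrac12\beta_1\cup\beta_2,\ \beta_1+\beta_2,\ 0),$$ $$(\alpha_1,\beta_1,0)\cdot(\alpha_2,\beta_2,1)=(\alpha_1+\alpha_2+\tfrac12\beta_1\cup\beta_2+\tfrac12\beta_1\cup\beta_1,\ \beta_1+\beta_2,\ 1),$$ $$(\alpha_1,\beta_1,1)\cdot(\alpha_2,\beta_2,1)=(\alpha_1+\alpha_2+\tfrac12\beta_1\cup\beta_2,\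 \beta_1+\beta_2+x,\ 0),$$ and symmetrically for (odd)·(even). 3. Every central real super-division algebra is isomorphic to exactly one of the eight algebras $D_0,\dots,D_7$ below, and these eight are central super-division algebras. Each $D_n$ is graded Morita equivalent to $C\ell_{n,0}\mathbb R$. 4. The isomorphism of the group of phases with $\mathbb Z/8$ can be chosen such that the phase of $C\ell_{n,0}\mathbb R\otimes\mathbb C$ is $n \bmod 8$ for every $n\ge0$ and the phase of $D_n\otimes\mathbb C$ is $n$ for $0\le n<8$; in particular these complexifications are SRE algebras, and every phase contains exactly one $D_n\otimes\mathbb C$. The invariants of $D_n\otimes\mathbb C$ are, with $0,1$ denoting the trivial and the nontrivial class, | $n$ | $D_n$ | $(\alpha,\beta,\gamma)$ | |---|---|---| | 0 | $\mathbb R$ | $(0,0,0)$ | | 1 | $C\ell_{1,0}\mathbb R$ | $(0,0,1)$ | | 2 | $C\ell_{2,0}\mathbb R$ | $(0,1,0)$ | | 3 | $\mathbb H\otimes C\ell_{0,1}\mathbb R$ | $(1,1,1)$ | | 4 | $\mathbb H$ | $(1,0,0)$ | | 5 | $\mathbb H\otimes C\ell_{1,0}\mathbb R$ | $(1,0,1)$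 | | 6 | $C\ell_{0,2}\mathbb R$ | $(1,1,0)$ | | 7 | $C\ell_{0,1}\mathbb R$ | $(0,1,1)$ | ($\mathbb H$ is purely even.) -/

import Mathlib

open scoped TensorProduct

noncomputable section

namespace BDI

/-! ### Equivariant algebras, isomorphisms and Morita equivalence -/

section Equivariant

/-- A `k`-algebra with an action of the group `H` by ring automorphisms, where `g : H` acts
semilinearly over `k` with respect to the ring homomorphism `σ g`. -/
structure EquivariantAlgebra {k H : Type} [CommRing k] [Group H] (σ : H → k →+* k) where
  carrier : Type
  [ring : Ring carrier]
  [algebra : Algebra k carrier]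
  /-- As `H` is a group, every `act g` is automatically bijective. -/
  act : H →* (carrier →+* carrier)
  act_smul : ∀ (g : H) (c : k) (a : carrier), act g (c • a) = σ g c • act g a

attribute [instance] EquivariantAlgebra.ring EquivariantAlgebra.algebra

variable {k H : Type} [CommRing k] [Group H] {σ : H → k →+* k}

/-- Isomorphisms of equivariant algebras. -/
structure EquivariantAlgebra.Iso (A B : EquivariantAlgebra σ) where
  toAlgEquiv : A.carrier ≃ₐ[k] B.carrier
  map_act : ∀ (g : H) (a : A.carrier), toAlgEquiv (A.act g a) = B.act g (toAlgEquiv a)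

/-- An equivariant `A`-`B`-bimodule: the two induced `k`-actions agree, and `H` acts compatibly
with the bimodule structure. -/
structure EquivariantBimodule (A B : EquivariantAlgebra σ) where
  carrier : Type
  [addCommGroup : AddCommGroup carrier]
  [leftModule : Module A.carrier carrier]
  [rightModule : Module (B.carrier)ᵐᵒᵖ carrier]
  [smulComm : SMulCommClass A.carrier (B.carrier)ᵐᵒᵖ carrier]
  scalar : ∀ (c : k) (m : carrier),
    algebraMap k A.carrier c • m = MulOpposite.op (algebraMap k B.carrier c) • m
  act : H →* AddMonoid.End carrier
  act_smul : ∀ (g : H) (a : A.carrier) (m : carrier), act g (a • m) = A.act g a • act g m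
  act_op_smul : ∀ (g : H) (b : B.carrier) (m : carrier),
    act g (MulOpposite.op b • m) = MulOpposite.op (B.act g b) • act g m

attribute [instance] EquivariantBimodule.addCommGroup EquivariantBimodule.leftModule
  EquivariantBimodule.rightModule EquivariantBimodule.smulComm

/-- An equivariant Morita context with surjective pairings. The pairings are the isomorphisms
`M ⊗_B N ≅ A` and `N ⊗_A M ≅ B` of equivariant bimodules that express that `M` and `N` are mutually
inverse (for pairings with these properties, surjectivity implies bijectivity). -/
structure MoritaContext (A B : EquivariantAlgebra σ) where
  M : EquivariantBimodule A B
  N : EquivariantBimodule B A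
  pair : M.carrier →+ N.carrier →+ A.carrier
  copair : N.carrier →+ M.carrier →+ B.carrier
  pair_smul : ∀ (a : A.carrier) (m : M.carrier) (n : N.carrier), pair (a • m) n = a * pair m n
  pair_op_smul : ∀ (a : A.carrier) (m : M.carrier) (n : N.carrier),
    pair m (MulOpposite.op a • n) = pair m n * a
  pair_balanced : ∀ (b : B.carrier) (m : M.carrier) (n : N.carrier),
    pair (MulOpposite.op b • m) n = pair m (b • n)
  copair_smul : ∀ (b : B.carrier) (n : N.carrier) (m : M.carrier),
    copair (b • n) m = b * copair n m
  copair_op_smul : ∀ (b : B.carrier) (n : N.carrier) (m : M.carrier),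
    copair n (MulOpposite.op b • m) = copair n m * b
  copair_balanced : ∀ (a : A.carrier) (n : N.carrier) (m : M.carrier),
    copair (MulOpposite.op a • n) m = copair n (a • m)
  assoc : ∀ (m : M.carrier) (n : N.carrier) (m' : M.carrier),
    pair m n • m' = MulOpposite.op (copair n m') • m
  coassoc : ∀ (n : N.carrier) (m : M.carrier) (n' : N.carrier),
    copair n m • n' = MulOpposite.op (pair m n') • n
  pair_act : ∀ (g : H) (m : M.carrier) (n : N.carrier),
    A.act g (pair m n) = pair (M.act g m) (N.act g n)
  copair_act : ∀ (g : H) (n : N.carrier) (m : M.carrier),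
    B.act g (copair n m) = copair (N.act g n) (M.act g m)
  pair_surjective : AddSubgroup.closure {a | ∃ m n, pair m n = a} = ⊤
  copair_surjective : AddSubgroup.closure {b | ∃ n m, copair n m = b} = ⊤

/-- Equivariant Morita equivalence. -/
def MoritaEquivalent (A B : EquivariantAlgebra σ) : Prop :=
  Nonempty (MoritaContext A B)

end Equivariant

/-! ### The symmetry class -/

/-- The bosonic symmetry group `ℤ₂ᵀ`. -/
abbrev Gb : Type := Multiplicative (ZMod 2)

/-- The full symmetry group `ℤ₂ᶠ × ℤ₂ᵀ`. -/
abbrev G : Type := Multiplicative (ZMod 2) × Gb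

/-- Fermion parity. -/
def p : G := (Multiplicative.ofAdd 1, 1)

/-- The splitting `G_b → G`. -/
def s (g : Gb) : G := (1, g)

/-- The trivialization `t : G → ℤ/2` that belongs to the splitting. -/
def triv (g : G) : ZMod 2 := Multiplicative.toAdd g.1

/-- `x : G_b → ℤ/2`: the nontrivial element of `ℤ₂ᵀ` is anti-unitary. -/
def xb (g : Gb) : ZMod 2 := Multiplicative.toAdd g

/-- `x` on the full symmetry group. -/
def xG (g : G) : ZMod 2 := xb g.2

/-- `conj 0` is the identity of `ℂ`, `conj 1` is complex conjugation. -/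
def conj (a : ZMod 2) : ℂ →+* ℂ := if a = 0 then RingHom.id ℂ else starRingEnd ℂ

/-- Complex algebras with an action of `G` by linear (`x g = 0`) and antilinear (`x g = 1`)
automorphisms. -/
abbrev EqAlg : Type 1 := EquivariantAlgebra (fun g : G => conj (xG g))

/-! ### Fixed-point algebras of fermionic SRE phases -/

/-- A projective representation of `(H, x)` on a nonzero finite-dimensional complex Hilbert space:
`Q g` is unitary if `x g = 0` and anti-unitary if `x g = 1`, `Q 1 = 1`, and
`Q g * Q h = exp (2 π i ω(g, h)) Q (g * h)` with `ω(g, h) ∈ ℝ/ℤ`. -/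
structure ProjRep {H : Type} [Group H] (x : H → ZMod 2) where
  U : Type
  [normedAddCommGroup : NormedAddCommGroup U]
  [innerProductSpace : InnerProductSpace ℂ U]
  [finiteDimensional : FiniteDimensional ℂ U]
  [nontrivial : Nontrivial U]
  Q : H → U ≃+ U
  Q_smul : ∀ g (c : ℂ) u, Q g (c • u) = conj (x g) c • Q g u
  norm_Q : ∀ g u, ‖Q g u‖ = ‖u‖
  Q_one : ∀ u, Q 1 u = u
  ω : H → H → UnitAddCircle
  Q_mul : ∀ g h u, Q g (Q h u) = (AddCircle.toCircle (ω g h) : ℂ) • Q (g * h) u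

attribute [instance] ProjRep.normedAddCommGroup ProjRep.innerProductSpace
  ProjRep.finiteDimensional ProjRep.nontrivial

lemma conj_conj (a : ZMod 2) (c : ℂ) : conj a (conj a c) = c := by
  unfold conj; split_ifs <;> simp

lemma conj_real (a : ZMod 2) (r : ℝ) : conj a (r : ℂ) = r := by
  unfold conj; split_ifs <;> simp

namespace ProjRep

variable {H : Type} [Group H] {x : H → ZMod 2} (V : ProjRep x)

lemma Q_symm_smul (g : H) (c : ℂ) (u : V.U) :
    (V.Q g).symm (c • u) = conj (x g) c • (V.Q g).symm u := by
  rw [AddEquiv.symm_apply_eq, V.Q_smul, conj_conj, AddEquiv.apply_symm_apply]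

/-- `M ↦ Q(g) M Q(g)⁻¹` on `End(U)`. -/
def conjBy (g : H) : Module.End ℂ V.U →+* Module.End ℂ V.U where
  toFun M :=
    { toFun := fun u => V.Q g (M ((V.Q g).symm u))
      map_add' := by intro u v; simp
      map_smul' := by
        intro c u
        simp [Q_symm_smul, V.Q_smul, conj_conj] }
  map_one' := by ext u; simp
  map_mul' M N := by ext u; simp
  map_zero' := by ext u; simp
  map_add' M N := by ext u; simp

@[simp] lemma conjBy_apply (g : H) (M : Module.End ℂ V.U) (u : V.U) :
    V.conjBy g M u = V.Q g (M ((V.Q g).symm u)) := rfl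

lemma conjBy_one : V.conjBy 1 = RingHom.id _ := by
  ext M u
  have h : (V.Q 1).symm u = u := by rw [AddEquiv.symm_apply_eq, V.Q_one]
  simp [h, V.Q_one]

lemma conjBy_mul (g h : H) : V.conjBy (g * h) = (V.conjBy g).comp (V.conjBy h) := by
  ext M u
  obtain ⟨v, rfl⟩ := (V.Q g).surjective u
  obtain ⟨w, rfl⟩ := (V.Q h).surjective v
  have hne : (AddCircle.toCircle (V.ω g h) : ℂ) ≠ 0 := Circle.coe_ne_zero _
  simp only [RingHom.comp_apply, conjBy_apply, AddEquiv.symm_apply_apply]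
  rw [V.Q_mul, V.Q_mul, Q_symm_smul, AddEquiv.symm_apply_apply, map_smul, V.Q_smul, conj_conj]

lemma conjBy_smul (g : H) (c : ℂ) (M : Module.End ℂ V.U) :
    V.conjBy g (c • M) = conj (x g) c • V.conjBy g M := by
  ext u; simp [V.Q_smul]

/-- The action of `H` on `End(U)`. -/
def conjAct : H →* (Module.End ℂ V.U →+* Module.End ℂ V.U) where
  toFun := V.conjBy
  map_one' := V.conjBy_one
  map_mul' := V.conjBy_mul

end ProjRep

/-- The even algebra `End(U)` of a projective representation of `G`. -/
def evenAlg (V : ProjRep xG) : EqAlg where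
  carrier := Module.End ℂ V.U
  act := V.conjAct
  act_smul := V.conjBy_smul

/-- `H¹(G_b, ℤ/2)`. The coefficients are a trivial module, so there are no coboundaries, and the
cocycles are the homomorphisms. -/
abbrev H1 : Type := Additive Gb →+ ZMod 2

/-- `End(U_b) ⊗ Cℓ(1) = End(U_b)[Γ]/(Γ² - 1)`, realised as the group algebra of `ℤ/2` over
`End(U_b)`; `M ⊗ Γ^m` is `AddMonoidAlgebra.single m M`. -/
abbrev OddCarrier (V : ProjRep xb) : Type := AddMonoidAlgebra (Module.End ℂ V.U) (ZMod 2)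

/-- The homomorphism `Γ^m ↦ (-1)^(a m) Γ^m`. -/
def gammaSign (V : ProjRep xb) (a : ZMod 2) : Multiplicative (ZMod 2) →* OddCarrier V where
  toFun m := AddMonoidAlgebra.single (Multiplicative.toAdd m)
    (((-1 : ℤˣ) ^ (a * Multiplicative.toAdd m)) • (1 : Module.End ℂ V.U))
  map_one' := by simp [AddMonoidAlgebra.one_def]
  map_mul' m n := by
    simp [AddMonoidAlgebra.single_mul_single, mul_add, uzpow_add, smul_smul, mul_comm]

/-- `M ⊗ Γ^m ↦ (-1)^((β(b(g)) + t(g)) m) Q(b(g)) M Q(b(g))⁻¹ ⊗ Γ^m`. -/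
def oddBy (V : ProjRep xb) (β : H1) (g : G) : OddCarrier V →+* OddCarrier V :=
  AddMonoidAlgebra.liftNCRingHom
    (AddMonoidAlgebra.singleZeroRingHom.comp (V.conjBy g.2))
    (gammaSign V (β (Additive.ofMul g.2) + triv g))
    (by
      intro M m
      simp [gammaSign, Commute, SemiconjBy, AddMonoidAlgebra.single_mul_single])

lemma oddBy_single (V : ProjRep xb) (β : H1) (g : G) (m : ZMod 2) (M : Module.End ℂ V.U) :
    oddBy V β g (AddMonoidAlgebra.single m M) = AddMonoidAlgebra.single m
      (((-1 : ℤˣ) ^ ((β (Additive.ofMul g.2) + triv g) * m)) • V.conjBy g.2 M) := by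
  simp [oddBy, gammaSign, AddMonoidAlgebra.single_mul_single]

/-- The odd algebra `End(U_b) ⊗ Cℓ(1)` of a projective representation of `G_b` and a class `β`. -/
def oddAlg (V : ProjRep xb) (β : H1) : EqAlg where
  carrier := OddCarrier V
  act :=
    { toFun := oddBy V β
      map_one' := by
        refine RingHom.ext fun f => ?_
        induction f using AddMonoidAlgebra.induction_linear with
        | zero => simp
        | add f g hf hg => rw [map_add, map_add, hf, hg]
        | single m M => simp [oddBy_single, triv, V.conjBy_one]
      map_mul' := by
        intro g h
        refine RingHom.ext fun f => ?_
        induction f using AddMonoidAlgebra.induction_linear with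
        | zero => simp
        | add f g hf hg => rw [map_add, map_add, hf, hg]
        | single m M =>
          have e : (β (Additive.ofMul (g * h).2) + triv (g * h)) * m
              = (β (Additive.ofMul g.2) + triv g) * m + (β (Additive.ofMul h.2) + triv h) * m := by
            simp only [triv, Prod.snd_mul, Prod.fst_mul, ofMul_mul, map_add, toAdd_mul]
            ring
          have e2 : ∀ (u : ℤˣ) (N : Module.End ℂ V.U),
              V.conjBy g.2 (u • N) = u • V.conjBy g.2 N := by
            intro u N
            rw [Units.smul_def, Units.smul_def, map_zsmul]
          rw [RingHom.mul_def, RingHom.comp_apply, oddBy_single, oddBy_single, oddBy_single, e,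
            uzpow_add, e2, smul_smul, Prod.snd_mul, V.conjBy_mul]
          rfl }
  act_smul := by
    intro g c f
    change oddBy V β g (c • f) = _ • oddBy V β g f
    induction f using AddMonoidAlgebra.induction_linear with
    | zero => simp
    | add f g hf hg => rw [smul_add, map_add, map_add, smul_add, hf, hg]
    | single m M =>
      rw [AddMonoidAlgebra.smul_single, oddBy_single, oddBy_single, AddMonoidAlgebra.smul_single,
        V.conjBy_smul, smul_comm]
      rfl

/-- The fixed-point algebras of fermionic SRE phases: up to isomorphism, the even and the odd
algebras. -/
def IsSRE (A : EqAlg) : Prop :=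
  (∃ V : ProjRep xG, Nonempty (A.Iso (evenAlg V))) ∨
    ∃ (V : ProjRep xb) (β : H1), Nonempty (A.Iso (oddAlg V β))

/-- Fermionic SRE phases: equivariant Morita classes of SRE algebras. -/
def SREPhase : Type 1 :=
  Quot fun A B : {A : EqAlg // IsSRE A} => MoritaEquivalent A.1 B.1

/-- The phase of an SRE algebra. -/
def phase (A : EqAlg) (hA : IsSRE A) : SREPhase := Quot.mk _ ⟨A, hA⟩

/-! ### Stacking: the supertensor product -/

namespace EquivariantAlgebra

variable (A B : EqAlg)

/-- The homogeneous elements of degree `i`: fermion parity acts on them as `(-1)^i`. -/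
def parityGrading (i : ZMod 2) : Submodule ℂ A.carrier where
  carrier := {a | A.act p a = ((-1 : ℤˣ) ^ i) • a}
  add_mem' := by
    intro a b ha hb
    simp only [Set.mem_ofPred_eq] at *
    rw [map_add, ha, hb, smul_add]
  zero_mem' := by simp
  smul_mem' := by
    intro c a ha
    simp only [Set.mem_ofPred_eq] at *
    rw [A.act_smul, ha, smul_comm]
    simp [p, xG, xb, conj]

lemma mem_parityGrading {i : ZMod 2} {a : A.carrier} :
    a ∈ A.parityGrading i ↔ A.act p a = ((-1 : ℤˣ) ^ i) • a := Iff.rfl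

lemma act_p_smul (c : ℂ) (a : A.carrier) : A.act p (c • a) = c • A.act p a := by
  rw [A.act_smul]; simp [p, xG, xb, conj]

lemma act_p_act_p (a : A.carrier) : A.act p (A.act p a) = a := by
  have h : p * p = 1 := by decide
  rw [← RingHom.comp_apply, ← RingHom.mul_def, ← map_mul, h, map_one, RingHom.one_def,
    RingHom.id_apply]

lemma act_mem_parityGrading (g : G) {i : ZMod 2} {a : A.carrier} (ha : a ∈ A.parityGrading i) :
    A.act g a ∈ A.parityGrading i := by
  rw [mem_parityGrading] at *
  rw [← RingHom.comp_apply, ← RingHom.mul_def, ← map_mul, mul_comm p g, map_mul, RingHom.mul_def,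
    RingHom.comp_apply, ha, Units.smul_def, Units.smul_def, map_zsmul]

/-- The even part of `a`. -/
def evenPart : A.carrier →+ A.parityGrading 0 where
  toFun a := ⟨(2⁻¹ : ℂ) • (a + A.act p a), by
    rw [mem_parityGrading, act_p_smul, map_add, act_p_act_p, uzpow_zero, one_smul, add_comm]⟩
  map_zero' := by ext; simp
  map_add' a b := by ext; simp only [map_add, Submodule.coe_add, ← smul_add]; congr 1; abel

/-- The odd part of `a`. -/
def oddPart : A.carrier →+ A.parityGrading 1 where
  toFun a := ⟨(2⁻¹ : ℂ) • (a - A.act p a), by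
    rw [mem_parityGrading, act_p_smul, map_sub, act_p_act_p, uzpow_one, Units.neg_smul, one_smul,
      ← smul_neg, neg_sub]⟩
  map_zero' := by ext; simp
  map_add' a b := by ext; simp only [map_add, Submodule.coe_add, ← smul_add]; congr 1; abel

instance : GradedAlgebra A.parityGrading where
  one_mem := by rw [mem_parityGrading]; simp
  mul_mem i j a b ha hb := by
    rw [mem_parityGrading] at *
    rw [map_mul, ha, hb, uzpow_add, smul_mul_smul_comm]
  toDecomposition := DirectSum.Decomposition.ofAddHom A.parityGrading
    ((DirectSum.of (fun i => A.parityGrading i) 0).comp A.evenPart +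
      (DirectSum.of (fun i => A.parityGrading i) 1).comp A.oddPart)
    (by
      ext a
      simp only [AddMonoidHom.comp_apply, AddMonoidHom.add_apply, map_add,
        DirectSum.coeAddMonoidHom_of, AddMonoidHom.id_apply]
      change (2⁻¹ : ℂ) • (a + A.act p a) + (2⁻¹ : ℂ) • (a - A.act p a) = a
      rw [← smul_add, add_add_sub_cancel, ← two_smul ℂ a, smul_smul]
      norm_num)
    (by
      ext i a : 2
      obtain ⟨a, ha⟩ := a
      have hi : i = 0 ∨ i = 1 := (by decide : ∀ i : ZMod 2, i = 0 ∨ i = 1) i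
      rcases hi with rfl | rfl
      · have h0 : A.evenPart a = ⟨a, ha⟩ := by
          ext
          change (2⁻¹ : ℂ) • (a + A.act p a) = a
          rw [mem_parityGrading, uzpow_zero, one_smul] at ha
          rw [ha, ← two_smul ℂ a, smul_smul]
          norm_num
        have h1 : A.oddPart a = 0 := by
          ext
          change (2⁻¹ : ℂ) • (a - A.act p a) = 0
          rw [mem_parityGrading, uzpow_zero, one_smul] at ha
          rw [ha, sub_self, smul_zero]
        simp [h0, h1]
      · have h0 : A.evenPart a = 0 := by
          ext
          change (2⁻¹ : ℂ) • (a + A.act p a) = 0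
          rw [mem_parityGrading, uzpow_one, Units.neg_smul, one_smul] at ha
          rw [ha, add_neg_cancel, smul_zero]
        have h1 : A.oddPart a = ⟨a, ha⟩ := by
          ext
          change (2⁻¹ : ℂ) • (a - A.act p a) = a
          rw [mem_parityGrading, uzpow_one, Units.neg_smul, one_smul] at ha
          rw [ha, sub_neg_eq_add, ← two_smul ℂ a, smul_smul]
          norm_num
        simp [h0, h1])

/-- `act g` as a semilinear map. -/
def actₛₗ (g : G) : A.carrier →ₛₗ[conj (xG g)] A.carrier where
  toFun := A.act g
  map_add' := map_add _
  map_smul' := A.act_smul g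

/-- The supertensor product of the underlying superalgebras, with
`(a₁ ⊗ a₂)(b₁ ⊗ b₂) = (-1)^(|a₂| |b₁|) a₁ b₁ ⊗ a₂ b₂`. -/
abbrev StackCarrier : Type := A.parityGrading ᵍ⊗[ℂ] B.parityGrading

/-- `a ⊗ b ↦ R(g) a ⊗ R(g) b`, as an additive map. -/
def stackAdd (g : G) : StackCarrier A B →+ StackCarrier A B :=
  (TensorProduct.map (A.actₛₗ g) (B.actₛₗ g)).toAddMonoidHom

lemma stackAdd_tmul (g : G) (a : A.carrier) (b : B.carrier) :
    stackAdd A B g (a ᵍ⊗ₜ[ℂ] b) = (A.act g a) ᵍ⊗ₜ[ℂ] (B.act g b) := rfl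

lemma stack_induction {P : StackCarrier A B → Prop} (h0 : P 0)
    (hadd : ∀ x y, P x → P y → P (x + y))
    (ht : ∀ (i j : ZMod 2) (a : A.parityGrading i) (b : B.parityGrading j),
      P ((a : A.carrier) ᵍ⊗ₜ[ℂ] (b : B.carrier))) (x : StackCarrier A B) : P x := by
  refine TensorProduct.induction_on (motive := fun y => P y) x h0 (fun a b => ?_)
    (fun x y hx hy => hadd x y hx hy)
  change P (a ᵍ⊗ₜ[ℂ] b)
  induction a using DirectSum.Decomposition.inductionOn A.parityGrading with
  | zero => simpa [GradedTensorProduct.tmul] using h0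
  | add a a' ha ha' =>
    simpa [GradedTensorProduct.tmul, TensorProduct.add_tmul] using hadd _ _ ha ha'
  | homogeneous a =>
    induction b using DirectSum.Decomposition.inductionOn B.parityGrading with
    | zero => simpa [GradedTensorProduct.tmul] using h0
    | add b b' hb hb' =>
      simpa [GradedTensorProduct.tmul, TensorProduct.tmul_add] using hadd _ _ hb hb'
    | homogeneous b => exact ht _ _ a b

/-- `a ⊗ b ↦ R(g) a ⊗ R(g) b`. -/
def stackBy (g : G) : StackCarrier A B →+* StackCarrier A B :=
  { stackAdd A B g with
    map_one' := by
      change stackAdd A B g ((1 : A.carrier) ᵍ⊗ₜ[ℂ] (1 : B.carrier)) = _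
      rw [stackAdd_tmul, map_one, map_one]
      rfl
    map_mul' := by
      intro x y
      change stackAdd A B g (x * y) = stackAdd A B g x * stackAdd A B g y
      induction x using stack_induction with
      | h0 => rw [zero_mul, map_zero, zero_mul]
      | hadd x x' hx hx' => rw [add_mul, map_add, map_add, add_mul, hx, hx']
      | ht i j a b =>
        induction y using stack_induction with
        | h0 => rw [mul_zero, map_zero, mul_zero]
        | hadd y y' hy hy' => rw [mul_add, map_add, map_add, mul_add, hy, hy']
        | ht i' j' a' b' =>
          have hb : B.act g b ∈ B.parityGrading j := B.act_mem_parityGrading g b.2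
          have ha' : A.act g a' ∈ A.parityGrading i' := A.act_mem_parityGrading g a'.2
          rw [GradedTensorProduct.tmul_coe_mul_coe_tmul, Units.smul_def, map_zsmul,
            stackAdd_tmul, stackAdd_tmul, stackAdd_tmul, map_mul, map_mul, ← Units.smul_def]
          exact (GradedTensorProduct.tmul_coe_mul_coe_tmul A.parityGrading B.parityGrading
            (A.act g a) ⟨_, hb⟩ ⟨_, ha'⟩ (B.act g b')).symm }

/-- Stacking of phases: the supertensor product with the diagonal action of `G`. -/
def stack : EqAlg where
  carrier := StackCarrier A B
  act :=
    { toFun := stackBy A B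
      map_one' := by
        refine RingHom.ext fun x => ?_
        change stackAdd A B 1 x = x
        induction x using stack_induction with
        | h0 => rw [map_zero]
        | hadd x y hx hy => rw [map_add, hx, hy]
        | ht i j a b => rw [stackAdd_tmul, map_one, map_one]; rfl
      map_mul' := by
        intro g h
        refine RingHom.ext fun x => ?_
        change stackAdd A B (g * h) x = stackAdd A B g (stackAdd A B h x)
        induction x using stack_induction with
        | h0 => simp only [map_zero]
        | hadd x y hx hy => simp only [map_add, hx, hy]
        | ht i j a b =>
          rw [stackAdd_tmul, stackAdd_tmul, stackAdd_tmul, map_mul, map_mul]; rfl }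
  act_smul g c x := by
    change TensorProduct.map (A.actₛₗ g) (B.actₛₗ g) _ = _
    exact LinearMap.map_smulₛₗ (TensorProduct.map (A.actₛₗ g) (B.actₛₗ g)) c x

end EquivariantAlgebra

/-! ### The invariants `α`, `β`, `γ` -/

/-- The inclusion `ℤ/2 → ℝ/ℤ`, `a ↦ a/2`. -/
def half (a : ZMod 2) : UnitAddCircle := (((a.val : ℝ) / 2 : ℝ) : UnitAddCircle)

lemma half_add (a b : ZMod 2) : half (a + b) = half a + half b := by
  have ha : a = 0 ∨ a = 1 := by revert a; decide
  have hb : b = 0 ∨ b = 1 := by revert b; decide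
  rcases ha with rfl | rfl <;> rcases hb with rfl | rfl
  · simp [half]
  · simp [half]
  · simp [half]
  · have e : (1 + 1 : ZMod 2) = 0 := by decide
    have e1 : (1 : ZMod 2).val = 1 := rfl
    rw [e, half, half, ZMod.val_zero, e1, ← AddCircle.coe_add]
    norm_num
    exact (AddCircle.coe_period (1 : ℝ)).symm

lemma neg_half (a : ZMod 2) : -half a = half a := by
  rw [neg_eq_iff_add_eq_zero, ← half_add, CharTwo.add_self_eq_zero]
  simp [half]

/-- `a ↦ (-1)^(x(g)) a` on `ℝ/ℤ`. -/
def twist (g : Gb) : UnitAddCircle →ₗ[ℤ] UnitAddCircle :=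
  if xb g = 0 then LinearMap.id else -LinearMap.id

/-- `U(1)_T`: the group `ℝ/ℤ` on which `g` acts as `(-1)^(x(g))`. -/
abbrev U1T : Rep ℤ Gb :=
  Rep.of (X := UnitAddCircle)
    ({ toFun := twist
       map_one' := by simp [twist, xb]; rfl
       map_mul' := by
        intro g h
        have hg : xb g = 0 ∨ xb g = 1 := by generalize xb g = a; revert a; decide
        have hh : xb h = 0 ∨ xb h = 1 := by generalize xb h = a; revert a; decide
        have e : xb (g * h) = xb g + xb h := rfl
        have e2 : (1 + 1 : ZMod 2) = 0 := by decide
        ext a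
        rcases hg with hg | hg <;> rcases hh with hh | hh <;>
          simp [twist, e, hg, hh, e2] } : Representation ℤ Gb UnitAddCircle)

/-- `H²(G_b, U(1)_T)`. -/
abbrev H2 : Type := groupCohomology.H2 U1T

/-- The invariants `([α], [β], γ)`. -/
abbrev Invariants : Type := H2 × H1 × ZMod 2

/-- `A` has the invariants `i`: for an even algebra, `α` is the pullback along `s` of the twisted
cocycle `ω` of the projective representation, and
`β(b(g))/2 = ω(g, p) - ω(p, g) + x(g) ω(p, p)`; for an odd algebra, `α` is the twisted cocycle of
the projective representation of `G_b` and `β` gives the action on the odd generator. -/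
def HasInvariants (A : EqAlg) (i : Invariants) : Prop :=
  (∃ (V : ProjRep xG) (α : groupCohomology.cocycles₂ U1T) (β : H1),
      Nonempty (A.Iso (evenAlg V)) ∧
      (∀ g h : Gb, α (g, h) = V.ω (s g) (s h)) ∧
      (∀ g : G, half (β (Additive.ofMul g.2)) =
        V.ω g p - V.ω p g + (xG g).val • V.ω p p) ∧
      i = (groupCohomology.H2π U1T α, β, 0)) ∨
  ∃ (V : ProjRep xb) (α : groupCohomology.cocycles₂ U1T) (β : H1),
      Nonempty (A.Iso (oddAlg V β)) ∧
      (∀ g h : Gb, α (g, h) = V.ω g h) ∧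
      i = (groupCohomology.H2π U1T α, β, 1)

/-- The twisted cocycle `½ β₁ ∪ β₂`. -/
def halfCupCocycle (β₁ β₂ : H1) : groupCohomology.cocycles₂ U1T :=
  ⟨fun gh => half (β₁ (Additive.ofMul gh.1) * β₂ (Additive.ofMul gh.2)), by
    rw [groupCohomology.mem_cocycles₂_iff]
    intro g h j
    have e : ∀ a, U1T.ρ g (half a) = half a := by
      intro a
      change twist g (half a) = half a
      unfold twist
      split_ifs
      · rfl
      · simp [neg_half]
    change half _ + half _ = U1T.ρ g (half _) + half _
    rw [e]
    change half _ + half _ = half _ + half _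
    rw [← half_add, ← half_add]
    congr 1
    simp only [ofMul_mul, map_add]
    ring⟩

/-- The class `½ β₁ ∪ β₂` in `H²(G_b, U(1)_T)`. -/
def halfCup (β₁ β₂ : H1) : H2 := groupCohomology.H2π U1T (halfCupCocycle β₁ β₂)

/-- `x` as a class in `H¹(G_b, ℤ/2)`; it is the nontrivial one. -/
def xClass : H1 where
  toFun g := xb g.toMul
  map_zero' := rfl
  map_add' _ _ := rfl

/-- The stacking law of the invariants. -/
def Invariants.stack (i j : Invariants) : Invariants :=
  (i.1 + j.1 + halfCup i.2.1 j.2.1 +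
      (if i.2.2 = 0 ∧ j.2.2 = 1 then halfCup i.2.1 i.2.1 else 0) +
      (if i.2.2 = 1 ∧ j.2.2 = 0 then halfCup j.2.1 j.2.1 else 0),
    i.2.1 + j.2.1 + (if i.2.2 = 1 ∧ j.2.2 = 1 then xClass else 0),
    i.2.2 + j.2.2)

/-- The class in `H²(G_b, U(1)_T)` with `α(t, t) = a/2`, where `t` generates `ℤ₂ᵀ`. -/
def alphaClass (a : ZMod 2) : H2 := if a = 0 then 0 else halfCup xClass xClass

/-- The class in `H¹(G_b, ℤ/2)` with `β(t) = b`, where `t` generates `ℤ₂ᵀ`. -/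
def betaClass (b : ZMod 2) : H1 := if b = 0 then 0 else xClass

/-! ### Real superalgebras -/

/-- Real superalgebras: the grading is given by the parity automorphism, whose eigenspaces for the
eigenvalues `1` and `-1` are the even and the odd part. -/
abbrev RealSuperAlgebra : Type 1 :=
  EquivariantAlgebra (fun _ : Multiplicative (ZMod 2) => RingHom.id ℝ)

/-- The real superalgebra with a given involutive parity automorphism. -/
def RealSuperAlgebra.mk (A : Type) [Ring A] [Algebra ℝ A] (P : A →ₐ[ℝ] A)
    (hP : ∀ a, P (P a) = a) : RealSuperAlgebra where
  carrier := A
  act :=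
    { toFun := fun g => if Multiplicative.toAdd g = 0 then RingHom.id A else P.toRingHom
      map_one' := by simp; rfl
      map_mul' := by
        intro g h
        have hg : g.toAdd = 0 ∨ g.toAdd = 1 := by generalize g.toAdd = a; revert a; decide
        have hh : h.toAdd = 0 ∨ h.toAdd = 1 := by generalize h.toAdd = a; revert a; decide
        have e2 : (1 + 1 : ZMod 2) = 0 := by decide
        refine RingHom.ext fun a => ?_
        rcases hg with hg | hg <;> rcases hh with hh | hh <;> simp [hg, hh, e2, hP] }
  act_smul := by
    intro g c a
    change (if Multiplicative.toAdd g = 0 then RingHom.id A else P.toRingHom) (c • a) =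
      c • (if Multiplicative.toAdd g = 0 then RingHom.id A else P.toRingHom) a
    split_ifs <;> simp

/-- The parity automorphism. -/
def RealSuperAlgebra.parity (D : RealSuperAlgebra) : D.carrier →+* D.carrier :=
  D.act (Multiplicative.ofAdd 1)

/-- Central super-division algebras over `ℝ`: nonzero and finite-dimensional, all nonzero homogeneous
elements are invertible, and the supercenter is `ℝ`. -/
structure RealSuperAlgebra.IsCentralSuperDivision (D : RealSuperAlgebra) : Prop where
  nontrivial : Nontrivial D.carrier
  finiteDimensional : FiniteDimensional ℝ D.carrier
  isUnit : ∀ a : D.carrier, a ≠ 0 → (parity D a = a ∨ parity D a = -a) → IsUnit a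
  center_even : ∀ z : D.carrier, parity D z = z → (∀ a, z * a = a * z) →
    ∃ r : ℝ, z = algebraMap ℝ D.carrier r
  center_odd : ∀ z : D.carrier, parity D z = -z → (∀ a, z * a = parity D a * z) → z = 0

/-- The quadratic form `x₁² + ⋯ + x_m² - y₁² - ⋯ - y_n²`. -/
def cliffordForm (m n : ℕ) : QuadraticForm ℝ (Fin m ⊕ Fin n → ℝ) :=
  QuadraticMap.weightedSumSquares ℝ (Sum.elim (fun _ => (1 : ℝ)) (fun _ => -1))

/-- The Clifford algebra `Cℓ_{m,n}ℝ`: `m` generators with square `1`, `n` with square `-1`. -/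
def cliff (m n : ℕ) : RealSuperAlgebra :=
  RealSuperAlgebra.mk (CliffordAlgebra (cliffordForm m n)) CliffordAlgebra.involute
    CliffordAlgebra.involute_involute

/-- `ℍ ⊗ Cℓ_{m,n}ℝ`, where `ℍ` is purely even. -/
def quatCliff (m n : ℕ) : RealSuperAlgebra :=
  RealSuperAlgebra.mk (Quaternion ℝ ⊗[ℝ] CliffordAlgebra (cliffordForm m n))
    (Algebra.TensorProduct.map (AlgHom.id ℝ _) CliffordAlgebra.involute)
    (by
      intro a
      induction a using TensorProduct.induction_on with
      | zero => simp
      | tmul a b => simp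
      | add a b ha hb => rw [map_add, map_add, ha, hb])

/-- The table of the eight central real super-division algebras. -/
def superDiv : Fin 8 → RealSuperAlgebra :=
  ![RealSuperAlgebra.mk ℝ (AlgHom.id ℝ ℝ) (fun _ => rfl),
    cliff 1 0,
    cliff 2 0,
    quatCliff 0 1,
    RealSuperAlgebra.mk (Quaternion ℝ) (AlgHom.id ℝ _) (fun _ => rfl),
    quatCliff 1 0,
    cliff 0 2,
    cliff 0 1]

/-- The table of the invariants. -/
def tableInvariants : Fin 8 → Invariants :=
  ![(alphaClass 0, betaClass 0, 0),
    (alphaClass 0, betaClass 0, 1),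
    (alphaClass 0, betaClass 1, 0),
    (alphaClass 1, betaClass 1, 1),
    (alphaClass 1, betaClass 0, 0),
    (alphaClass 1, betaClass 0, 1),
    (alphaClass 1, betaClass 1, 0),
    (alphaClass 0, betaClass 1, 1)]

/-- `conj a` as a homomorphism of real algebras. -/
def conjAlg (a : ZMod 2) : ℂ →ₐ[ℝ] ℂ := { conj a with commutes' := conj_real a }

/-- The parity action as a homomorphism of real algebras. -/
def RealSuperAlgebra.actAlg (D : RealSuperAlgebra) (g : Multiplicative (ZMod 2)) :
    D.carrier →ₐ[ℝ] D.carrier :=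
  { D.act g with
    commutes' := by
      intro r
      have h := D.act_smul g r 1
      rw [map_one, RingHom.id_apply, ← Algebra.algebraMap_eq_smul_one] at h
      exact h }

/-- The action of `G` on `ℂ ⊗ D`: fermion parity acts as the parity of `D`, and the generator of
`ℤ₂ᵀ` as complex conjugation. -/
def complexifyBy (D : RealSuperAlgebra) (g : G) :
    ℂ ⊗[ℝ] D.carrier →ₐ[ℝ] ℂ ⊗[ℝ] D.carrier :=
  Algebra.TensorProduct.map (conjAlg (xG g)) (RealSuperAlgebra.actAlg D g.1)

lemma complexifyBy_tmul (D : RealSuperAlgebra) (g : G) (c : ℂ) (a : D.carrier) :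
    complexifyBy D g (c ⊗ₜ a) = conj (xG g) c ⊗ₜ D.act g.1 a := rfl

/-- The complexification `D ⊗ ℂ` of a real superalgebra as a `G`-equivariant algebra. -/
def complexify (D : RealSuperAlgebra) : EqAlg where
  carrier := ℂ ⊗[ℝ] D.carrier
  act :=
    { toFun := fun g => (complexifyBy D g).toRingHom
      map_one' := by
        refine RingHom.ext fun x => ?_
        change complexifyBy D 1 x = x
        induction x using TensorProduct.induction_on with
        | zero => simp
        | tmul c a => simp [complexifyBy_tmul, xG, xb, conj]
        | add x y hx hy => rw [map_add, hx, hy]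
      map_mul' := by
        intro g h
        refine RingHom.ext fun x => ?_
        change complexifyBy D (g * h) x = complexifyBy D g (complexifyBy D h x)
        have hg : xG g = 0 ∨ xG g = 1 := by generalize xG g = a; revert a; decide
        have hh : xG h = 0 ∨ xG h = 1 := by generalize xG h = a; revert a; decide
        have e : xG (g * h) = xG g + xG h := rfl
        have e2 : (1 + 1 : ZMod 2) = 0 := by decide
        induction x using TensorProduct.induction_on with
        | zero => simp
        | tmul c a =>
          rw [complexifyBy_tmul, complexifyBy_tmul, complexifyBy_tmul, Prod.fst_mul, map_mul, e]
          rcases hg with hg | hg <;> rcases hh with hh | hh <;> simp [hg, hh, e2, conj]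
        | add x y hx hy => simp only [map_add, hx, hy] }
  act_smul := by
    intro g c x
    change complexifyBy D g (c • x) = conj (xG g) c • complexifyBy D g x
    induction x using TensorProduct.induction_on with
    | zero => simp
    | tmul d a => simp [TensorProduct.smul_tmul', complexifyBy_tmul]
    | add x y hx hy => simp only [smul_add, map_add, hx, hy]

end BDI

end

open scoped TensorProduct Quaternion

noncomputable section

namespace BDI

/-! ### Signs and the elements of the symmetry group -/

/-! Everything rests on the fact that an SRE algebra carries exactly three signs of information,
recorded by `HasType A a b c`. If `A ≅ End U` (`c = 0`), the automorphisms of `p` and `t` are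
implemented by a linear `P` and an antilinear `T`, unique up to scalars by Schur's lemma, which can
be normalised to `P² = 1`, `T² = (-1)^a`, `TP = (-1)^b PT`. If `A ≅ End U × End U` with `p`
exchanging the factors (`c = 1`), exactly one of `t` and `pt`, namely `tb b`, preserves the factors,
and it is implemented by an antilinear `T` with `T² = (-1)^a`. A rescaling of `T` multiplies `T²` by
a positive number only, so no sign can be removed (`HasType.unique`).

The signs are the invariants: the class of a twisted cocycle on `ℤ₂ᵀ` is read off from `α(t,t) +
α(1,1)`, which is `0` or `1/2`, and the formula for `β` is the commutation sign of `T` with the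
normalised `P` (`hasInvariants_iff`). For the converse direction an invariant inner product is
obtained by averaging.

They classify Morita classes. For equal types the spaces `Hom(U', U)` form an equivariant Morita
context, since all signs occur twice and cancel (`HasType.moritaEquivalent`); conversely a context
carries a model `U` of `B` to the model `Hom_B(N, U)` of `A` (`HasType.of_moritaEquivalent`). For
stacking, the supertensor product acts on `V ⊗ U` with an odd `b` acting as `P ⊗ b`; surjectivity
and a dimension count give a model, and the squares and commutators of the new operators give the
stacking law (`HasType.stack`). That this law on triples of signs is addition in `ℤ/8` is a finite
check (`typeEquiv_add`).

On the real side, adjoining an odd generator to a superalgebra amounts to stacking its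
complexification with that of a Clifford algebra on one generator
(`RealSuperAlgebra.hasType_adjoin`). Together with the types of `ℝ` and `ℍ` this gives the whole
table and all `Cℓ_{n,0}`. The complexification of a central super-division algebra is graded simple,
hence typed (`GradedSimple.exists_hasType`), hence Morita equivalent to one in the table. Passing to
the fixed points of `t` makes this a Morita equivalence over `ℝ` (`MoritaEquivalent.descend`), and
Morita equivalent super-division algebras are isomorphic because a homogeneous pair with pairing `1`
identifies them. -/

/-- The sign `(-1)^a`. -/
def sgn (a : ZMod 2) : ℤ := if a = 0 then 1 else -1

lemma zmod_two_cases (a : ZMod 2) : a = 0 ∨ a = 1 := by revert a; decide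

@[simp] lemma sgn_zero : sgn 0 = 1 := rfl

@[simp] lemma sgn_one : sgn 1 = -1 := rfl

lemma sgn_add (a b : ZMod 2) : sgn (a + b) = sgn a * sgn b := by
  revert a b; decide

lemma sgn_mul_self (a : ZMod 2) : sgn a * sgn a = 1 := by
  revert a; decide

lemma sgn_injective : Function.Injective sgn := by
  unfold Function.Injective; decide

lemma units_smul_eq_sgn {M : Type*} [AddCommGroup M] (a : ZMod 2) (m : M) :
    ((-1 : ℤˣ) ^ a) • m = sgn a • m := by
  rcases zmod_two_cases a with rfl | rfl <;> simp

/-- The generator of time reversal twisted by `p ^ b`. -/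
def tb (b : ZMod 2) : G := (Multiplicative.ofAdd b, Multiplicative.ofAdd 1)

@[simp] lemma xG_tb (b : ZMod 2) : xG (tb b) = 1 := rfl

@[simp] lemma xG_p : xG p = 0 := rfl

@[simp] lemma conj_zero : conj 0 = RingHom.id ℂ := rfl

@[simp] lemma conj_one : conj 1 = starRingEnd ℂ := rfl

lemma tb_mul_tb (b : ZMod 2) : tb b * tb b = 1 := by revert b; decide

lemma p_mul_p : p * p = 1 := by decide

lemma p_mul_tb (b : ZMod 2) : p * tb b = tb (b + 1) := by revert b; decide

lemma tb_mul_p (b : ZMod 2) : tb b * p = tb (b + 1) := by revert b; decide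

/-- The group is generated by `p` and any one of the two time reversals; the choice of `b` lets odd
models use the reversal that preserves their factors. -/
lemma group_induction (b : ZMod 2) {C : G → Prop} (h1 : C 1) (hp : C p) (ht : C (tb b))
    (hmul : ∀ g h, C g → C h → C (g * h)) (g : G) : C g := by
  have key : ∀ (b : ZMod 2) (g : G), g = 1 ∨ g = p ∨ g = tb b ∨ g = p * tb b := by decide
  rcases key b g with rfl | rfl | rfl | rfl
  exacts [h1, hp, ht, hmul _ _ hp ht]

/-- The action of the symmetry group that is determined by commuting involutions. -/
def actOfInvolutions {M : Type*} [Monoid M] (b : ZMod 2) (P T : M) (hP : P * P = 1)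
    (hT : T * T = 1) (hPT : T * P = P * T) : G →* M where
  -- On `tb b` both `triv` and `b * xG` equal `b`, so the power of `P` cancels and `tb b` acts as
  -- `T` alone; on `p` only one factor `P` is left.
  toFun g := P ^ (b * xG g + triv g).val * T ^ (xG g).val
  map_one' := by simp [xG, xb, triv]
  map_mul' g h := by
    have e1 : xG (g * h) = xG g + xG h := rfl
    have e2 : triv (g * h) = triv g + triv h := rfl
    have key : ∀ (Q : M), Q * Q = 1 → ∀ i j : ZMod 2, Q ^ (i + j).val = Q ^ i.val * Q ^ j.val := by
      intro Q hQ i j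
      have e : (1 + 1 : ZMod 2) = 0 := by decide
      have e1 : (1 : ZMod 2).val = 1 := rfl
      rcases zmod_two_cases i with rfl | rfl <;> rcases zmod_two_cases j with rfl | rfl <;>
        simp [e, e1, hQ]
    have hc : ∀ i j : ℕ, T ^ i * P ^ j = P ^ j * T ^ i :=
      fun i j => ((show Commute T P from hPT).pow_pow i j).eq
    rw [e1, e2, mul_add, add_add_add_comm, key P hP, key T hT, mul_assoc, mul_assoc,
      ← mul_assoc (T ^ _) (P ^ _), hc, mul_assoc]

lemma actOfInvolutions_p {M : Type*} [Monoid M] (b : ZMod 2) (P T : M) (hP : P * P = 1)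
    (hT : T * T = 1) (hPT : T * P = P * T) : actOfInvolutions b P T hP hT hPT p = P := by
  have e1 : (1 : ZMod 2).val = 1 := rfl
  simp [actOfInvolutions, p, xG, xb, triv, e1]

lemma actOfInvolutions_tb {M : Type*} [Monoid M] (b : ZMod 2) (P T : M) (hP : P * P = 1)
    (hT : T * T = 1) (hPT : T * P = P * T) : actOfInvolutions b P T hP hT hPT (tb b) = T := by
  have e1 : (1 : ZMod 2).val = 1 := rfl
  have e2 : b + b = 0 := CharTwo.add_self_eq_zero b
  simp [actOfInvolutions, tb, xG, xb, triv, e1, e2]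

namespace EquivariantAlgebra

section

variable {k H : Type} [CommRing k] [Group H] {σ : H → k →+* k}

lemma act_mul_apply (A : EquivariantAlgebra σ) (g h : H) (x : A.carrier) :
    A.act (g * h) x = A.act g (A.act h x) := by
  rw [map_mul]; rfl

lemma act_one_apply (A : EquivariantAlgebra σ) (x : A.carrier) : A.act 1 x = x := by
  rw [map_one]; rfl

/-- The inverse isomorphism. -/
def Iso.symm {A B : EquivariantAlgebra σ} (e : A.Iso B) : B.Iso A where
  toAlgEquiv := e.toAlgEquiv.symm
  map_act g b := by
    rw [AlgEquiv.symm_apply_eq, e.map_act, AlgEquiv.apply_symm_apply]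

end

variable (A : EqAlg)

lemma act_tb_tb (b : ZMod 2) (x : A.carrier) : A.act (tb b) (A.act (tb b) x) = x := by
  rw [← act_mul_apply, tb_mul_tb, act_one_apply]

lemma act_tb_p (b : ZMod 2) (x : A.carrier) : A.act (tb b) (A.act p x) = A.act (tb (b + 1)) x := by
  rw [← act_mul_apply, tb_mul_p]

lemma act_p_tb (b : ZMod 2) (x : A.carrier) : A.act p (A.act (tb b) x) = A.act (tb (b + 1)) x := by
  rw [← act_mul_apply, p_mul_tb]

lemma act_tb_smul (b : ZMod 2) (c : ℂ) (x : A.carrier) :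
    A.act (tb b) (c • x) = starRingEnd ℂ c • A.act (tb b) x := A.act_smul _ _ _

/-- Fermion parity as an algebra homomorphism. -/
def parity : A.carrier →ₐ[ℂ] A.carrier :=
  { A.act p with
    commutes' := by
      intro c
      have h := A.act_p_smul c 1
      rw [map_one, ← Algebra.algebraMap_eq_smul_one] at h
      exact h }

@[simp] lemma parity_apply (x : A.carrier) : A.parity x = A.act p x := rfl

end EquivariantAlgebra

/-! ### Models of even and odd algebras -/

/-- An algebra with the underlying complex algebra `End U` on which fermion parity acts through
`P` and time reversal through `T`. -/
structure EvenModel (A : EqAlg) (a b : ZMod 2) where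
  U : Type
  [addCommGroup : AddCommGroup U]
  [module : Module ℂ U]
  [finiteDimensional : FiniteDimensional ℂ U]
  [nontrivial : Nontrivial U]
  φ : A.carrier →ₐ[ℂ] Module.End ℂ U
  bijective : Function.Bijective φ
  P : U →ₗ[ℂ] U
  T : U →ₛₗ[starRingEnd ℂ] U
  P_P : ∀ u, P (P u) = u
  T_T : ∀ u, T (T u) = sgn a • u
  T_P : ∀ u, T (P u) = sgn b • P (T u)
  P_φ : ∀ x u, P (φ x u) = φ (A.act p x) (P u)
  T_φ : ∀ x u, T (φ x u) = φ (A.act (tb 0) x) (T u)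

/-- An algebra with the underlying complex algebra `End U × End U`, whose factors are exchanged by
fermion parity and preserved by `tb b`, which acts through `T`. -/
structure OddModel (A : EqAlg) (a b : ZMod 2) where
  U : Type
  [addCommGroup : AddCommGroup U]
  [module : Module ℂ U]
  [finiteDimensional : FiniteDimensional ℂ U]
  [nontrivial : Nontrivial U]
  φ : A.carrier →ₐ[ℂ] Module.End ℂ U
  bijective : Function.Bijective (fun x => (φ x, φ (A.act p x)))
  T : U →ₛₗ[starRingEnd ℂ] U
  T_T : ∀ u, T (T u) = sgn a • u
  T_φ : ∀ x u, T (φ x u) = φ (A.act (tb b) x) (T u)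

attribute [instance] EvenModel.addCommGroup EvenModel.module EvenModel.finiteDimensional
  EvenModel.nontrivial OddModel.addCommGroup OddModel.module OddModel.finiteDimensional
  OddModel.nontrivial

/-- `A` is an even (`c = 0`) or odd (`c = 1`) algebra with the signs `a` and `b`. -/
def HasType (A : EqAlg) (a b c : ZMod 2) : Prop :=
  if c = 0 then Nonempty (EvenModel A a b) else Nonempty (OddModel A a b)

lemma hasType_zero {A : EqAlg} {a b : ZMod 2} :
    HasType A a b 0 ↔ Nonempty (EvenModel A a b) := by simp [HasType]

lemma hasType_one {A : EqAlg} {a b : ZMod 2} :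
    HasType A a b 1 ↔ Nonempty (OddModel A a b) := by simp [HasType]

/-- Transport of a model along an isomorphism. -/
def EvenModel.ofIso {A B : EqAlg} {a b : ZMod 2} (e : A.Iso B) (m : EvenModel B a b) :
    EvenModel A a b where
  U := m.U
  φ := m.φ.comp e.toAlgEquiv.toAlgHom
  bijective := m.bijective.comp e.toAlgEquiv.bijective
  P := m.P
  T := m.T
  P_P := m.P_P
  T_T := m.T_T
  T_P := m.T_P
  P_φ x u := by simp [m.P_φ, e.map_act]
  T_φ x u := by simp [m.T_φ, e.map_act]

/-- Transport of a model along an isomorphism. -/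
def OddModel.ofIso {A B : EqAlg} {a b : ZMod 2} (e : A.Iso B) (m : OddModel B a b) :
    OddModel A a b where
  U := m.U
  φ := m.φ.comp e.toAlgEquiv.toAlgHom
  bijective := by
    have h := m.bijective.comp e.toAlgEquiv.bijective
    convert h using 2 with x
    simp [e.map_act]
  T := m.T
  T_T := m.T_T
  T_φ x u := by simp [m.T_φ, e.map_act]

lemma HasType.ofIso {A B : EqAlg} {a b c : ZMod 2} (e : A.Iso B) (h : HasType B a b c) :
    HasType A a b c := by
  rcases zmod_two_cases c with rfl | rfl
  · rw [hasType_zero] at *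
    exact h.map (EvenModel.ofIso e)
  · rw [hasType_one] at *
    exact h.map (OddModel.ofIso e)

/-! ### Operators on finite-dimensional complex vector spaces -/

section Operators

variable {U : Type*} [AddCommGroup U]

lemma sgn_smul_smul (a : ZMod 2) (u : U) : sgn a • sgn a • u = u := by
  rw [smul_smul, sgn_mul_self, one_smul]

lemma map_sgn_smul {U' F : Type*} [AddCommGroup U'] [FunLike F U U'] [AddMonoidHomClass F U U']
    (T : F) (a : ZMod 2) (u : U) : T (sgn a • u) = sgn a • T u := map_zsmul T _ _

variable [Module ℂ U]

lemma sgn_cast_smul (a : ZMod 2) (u : U) : (sgn a : ℂ) • u = sgn a • u :=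
  Int.cast_smul_eq_zsmul ℂ _ _

lemma smul_right_cancel_of_nontrivial [Nontrivial U] {c d : ℂ} (h : ∀ u : U, c • u = d • u) :
    c = d := by
  obtain ⟨u, hu⟩ := exists_ne (0 : U)
  exact smul_left_injective ℂ hu (h u)

lemma sgn_smul_injective [Nontrivial U] {a b : ZMod 2} (h : ∀ u : U, sgn a • u = sgn b • u) :
    a = b := by
  refine sgn_injective (Int.cast_injective (α := ℂ) (smul_right_cancel_of_nontrivial (U := U) ?_))
  simpa only [sgn_cast_smul] using h

/-- Schur's lemma by rank-one operators: with `f u = 1`, commuting with `w ↦ f w • v` and evaluating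
at `u` gives `F v = f (F u) • v`. -/
lemma exists_scalar_of_commute [Nontrivial U] (F : U →ₗ[ℂ] U)
    (h : ∀ (M : Module.End ℂ U) (u : U), F (M u) = M (F u)) : ∃ c : ℂ, ∀ u, F u = c • u := by
  obtain ⟨u, hu⟩ := exists_ne (0 : U)
  obtain ⟨f, hf⟩ := Module.Projective.exists_dual_eq_one ℂ hu
  refine ⟨f (F u), fun v => ?_⟩
  have := h (f.smulRight v) u
  simpa [hf] using this

lemma exists_scalar_of_commute_surjective [Nontrivial U] {R : Type*} {φ : R → Module.End ℂ U}
    (hφ : Function.Surjective φ) (F : U →ₗ[ℂ] U)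
    (h : ∀ (x : R) (u : U), F (φ x u) = φ x (F u)) : ∃ c : ℂ, ∀ u, F u = c • u := by
  refine exists_scalar_of_commute F fun M u => ?_
  obtain ⟨x, rfl⟩ := hφ M
  exact h x u

lemma exists_sgn_of_sq_eq_one {c : ℂ} (h : c * c = 1) : ∃ a : ZMod 2, c = (sgn a : ℂ) := by
  rcases mul_self_eq_one_iff.mp h with rfl | rfl
  · exact ⟨0, by simp⟩
  · exact ⟨1, by simp⟩

/-- An antilinear operator whose square is a nonzero scalar can be normalised. -/
lemma exists_normalized_antilinear [Nontrivial U] (T : U →ₛₗ[starRingEnd ℂ] U)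
    (d : ℂ) (hd : d ≠ 0) (hT : ∀ u, T (T u) = d • u) :
    ∃ (a : ZMod 2) (r : ℝ), r ≠ 0 ∧ ∀ u, (r : ℂ) • T ((r : ℂ) • T u) = sgn a • u := by
  -- Evaluate `T³` in two ways: `T ∘ T²` gives the conjugate of `d`, `T² ∘ T` gives `d`. As `T` is
  -- surjective, `d` is real.
  have hconj : starRingEnd ℂ d = d := by
    refine smul_right_cancel_of_nontrivial (U := U) fun u => ?_
    obtain ⟨v, rfl⟩ : ∃ v, u = T v := ⟨starRingEnd ℂ d⁻¹ • T u, by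
      rw [map_smulₛₗ, hT, smul_smul]; simp [hd]⟩
    rw [← map_smulₛₗ, ← hT, hT (T v)]
  obtain ⟨x, rfl⟩ := Complex.conj_eq_iff_real.mp hconj
  have hx : x ≠ 0 := by rintro rfl; simp at hd
  have hr : (√|x|) ≠ 0 := Real.sqrt_ne_zero'.mpr (abs_pos.mpr hx)
  have hs : √|x| * √|x| = |x| := Real.mul_self_sqrt (abs_nonneg x)
  -- A real factor `r` multiplies the square of `T` by `r²`, so the absolute value of `x` can be
  -- removed and its sign cannot.
  have key : ∀ u, (((√|x|)⁻¹ : ℝ) : ℂ) • T ((((√|x|)⁻¹ : ℝ) : ℂ) • T u) =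
      ((|x|⁻¹ * x : ℝ) : ℂ) • u := by
    intro u
    rw [map_smulₛₗ, hT, smul_smul, smul_smul, Complex.conj_ofReal, ← Complex.ofReal_mul,
      ← Complex.ofReal_mul, ← mul_inv, hs]
  rcases lt_or_gt_of_ne hx with h | h
  · refine ⟨1, (√|x|)⁻¹, inv_ne_zero hr, fun u => ?_⟩
    rw [key, abs_of_neg h, inv_neg, neg_mul, inv_mul_cancel₀ hx]
    simp
  · refine ⟨0, (√|x|)⁻¹, inv_ne_zero hr, fun u => ?_⟩
    rw [key, abs_of_pos h, inv_mul_cancel₀ hx]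
    simp

end Operators

/-! ### Existence and isomorphisms of models -/

/-- The operators `P²`, `T²` and `PTPT` commute with all of `End U`, so they are scalars. A complex
square root turns the first into `1`, a real factor turns the second into a sign, and the third then
squares to `1`. -/
lemma EvenModel.exists_of_operators (A : EqAlg) {U : Type} [AddCommGroup U] [Module ℂ U]
    [FiniteDimensional ℂ U] [Nontrivial U] (φ : A.carrier →ₐ[ℂ] Module.End ℂ U)
    (hφ : Function.Bijective φ) (P : U →ₗ[ℂ] U) (T : U →ₛₗ[starRingEnd ℂ] U)
    (hP : Function.Injective P) (hT : Function.Injective T)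
    (hPφ : ∀ x u, P (φ x u) = φ (A.act p x) (P u))
    (hTφ : ∀ x u, T (φ x u) = φ (A.act (tb 0) x) (T u)) :
    ∃ a b, Nonempty (EvenModel A a b) := by
  obtain ⟨u₀, hu₀⟩ := exists_ne (0 : U)
  obtain ⟨c, hc⟩ := exists_scalar_of_commute_surjective hφ.2 (P ∘ₗ P)
    (fun x u => by simp [hPφ, A.act_p_act_p])
  have hc0 : c ≠ 0 := by
    rintro rfl
    have := hc u₀
    rw [zero_smul, LinearMap.comp_apply, ← map_zero P, hP.eq_iff, ← map_zero P, hP.eq_iff] at this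
    exact hu₀ this
  obtain ⟨e, he⟩ := IsAlgClosed.exists_pow_nat_eq c⁻¹ (n := 2) (by norm_num)
  obtain ⟨d, hd⟩ := exists_scalar_of_commute_surjective hφ.2 (T.comp T : U →ₗ[ℂ] U)
    (fun x u => by simp [hTφ, A.act_tb_tb])
  have hd0 : d ≠ 0 := by
    rintro rfl
    have := hd u₀
    rw [zero_smul, LinearMap.comp_apply, ← map_zero T, hT.eq_iff, ← map_zero T, hT.eq_iff] at this
    exact hu₀ this
  obtain ⟨a, r, hr, ha⟩ := exists_normalized_antilinear T d hd0 hd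
  set P' : U →ₗ[ℂ] U := e • P with hP'
  set T' : U →ₛₗ[starRingEnd ℂ] U := (r : ℂ) • T with hT'
  have hPP : ∀ u, P' (P' u) = u := by
    intro u
    have := hc u
    simp only [LinearMap.comp_apply] at this
    simp only [hP', LinearMap.smul_apply, map_smul, this, smul_smul]
    rw [← mul_assoc, ← sq, he, inv_mul_cancel₀ hc0, one_smul]
  have hTT : ∀ u, T' (T' u) = sgn a • u := ha
  have hPφ' : ∀ x u, P' (φ x u) = φ (A.act p x) (P' u) := by
    intro x u; simp [hP', hPφ]
  have hTφ' : ∀ x u, T' (φ x u) = φ (A.act (tb 0) x) (T' u) := by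
    intro x u; simp [hT', hTφ]
  obtain ⟨f, hf⟩ := exists_scalar_of_commute_surjective hφ.2
    (P' ∘ₗ (T'.comp (P'.comp T') : U →ₗ[ℂ] U))
    (fun x u => by
      simp only [LinearMap.comp_apply, hPφ', hTφ']
      rw [A.act_tb_p, A.act_p_tb, show (0 + 1 + 1 : ZMod 2) = 0 from rfl, A.act_tb_tb])
  simp only [LinearMap.comp_apply] at hf
  have hTPT : ∀ u, T' (P' (T' u)) = f • P' u := by
    intro u; rw [← hPP (T' _), hf, map_smul]
  have hff : f * f = 1 := by
    refine smul_right_cancel_of_nontrivial (U := U) fun u => ?_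
    have h1 : T' (P' (T' (T' (P' (T' u))))) = u := by
      rw [hTT, map_sgn_smul, hPP, map_sgn_smul, hTT, sgn_smul_smul]
    rw [hTPT, hTPT, map_smul, hPP, smul_smul] at h1
    rw [one_smul, h1]
  obtain ⟨s, rfl⟩ := exists_sgn_of_sq_eq_one hff
  -- From `TPT = (-1)^s P`, applied to `T u`, and `T² = (-1)^a` follows `TP = (-1)^(a+s) PT`.
  refine ⟨a, a + s, ⟨⟨U, φ, hφ, P', T', hPP, hTT, fun u => ?_, hPφ', hTφ'⟩⟩⟩
  have h := hTPT (T' u)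
  rw [hTT, map_sgn_smul, map_sgn_smul, sgn_cast_smul] at h
  rw [sgn_add, mul_smul, ← h, sgn_smul_smul]

/-- Parity only exchanges the two factors and needs no operator, so `T` is the only thing to
normalise. -/
lemma OddModel.exists_of_operators (A : EqAlg) {U : Type} [AddCommGroup U] [Module ℂ U]
    [FiniteDimensional ℂ U] [Nontrivial U] (φ : A.carrier →ₐ[ℂ] Module.End ℂ U)
    (hφ : Function.Bijective (fun x => (φ x, φ (A.act p x)))) (b : ZMod 2)
    (T : U →ₛₗ[starRingEnd ℂ] U) (hT : Function.Injective T)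
    (hTφ : ∀ x u, T (φ x u) = φ (A.act (tb b) x) (T u)) :
    ∃ a, Nonempty (OddModel A a b) := by
  obtain ⟨u₀, hu₀⟩ := exists_ne (0 : U)
  have hs : Function.Surjective φ := fun M => by
    obtain ⟨x, hx⟩ := hφ.2 (M, 0)
    exact ⟨x, congrArg Prod.fst hx⟩
  obtain ⟨d, hd⟩ := exists_scalar_of_commute_surjective hs (T.comp T : U →ₗ[ℂ] U)
    (fun x u => by simp [hTφ, A.act_tb_tb])
  have hd0 : d ≠ 0 := by
    rintro rfl
    have := hd u₀
    rw [zero_smul, LinearMap.comp_apply, ← map_zero T, hT.eq_iff, ← map_zero T, hT.eq_iff] at this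
    exact hu₀ this
  obtain ⟨a, r, hr, ha⟩ := exists_normalized_antilinear T d hd0 hd
  exact ⟨a, ⟨⟨U, φ, hφ, (r : ℂ) • T, ha, fun x u => by simp [hTφ]⟩⟩⟩

/-- The algebra isomorphism to `End U`. -/
def EvenModel.equiv {A : EqAlg} {a b : ZMod 2} (m : EvenModel A a b) :
    A.carrier ≃ₐ[ℂ] Module.End ℂ m.U := AlgEquiv.ofBijective m.φ m.bijective

/-- The algebra isomorphism to `End U × End U`. -/
def OddModel.equiv {A : EqAlg} {a b : ZMod 2} (m : OddModel A a b) :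
    A.carrier ≃ₐ[ℂ] Module.End ℂ m.U × Module.End ℂ m.U :=
  AlgEquiv.ofBijective (m.φ.prod (m.φ.comp A.parity)) m.bijective

lemma OddModel.ext_φ {A : EqAlg} {a b : ZMod 2} (m : OddModel A a b) {x y : A.carrier}
    (h : m.φ x = m.φ y) (h' : m.φ (A.act p x) = m.φ (A.act p y)) : x = y :=
  m.bijective.1 (Prod.ext h h')

lemma OddModel.exists_φ {A : EqAlg} {a b : ZMod 2} (m : OddModel A a b)
    (M N : Module.End ℂ m.U) : ∃ x, m.φ x = M ∧ m.φ (A.act p x) = N := by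
  obtain ⟨x, hx⟩ := m.bijective.2 (M, N)
  exact ⟨x, congrArg Prod.fst hx, congrArg Prod.snd hx⟩

/-- Algebras with isomorphic models are isomorphic. -/
def EvenModel.iso {A B : EqAlg} {a b a' b' : ZMod 2} (m : EvenModel A a b) (m' : EvenModel B a' b')
    (S : m.U ≃ₗ[ℂ] m'.U) (hP : ∀ u, S (m.P u) = m'.P (S u)) (hT : ∀ u, S (m.T u) = m'.T (S u)) :
    A.Iso B where
  toAlgEquiv := (m.equiv.trans (S.conjAlgEquiv ℂ)).trans m'.equiv.symm
  map_act g := by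
    set e := (m.equiv.trans (S.conjAlgEquiv ℂ)).trans m'.equiv.symm with he
    have h : ∀ x u, m'.φ (e x) (S u) = S (m.φ x u) := by
      intro x u
      have : m'.φ (e x) = S.conjAlgEquiv ℂ (m.φ x) := m'.equiv.apply_symm_apply _
      rw [this, LinearEquiv.conjAlgEquiv_apply]
      simp
    induction g using group_induction 0 with
    | h1 => intro x; rw [A.act_one_apply, B.act_one_apply]
    | hp =>
      intro x
      refine m'.bijective.1 (LinearMap.ext fun u => ?_)
      obtain ⟨u, rfl⟩ := S.surjective u
      obtain ⟨u, rfl⟩ : ∃ v, u = m.P v := ⟨m.P u, (m.P_P u).symm⟩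
      rw [h, ← m.P_φ, hP, hP, ← m'.P_φ, h]
    | ht =>
      intro x
      refine m'.bijective.1 (LinearMap.ext fun u => ?_)
      obtain ⟨u, rfl⟩ := S.surjective u
      obtain ⟨u, rfl⟩ : ∃ v, u = m.T v := ⟨sgn a • m.T u, by
        rw [map_sgn_smul, m.T_T, sgn_smul_smul]⟩
      rw [h, ← m.T_φ, hT, hT, ← m'.T_φ, h]
    | hmul g g' hg hg' =>
      intro x
      rw [A.act_mul_apply, B.act_mul_apply, hg, hg']

/-- Algebras with isomorphic models are isomorphic. -/
def OddModel.iso {A B : EqAlg} {a b a' : ZMod 2} (m : OddModel A a b) (m' : OddModel B a' b)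
    (S : m.U ≃ₗ[ℂ] m'.U) (hT : ∀ u, S (m.T u) = m'.T (S u)) : A.Iso B where
  toAlgEquiv := (m.equiv.trans ((S.conjAlgEquiv ℂ).prodCongr (S.conjAlgEquiv ℂ))).trans m'.equiv.symm
  map_act g := by
    set e := (m.equiv.trans ((S.conjAlgEquiv ℂ).prodCongr (S.conjAlgEquiv ℂ))).trans m'.equiv.symm
    have h0 : ∀ x, (m'.φ (e x), m'.φ (B.act p (e x))) =
        (S.conjAlgEquiv ℂ (m.φ x), S.conjAlgEquiv ℂ (m.φ (A.act p x))) :=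
      fun x => m'.equiv.apply_symm_apply _
    have h : ∀ x u, m'.φ (e x) (S u) = S (m.φ x u) := by
      intro x u
      have hx : m'.φ (e x) = _ := (Prod.ext_iff.mp (h0 x)).1
      rw [hx, LinearEquiv.conjAlgEquiv_apply]
      simp
    have h' : ∀ x u, m'.φ (B.act p (e x)) (S u) = S (m.φ (A.act p x) u) := by
      intro x u
      have hx : m'.φ (B.act p (e x)) = _ := (Prod.ext_iff.mp (h0 x)).2
      rw [hx, LinearEquiv.conjAlgEquiv_apply]
      simp
    induction g using group_induction b with
    | h1 => intro x; rw [A.act_one_apply, B.act_one_apply]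
    | hp =>
      intro x
      refine m'.ext_φ (LinearMap.ext fun u => ?_) (LinearMap.ext fun u => ?_)
      · obtain ⟨u, rfl⟩ := S.surjective u
        rw [h, h']
      · obtain ⟨u, rfl⟩ := S.surjective u
        rw [h', B.act_p_act_p, A.act_p_act_p, h]
    | ht =>
      intro x
      refine m'.ext_φ (LinearMap.ext fun u => ?_) (LinearMap.ext fun u => ?_) <;>
      obtain ⟨u, rfl⟩ := S.surjective u <;>
      obtain ⟨u, rfl⟩ : ∃ v, u = m.T v := ⟨sgn a • m.T u, by
        rw [map_sgn_smul, m.T_T, sgn_smul_smul]⟩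
      · rw [h, ← m.T_φ, hT, hT, ← m'.T_φ, h]
      · rw [h', A.act_p_tb, B.act_p_tb, ← A.act_tb_p, ← B.act_tb_p, ← m.T_φ, hT, hT, ← m'.T_φ, h']
    | hmul g g' hg hg' =>
      intro x
      rw [A.act_mul_apply, B.act_mul_apply, hg, hg']

/-! ### The operators of a projective representation -/

/-- The phase `exp (2 π i θ)`. -/
def phaseFactor (θ : UnitAddCircle) : ℂ := (AddCircle.toCircle θ : ℂ)

lemma phaseFactor_add (θ η : UnitAddCircle) :
    phaseFactor (θ + η) = phaseFactor θ * phaseFactor η := by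
  simp [phaseFactor, AddCircle.toCircle_add]

lemma phaseFactor_zero : phaseFactor 0 = 1 := by simp [phaseFactor]

lemma phaseFactor_neg (θ : UnitAddCircle) : phaseFactor (-θ) = starRingEnd ℂ (phaseFactor θ) := by
  rw [phaseFactor, AddCircle.toCircle_neg, Circle.coe_inv_eq_conj]; rfl

lemma norm_phaseFactor (θ : UnitAddCircle) : ‖phaseFactor θ‖ = 1 := Circle.norm_coe _

lemma phaseFactor_injective : Function.Injective phaseFactor :=
  fun _ _ h => AddCircle.injective_toCircle one_ne_zero (Circle.ext h)

lemma phaseFactor_half (a : ZMod 2) : phaseFactor (half a) = (sgn a : ℂ) := by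
  rcases zmod_two_cases a with rfl | rfl
  · simp [half, phaseFactor]
  · have e1 : (1 : ZMod 2).val = 1 := rfl
    rw [phaseFactor, half, AddCircle.toCircle_apply_mk, Circle.coe_exp, e1]
    simp only [sgn_one]
    push_cast
    rw [show (2 * (Real.pi : ℂ) / 1 * (1 / 2) * Complex.I) = Real.pi * Complex.I by ring,
      Complex.exp_pi_mul_I]

lemma half_injective : Function.Injective half := fun a b h => by
  have := congrArg phaseFactor h
  rw [phaseFactor_half, phaseFactor_half] at this
  exact sgn_injective (Int.cast_injective this)

namespace ProjRep

variable {H : Type} [Group H] {x : H → ZMod 2} (V : ProjRep x)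

lemma Q_mul' (g h : H) (u : V.U) :
    V.Q g (V.Q h u) = phaseFactor (V.ω g h) • V.Q (g * h) u := V.Q_mul g h u

/-- A linear operator of a projective representation. -/
def linearOp (g : H) (hg : x g = 0) : V.U →ₗ[ℂ] V.U where
  toFun := V.Q g
  map_add' := map_add _
  map_smul' c u := by rw [V.Q_smul, hg]; rfl

@[simp] lemma linearOp_apply (g : H) (hg : x g = 0) (u : V.U) : V.linearOp g hg u = V.Q g u := rfl

/-- An antilinear operator of a projective representation. -/
def antilinearOp (g : H) (hg : x g = 1) : V.U →ₛₗ[starRingEnd ℂ] V.U where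
  toFun := V.Q g
  map_add' := map_add _
  map_smul' c u := by rw [V.Q_smul, hg]; rfl

@[simp] lemma antilinearOp_apply (g : H) (hg : x g = 1) (u : V.U) :
    V.antilinearOp g hg u = V.Q g u := rfl

lemma ω_one_left (h : H) : V.ω 1 h = 0 := by
  refine phaseFactor_injective (smul_right_cancel_of_nontrivial (U := V.U) fun u => ?_)
  obtain ⟨u, rfl⟩ := (V.Q h).surjective u
  have := V.Q_mul' 1 h u
  rw [V.Q_one, one_mul] at this
  rw [← this, phaseFactor_zero, one_smul]

end ProjRep

/-- The identity, as a homomorphism to `End U`. -/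
def evenAlgEval (V : ProjRep xG) : (evenAlg V).carrier →ₐ[ℂ] Module.End ℂ V.U :=
  AlgHom.id ℂ (Module.End ℂ V.U)

lemma evenAlgEval_act (V : ProjRep xG) (g : G) (M : (evenAlg V).carrier) (u : V.U) :
    V.Q g (evenAlgEval V M u) = evenAlgEval V ((evenAlg V).act g M) (V.Q g u) := by
  have key : ∀ N : Module.End ℂ V.U, V.Q g (N u) = V.conjBy g N (V.Q g u) := by intro N; simp
  exact key M

/-- The sum of the coefficients, as a homomorphism `End U ⊗ Cℓ(1) → End U`, `Γ ↦ 1`. -/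
def oddAlgEval (V : ProjRep xb) : OddCarrier V →ₐ[ℂ] Module.End ℂ V.U :=
  AddMonoidAlgebra.liftNCAlgHom (AlgHom.id ℂ _) 1 (fun _ _ => Commute.one_right _)

@[simp] lemma oddAlgEval_single (V : ProjRep xb) (m : ZMod 2) (M : Module.End ℂ V.U) :
    oddAlgEval V (AddMonoidAlgebra.single m M) = M := by
  simp [oddAlgEval, AddMonoidAlgebra.liftNCAlgHom]

lemma oddAlgEval_act (V : ProjRep xb) (β : H1) (g : G) (M N : Module.End ℂ V.U) :
    oddAlgEval V ((oddAlg V β).act g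
      (AddMonoidAlgebra.single 0 M + AddMonoidAlgebra.single 1 N : OddCarrier V)) =
      V.conjBy g.2 M + sgn (β (Additive.ofMul g.2) + triv g) • V.conjBy g.2 N := by
  change oddAlgEval V (oddBy V β g
    (AddMonoidAlgebra.single 0 M + AddMonoidAlgebra.single 1 N : OddCarrier V)) = _
  rw [map_add, map_add, oddBy_single, oddBy_single, oddAlgEval_single, oddAlgEval_single,
    mul_zero, mul_one, units_smul_eq_sgn, units_smul_eq_sgn,
    sgn_zero, one_smul]

lemma oddCarrier_eq (V : ProjRep xb) (f : OddCarrier V) :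
    ∃ M N : Module.End ℂ V.U, f = AddMonoidAlgebra.single 0 M + AddMonoidAlgebra.single 1 N := by
  induction f using AddMonoidAlgebra.induction_linear with
  | zero => exact ⟨0, 0, by simp⟩
  | add f g hf hg =>
    obtain ⟨M, N, rfl⟩ := hf
    obtain ⟨M', N', rfl⟩ := hg
    exact ⟨M + M', N + N', by rw [AddMonoidAlgebra.single_add, AddMonoidAlgebra.single_add]; abel⟩
  | single m M =>
    rcases zmod_two_cases m with rfl | rfl
    · exact ⟨M, 0, by simp⟩
    · exact ⟨0, M, by simp⟩

/-- The operator of the generator of time reversal. -/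
def ProjRep.timeReversal (V : ProjRep xb) : V.U →ₛₗ[starRingEnd ℂ] V.U :=
  V.antilinearOp (Multiplicative.ofAdd 1) rfl

@[simp] lemma ProjRep.timeReversal_apply (V : ProjRep xb) (u : V.U) :
    V.timeReversal u = V.Q (Multiplicative.ofAdd 1) u := rfl

/-- The evaluations `Γ ↦ 1` and `Γ ↦ -1` send `M + NΓ` to `(M + N, M - N)`, and this is inverted by
dividing by two. -/
lemma oddAlgEval_bijective (V : ProjRep xb) (β : H1) : Function.Bijective
    (fun f : (oddAlg V β).carrier => (oddAlgEval V f, oddAlgEval V ((oddAlg V β).act p f))) := by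
  have hp : ∀ M N : Module.End ℂ V.U, oddAlgEval V ((oddAlg V β).act p
      (AddMonoidAlgebra.single 0 M + AddMonoidAlgebra.single 1 N : OddCarrier V)) = M - N := by
    intro M N
    rw [oddAlgEval_act]
    simp [p, triv, V.conjBy_one, sub_eq_add_neg]
  constructor
  · intro f g hfg
    obtain ⟨M, N, rfl⟩ := oddCarrier_eq V f
    obtain ⟨M', N', rfl⟩ := oddCarrier_eq V g
    have h1 := congrArg Prod.fst hfg
    have h2 := congrArg Prod.snd hfg
    simp only [hp] at h2
    simp only [map_add, oddAlgEval_single] at h1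
    have e1 : (2 : ℂ) • M = (2 : ℂ) • M' := by
      rw [two_smul, two_smul]
      calc M + M = (M + N) + (M - N) := by abel
        _ = (M' + N') + (M' - N') := by rw [h1, h2]
        _ = M' + M' := by abel
    have e2 : M = M' := smul_right_injective _ (two_ne_zero) e1
    subst e2
    rw [add_right_inj] at h1
    rw [h1]
  · rintro ⟨M, N⟩
    refine ⟨(AddMonoidAlgebra.single 0 ((2⁻¹ : ℂ) • (M + N)) +
      AddMonoidAlgebra.single 1 ((2⁻¹ : ℂ) • (M - N)) : OddCarrier V), ?_⟩
    simp only [hp, map_add, oddAlgEval_single]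
    rw [← smul_add, ← smul_sub, add_add_sub_cancel, add_sub_sub_cancel, ← two_smul ℂ M,
      ← two_smul ℂ N, smul_smul, smul_smul]
    norm_num

/-- For the reversal `tb b` the contributions of `β` and of the fermion parity to the sign of `Γ`
cancel, so it fixes `Γ` and is compatible with `Γ ↦ 1`. -/
lemma timeReversal_oddAlgEval (V : ProjRep xb) (β : H1) (b : ZMod 2)
    (hb : β (Additive.ofMul (Multiplicative.ofAdd 1)) = b) (f : (oddAlg V β).carrier) (u : V.U) :
    V.timeReversal (oddAlgEval V f u) =
      oddAlgEval V ((oddAlg V β).act (tb b) f) (V.timeReversal u) := by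
  obtain ⟨M, N, rfl⟩ := oddCarrier_eq V f
  have hb2 : b + b = 0 := CharTwo.add_self_eq_zero b
  rw [oddAlgEval_act, map_add, oddAlgEval_single, oddAlgEval_single]
  simp [tb, triv, hb, hb2]

/-- Every SRE algebra has a model. -/
lemma IsSRE.exists_hasType {A : EqAlg} (h : IsSRE A) : ∃ a b c, HasType A a b c := by
  rcases h with ⟨V, ⟨e⟩⟩ | ⟨V, β, ⟨e⟩⟩
  · obtain ⟨a, b, ⟨m⟩⟩ := EvenModel.exists_of_operators (evenAlg V)
      (evenAlgEval V) Function.bijective_id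
      (V.linearOp p xG_p) (V.antilinearOp (tb 0) (xG_tb 0)) (V.Q p).injective (V.Q (tb 0)).injective
      (evenAlgEval_act V p) (evenAlgEval_act V (tb 0))
    exact ⟨a, b, 0, hasType_zero.mpr ⟨m.ofIso e⟩⟩
  · obtain ⟨a, ⟨m⟩⟩ := OddModel.exists_of_operators (oddAlg V β) (oddAlgEval V)
      (oddAlgEval_bijective V β) _ V.timeReversal (V.Q _).injective
      (timeReversal_oddAlgEval V β _ rfl)
    exact ⟨a, _, 1, hasType_one.mpr ⟨m.ofIso e⟩⟩

/-! ### The cohomology groups of `ℤ₂ᵀ` -/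

open groupCohomology

/-- The generator of `ℤ₂ᵀ`. -/
def tGen : Gb := Multiplicative.ofAdd 1

lemma gb_cases (g : Gb) : g = 1 ∨ g = tGen := by revert g; decide

lemma tGen_mul_tGen : tGen * tGen = 1 := by decide

lemma twist_one (θ : UnitAddCircle) : twist 1 θ = θ := by simp [twist, xb]

lemma twist_tGen (θ : UnitAddCircle) : twist tGen θ = -θ := by simp [twist, xb, tGen]

/-- The value that determines the class of a cocycle. -/
def cocycleValue (α : cocycles₂ U1T) : UnitAddCircle :=
  (α (tGen, tGen) : UnitAddCircle) + (α (1, 1) : UnitAddCircle)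

lemma cocycle_one_tGen (α : cocycles₂ U1T) :
    (α (1, tGen) : UnitAddCircle) = α (1, 1) := cocycles₂_map_one_fst α tGen

lemma cocycle_tGen_one (α : cocycles₂ U1T) :
    (α (tGen, 1) : UnitAddCircle) = -(α (1, 1) : UnitAddCircle) :=
  (cocycles₂_map_one_snd α tGen).trans (twist_tGen _)

/-- This is the cocycle identity at `(t, t, t)`, with `α(1, t) = α(1, 1)` and `α(t, 1) = -α(1, 1)`
inserted. It leaves only the two values `0` and `1/2`. -/
lemma cocycleValue_add_self (α : cocycles₂ U1T) : cocycleValue α + cocycleValue α = 0 := by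
  have h : (α (tGen * tGen, tGen) : UnitAddCircle) + (α (tGen, tGen) : UnitAddCircle) =
      twist tGen (α (tGen, tGen)) + (α (tGen, tGen * tGen) : UnitAddCircle) :=
    (mem_cocycles₂_iff (α : Gb × Gb → U1T)).mp α.2 tGen tGen tGen
  rw [tGen_mul_tGen, cocycle_one_tGen, cocycle_tGen_one, twist_tGen] at h
  unfold cocycleValue
  generalize (α (1, 1) : UnitAddCircle) = v at h ⊢
  generalize (α (tGen, tGen) : UnitAddCircle) = w at h ⊢
  calc w + v + (w + v) = (v + w) + (w + v) := by abel
    _ = 0 := by rw [h]; abel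

lemma exists_half_of_add_self {θ : UnitAddCircle} (h : θ + θ = 0) : ∃ a, θ = half a := by
  have h1 : phaseFactor θ * phaseFactor θ = 1 := by
    rw [← phaseFactor_add, h, phaseFactor_zero]
  obtain ⟨a, ha⟩ := exists_sgn_of_sq_eq_one h1
  exact ⟨a, phaseFactor_injective (by rw [ha, phaseFactor_half])⟩

lemma H2π_eq_zero_iff_cocycleValue (α : cocycles₂ U1T) :
    H2π U1T α = 0 ↔ cocycleValue α = 0 := by
  rw [H2π_eq_zero_iff]
  constructor
  · rintro ⟨c, hc⟩
    have h : ∀ g h : Gb, (α (g, h) : UnitAddCircle) =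
        twist g (c h) - (c (g * h) : UnitAddCircle) + c g :=
      fun g h => (congrFun hc (g, h)).symm
    unfold cocycleValue
    rw [h, h, twist_one, twist_tGen, tGen_mul_tGen, one_mul]
    abel
  · intro h
    -- The coboundary of a constant cochain `v` is `(g, h) ↦ g · v`, which agrees with a cocycle of
    -- value zero on all four pairs when `v = α(1, 1)`.
    refine ⟨fun _ => α (1, 1), ?_⟩
    have h' : (α (tGen, tGen) : UnitAddCircle) = -(α (1, 1) : UnitAddCircle) :=
      eq_neg_of_add_eq_zero_left h
    have key : ∀ g h : Gb, twist g (α (1, 1)) - (α (1, 1) : UnitAddCircle) +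
        (α (1, 1) : UnitAddCircle) = α (g, h) := by
      intro g h
      rw [sub_add_cancel]
      rcases gb_cases g with rfl | rfl <;> rcases gb_cases h with rfl | rfl
      · rw [twist_one]
      · rw [twist_one, cocycle_one_tGen]
      · rw [twist_tGen, cocycle_tGen_one]
      · rw [twist_tGen, h']
    exact funext fun gh => key gh.1 gh.2

lemma cocycleValue_sub (α α' : cocycles₂ U1T) :
    cocycleValue (α - α') = cocycleValue α - cocycleValue α' := by
  change ((α (tGen, tGen) : UnitAddCircle) - (α' (tGen, tGen) : UnitAddCircle)) +
    ((α (1, 1) : UnitAddCircle) - (α' (1, 1) : UnitAddCircle)) = _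
  unfold cocycleValue
  abel

lemma H2π_eq_iff_cocycleValue (α α' : cocycles₂ U1T) :
    H2π U1T α = H2π U1T α' ↔ cocycleValue α = cocycleValue α' := by
  rw [← sub_eq_zero, ← map_sub, H2π_eq_zero_iff_cocycleValue, cocycleValue_sub, sub_eq_zero]

/-- The cocycle `(g, h) ↦ a x(g) x(h) / 2`. -/
def alphaCocycle (a : ZMod 2) : cocycles₂ U1T :=
  if a = 0 then 0 else halfCupCocycle xClass xClass

lemma H2π_alphaCocycle (a : ZMod 2) : H2π U1T (alphaCocycle a) = alphaClass a := by
  unfold alphaCocycle alphaClass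
  split_ifs
  · exact map_zero _
  · rfl

lemma alphaCocycle_apply (a : ZMod 2) (g h : Gb) :
    (alphaCocycle a (g, h) : UnitAddCircle) = half (a * xb g * xb h) := by
  rcases zmod_two_cases a with rfl | rfl
  · rw [zero_mul, zero_mul]
    rw [alphaCocycle, if_pos rfl]
    change (0 : UnitAddCircle) = half 0
    simp [half]
  · rw [one_mul]
    rfl

lemma cocycleValue_alphaCocycle (a : ZMod 2) : cocycleValue (alphaCocycle a) = half a := by
  unfold cocycleValue
  rw [alphaCocycle_apply, alphaCocycle_apply]
  have e1 : xb tGen = 1 := rfl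
  have e2 : xb 1 = 0 := rfl
  rw [e1, e2, mul_one, mul_one, mul_zero, ← half_add, add_zero]

lemma H2π_eq_alphaClass_iff (α : cocycles₂ U1T) (a : ZMod 2) :
    H2π U1T α = alphaClass a ↔ cocycleValue α = half a := by
  rw [← H2π_alphaCocycle, H2π_eq_iff_cocycleValue, cocycleValue_alphaCocycle]

lemma exists_eq_alphaClass (x : H2) : ∃ a, x = alphaClass a := by
  induction x using H2_induction_on with
  | h α =>
    obtain ⟨a, ha⟩ := exists_half_of_add_self (cocycleValue_add_self α)
    exact ⟨a, (H2π_eq_alphaClass_iff α a).mpr ha⟩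

lemma alphaClass_injective : Function.Injective alphaClass := fun a a' h => by
  rw [← H2π_alphaCocycle, H2π_eq_alphaClass_iff, cocycleValue_alphaCocycle] at h
  exact half_injective h

lemma halfCup_eq (β₁ β₂ : H1) :
    halfCup β₁ β₂ = alphaClass (β₁ (Additive.ofMul tGen) * β₂ (Additive.ofMul tGen)) := by
  rw [halfCup, H2π_eq_alphaClass_iff]
  change half _ + half (β₁ 0 * β₂ 0) = _
  rw [map_zero, zero_mul, ← half_add, add_zero]

lemma alphaClass_add (a a' : ZMod 2) : alphaClass (a + a') = alphaClass a + alphaClass a' := by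
  symm
  rw [← H2π_alphaCocycle, ← H2π_alphaCocycle, ← map_add, H2π_eq_alphaClass_iff, half_add,
    ← cocycleValue_alphaCocycle a, ← cocycleValue_alphaCocycle a']
  change ((alphaCocycle a (tGen, tGen) : UnitAddCircle) + alphaCocycle a' (tGen, tGen)) +
    ((alphaCocycle a (1, 1) : UnitAddCircle) + (alphaCocycle a' (1, 1) : UnitAddCircle)) = _
  unfold cocycleValue
  abel

lemma betaClass_apply (b : ZMod 2) (g : Gb) : betaClass b (Additive.ofMul g) = b * xb g := by
  rcases zmod_two_cases b with rfl | rfl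
  · simp [betaClass]
  · rw [one_mul]; rfl

lemma H1_ext {β β' : H1} (h : β (Additive.ofMul tGen) = β' (Additive.ofMul tGen)) : β = β' := by
  refine DFunLike.ext _ _ fun g => ?_
  rcases gb_cases g.toMul with hg | hg
  · rw [show g = 0 from hg, map_zero, map_zero]
  · rw [show g = Additive.ofMul tGen from hg, h]

lemma betaClass_tGen (b : ZMod 2) : betaClass b (Additive.ofMul tGen) = b := by
  rw [betaClass_apply]; exact mul_one b

lemma eq_betaClass (β : H1) : β = betaClass (β (Additive.ofMul tGen)) :=
  H1_ext (betaClass_tGen _).symm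

lemma betaClass_injective : Function.Injective betaClass := fun b b' h => by
  rw [← betaClass_tGen b, h, betaClass_tGen]

lemma betaClass_add (b b' : ZMod 2) : betaClass (b + b') = betaClass b + betaClass b' :=
  H1_ext (by rw [AddMonoidHom.add_apply, betaClass_tGen, betaClass_tGen, betaClass_tGen])

lemma betaClass_one : betaClass 1 = xClass := rfl

/-- The classes `alphaClass a`, `betaClass b` are all classes. -/
def invariantsEquiv : ZMod 2 × ZMod 2 × ZMod 2 ≃ Invariants :=
  Equiv.ofBijective (fun i => (alphaClass i.1, betaClass i.2.1, i.2.2))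
    ⟨fun i j h => by
      simp only [Prod.mk.injEq] at h
      exact Prod.ext (alphaClass_injective h.1) (Prod.ext (betaClass_injective h.2.1) h.2.2),
    fun ⟨x, β, c⟩ => by
      obtain ⟨a, rfl⟩ := exists_eq_alphaClass x
      exact ⟨(a, β (Additive.ofMul tGen), c), by simp [← eq_betaClass]⟩⟩

lemma invariantsEquiv_apply (a b c : ZMod 2) :
    invariantsEquiv (a, b, c) = (alphaClass a, betaClass b, c) := rfl

lemma card_H2 : Nat.card H2 = 2 := by
  rw [← Nat.card_congr (Equiv.ofBijective alphaClass ⟨alphaClass_injective, fun x =>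
    (exists_eq_alphaClass x).imp fun _ h => h.symm⟩)]
  simp

lemma card_H1 : Nat.card H1 = 2 := by
  rw [← Nat.card_congr (Equiv.ofBijective betaClass ⟨betaClass_injective, fun β =>
    ⟨_, (eq_betaClass β).symm⟩⟩)]
  simp

/-! ### Invariants and models -/

/-- The operators of the projective representation form a model once `Q(p)` is divided by a square
root of `Q(p)²`. The antilinear `Q(t)` conjugates this phase, so the commutation sign acquires the
term `ω(p, p)`; this is the origin of `x(g) ω(p, p)` in the formula for `β`. -/
lemma HasInvariants.hasType {A : EqAlg} {a b c : ZMod 2}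
    (h : HasInvariants A (alphaClass a, betaClass b, c)) : HasType A a b c := by
  rcases h with ⟨V, α, β, ⟨e⟩, hα, hβ, hi⟩ | ⟨V, α, β, ⟨e⟩, hα, hi⟩
  · simp only [Prod.mk.injEq] at hi
    obtain ⟨h1, h2, rfl⟩ := hi
    subst h2
    rw [eq_comm, H2π_eq_alphaClass_iff] at h1
    have hωT : V.ω (tb 0) (tb 0) = half a := by
      -- As `Q(1) = 1`, the cocycle is normalised, and the invariant value is just `ω(t, t)`.
      have h11 : (α (1, 1) : UnitAddCircle) = 0 := (hα 1 1).trans (V.ω_one_left 1)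
      rw [cocycleValue, h11, add_zero] at h1
      exact (hα tGen tGen).symm.trans h1
    have hωTP : V.ω (tb 0) p = half b + V.ω p (tb 0) + -V.ω p p := by
      have := hβ (tb 0)
      rw [betaClass_apply, show xb (tb 0).2 = 1 from rfl, mul_one, xG_tb,
        show (1 : ZMod 2).val = 1 from rfl, one_smul] at this
      rw [this]; abel
    obtain ⟨ν, hν⟩ : ∃ ν : UnitAddCircle, ν + ν = V.ω p p := by
      induction V.ω p p using QuotientAddGroup.induction_on with
      | H r => exact ⟨((r / 2 : ℝ) : UnitAddCircle), by rw [← AddCircle.coe_add, add_halves]⟩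
    refine hasType_zero.mpr ⟨EvenModel.ofIso e
      { U := V.U
        φ := evenAlgEval V
        bijective := Function.bijective_id
        P := phaseFactor (-ν) • V.linearOp p xG_p
        T := V.antilinearOp (tb 0) (xG_tb 0)
        P_P := fun u => ?_
        T_T := fun u => ?_
        T_P := fun u => ?_
        P_φ := fun M u => ?_
        T_φ := evenAlgEval_act V (tb 0) }⟩
    · simp only [LinearMap.smul_apply, ProjRep.linearOp_apply, V.Q_smul, xG_p, conj_zero,
        RingHom.id_apply, V.Q_mul', p_mul_p, V.Q_one]
      rw [smul_smul, smul_smul, ← phaseFactor_add, ← phaseFactor_add, ← hν,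
        show -ν + -ν + (ν + ν) = 0 by abel, phaseFactor_zero, one_smul]
    · simp only [ProjRep.antilinearOp_apply, V.Q_mul', tb_mul_tb, V.Q_one, hωT, phaseFactor_half,
        sgn_cast_smul]
    · simp only [ProjRep.antilinearOp_apply, LinearMap.smul_apply, ProjRep.linearOp_apply,
        V.Q_smul, xG_tb, conj_one, V.Q_mul']
      rw [← phaseFactor_neg, hωTP, ← sgn_cast_smul, ← phaseFactor_half, smul_smul, smul_smul,
        smul_smul, ← phaseFactor_add, ← phaseFactor_add, ← phaseFactor_add, ← hν, p_mul_tb,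
        tb_mul_p]
      congr 2
      abel
    · simp only [LinearMap.smul_apply, ProjRep.linearOp_apply, map_smul, evenAlgEval_act V p M]
  · simp only [Prod.mk.injEq] at hi
    obtain ⟨h1, h2, rfl⟩ := hi
    subst h2
    rw [eq_comm, H2π_eq_alphaClass_iff] at h1
    have hωT : V.ω tGen tGen = half a := by
      have h11 : (α (1, 1) : UnitAddCircle) = 0 := (hα 1 1).trans (V.ω_one_left 1)
      rw [cocycleValue, h11, add_zero] at h1
      exact (hα tGen tGen).symm.trans h1
    refine hasType_one.mpr ⟨OddModel.ofIso e
      { U := V.U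
        φ := oddAlgEval V
        bijective := oddAlgEval_bijective V (betaClass b)
        T := V.timeReversal
        T_T := fun u => ?_
        T_φ := timeReversal_oddAlgEval V (betaClass b) b (betaClass_tGen b) }⟩
    change V.Q tGen (V.Q tGen u) = _
    rw [V.Q_mul', tGen_mul_tGen, V.Q_one, hωT, phaseFactor_half, sgn_cast_smul]

/-- Average the standard inner product over the group, conjugating the summands of antilinear `g` so
that the sum is sesquilinear in the correct arguments. The multipliers are phases, so right
translation permutes the summands of the squared norm. -/
lemma exists_invariant_core {H : Type} [Group H] [Fintype H] (x : H → ZMod 2) {U : Type}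
    [AddCommGroup U] [Module ℂ U] [FiniteDimensional ℂ U] (Q : H → U →+ U)
    (hsmul : ∀ g (c : ℂ) u, Q g (c • u) = conj (x g) c • Q g u) (hone : ∀ u, Q 1 u = u)
    (hmul : ∀ g h u, ∃ c : ℂ, ‖c‖ = 1 ∧ Q g (Q h u) = c • Q (g * h) u) :
    ∃ c : InnerProductSpace.Core ℂ U, ∀ g u, c.inner (Q g u) (Q g u) = c.inner u u := by
  let n := Module.finrank ℂ U
  let e : U ≃ₗ[ℂ] EuclideanSpace ℂ (Fin n) :=
    LinearEquiv.ofFinrankEq U _ (by simp [n])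
  have hc : ∀ (a : ZMod 2) (z : ℂ), starRingEnd ℂ (conj a z) = conj a (starRingEnd ℂ z) := by
    intro a z; unfold conj; split_ifs <;> simp
  have hre : ∀ (a : ZMod 2) (z : ℂ), (conj a z).re = z.re := by
    intro a z; unfold conj; split_ifs <;> simp
  have hself : ∀ v : EuclideanSpace ℂ (Fin n), inner ℂ v v = ((‖v‖ ^ 2 : ℝ) : ℂ) := by
    intro v; rw [inner_self_eq_norm_sq_to_K]; norm_cast
  have hsum : ∀ u, ∑ g, conj (x g) (inner ℂ (e (Q g u)) (e (Q g u))) =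
      ((∑ g, ‖e (Q g u)‖ ^ 2 : ℝ) : ℂ) := by
    intro u
    push_cast
    exact Finset.sum_congr rfl fun g _ => by rw [hself, conj_real]; push_cast; rfl
  refine ⟨{ inner := fun u v => ∑ g, conj (x g) (inner ℂ (e (Q g u)) (e (Q g v)))
            conj_inner_symm := fun u v => ?_
            re_inner_nonneg := fun u => ?_
            add_left := fun u v w => ?_
            smul_left := fun u v r => ?_
            definite := fun u hu => ?_ }, fun g u => ?_⟩
  · rw [map_sum]
    exact Finset.sum_congr rfl fun g _ => by rw [hc, inner_conj_symm]
  · rw [hsum]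
    change 0 ≤ (Complex.ofReal _).re
    rw [Complex.ofReal_re]
    exact Finset.sum_nonneg fun _ _ => sq_nonneg _
  · rw [← Finset.sum_add_distrib]
    exact Finset.sum_congr rfl fun g _ => by rw [map_add, map_add, inner_add_left, map_add]
  · rw [Finset.mul_sum]
    exact Finset.sum_congr rfl fun g _ => by
      rw [hsmul, map_smul, inner_smul_left, map_mul, hc, conj_conj]
  · have hu' : ∑ g, conj (x g) (inner ℂ (e (Q g u)) (e (Q g u))) = 0 := hu
    rw [hsum, Complex.ofReal_eq_zero, Finset.sum_eq_zero_iff_of_nonneg (fun _ _ => by positivity)]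
      at hu'
    have := hu' 1 (Finset.mem_univ _)
    rw [hone] at this
    simpa using this
  · change ∑ h, conj (x h) (inner ℂ (e (Q h (Q g u))) (e (Q h (Q g u)))) =
      ∑ h, conj (x h) (inner ℂ (e (Q h u)) (e (Q h u)))
    rw [hsum, hsum, ← Equiv.sum_comp (Equiv.mulRight g) (fun h => ‖e (Q h u)‖ ^ 2)]
    congr 1
    refine Finset.sum_congr rfl fun h _ => ?_
    obtain ⟨c, hc1, hc2⟩ := hmul h g u
    rw [hc2, map_smul, norm_smul, hc1, one_mul]
    rfl

/-- Operators that form a projective representation are unitary or anti-unitary for a suitable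
inner product. -/
lemma exists_projRep {H : Type} [Group H] [Fintype H] (x : H → ZMod 2) {U : Type}
    [AddCommGroup U] [Module ℂ U] [FiniteDimensional ℂ U] [Nontrivial U] (Q : H → U ≃+ U)
    (hsmul : ∀ g (c : ℂ) u, Q g (c • u) = conj (x g) c • Q g u) (hone : ∀ u, Q 1 u = u)
    (ω : H → H → UnitAddCircle)
    (hmul : ∀ g h u, Q g (Q h u) = phaseFactor (ω g h) • Q (g * h) u) :
    ∃ V : ProjRep x, V.ω = ω ∧ ∃ S : U ≃ₗ[ℂ] V.U, ∀ g u, S (Q g u) = V.Q g (S u) := by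
  obtain ⟨c, hc⟩ := exists_invariant_core x (fun g => (Q g).toAddMonoidHom) hsmul hone
    (fun g h u => ⟨_, norm_phaseFactor _, hmul g h u⟩)
  let : NormedAddCommGroup U := c.toNormedAddCommGroup
  let : InnerProductSpace ℂ U := InnerProductSpace.ofCore c.toCore
  have hn : ∀ g u, ‖Q g u‖ = ‖u‖ := by
    intro g u
    have h1 : inner ℂ (Q g u) (Q g u) = inner ℂ u u := hc g u
    rw [@norm_eq_sqrt_re_inner ℂ, h1, ← @norm_eq_sqrt_re_inner ℂ]
  exact ⟨{ U := U, Q := Q, Q_smul := hsmul, norm_Q := hn, Q_one := hone, ω := ω, Q_mul := hmul },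
    rfl, LinearEquiv.refl ℂ U, fun _ _ => rfl⟩

/-- The additive automorphism of an operator with invertible square. -/
def addEquivOfSq {U F : Type*} [AddCommGroup U] [FunLike F U U] [AddMonoidHomClass F U U]
    (T : F) (a : ZMod 2) (hT : ∀ u, T (T u) = sgn a • u) : U ≃+ U where
  toFun := T
  invFun u := sgn a • T u
  left_inv u := by simp only [hT, sgn_smul_smul]
  right_inv u := by simp only [map_sgn_smul, hT, sgn_smul_smul]
  map_add' := map_add T

@[simp] lemma addEquivOfSq_apply {U F : Type*} [AddCommGroup U] [FunLike F U U]
    [AddMonoidHomClass F U U] (T : F) (a : ZMod 2) (hT : ∀ u, T (T u) = sgn a • u) (u : U) :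
    addEquivOfSq T a hT u = T u := rfl

/-- Take `Q(g) = P^(triv g) T^(x g)`. Moving `T` past `P` costs the sign `b`, and collecting two
factors `T` costs the sign `a`; this dictates the formula for `ω`. -/
lemma EvenModel.hasInvariants {A : EqAlg} {a b : ZMod 2} (m : EvenModel A a b) :
    HasInvariants A (alphaClass a, betaClass b, 0) := by
  let Pe : m.U ≃+ m.U := addEquivOfSq m.P 0 (fun u => by simp [m.P_P])
  let Te : m.U ≃+ m.U := addEquivOfSq m.T a m.T_T
  let Q : G → m.U ≃+ m.U := fun g =>
    (if xG g = 0 then AddEquiv.refl m.U else Te).trans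
      (if triv g = 0 then AddEquiv.refl m.U else Pe)
  obtain ⟨V, hω, S, hS⟩ := exists_projRep xG Q
    (by
      intro g c u
      have h2 := zmod_two_cases (xG g)
      have h3 := zmod_two_cases (triv g)
      rcases h2 with h2 | h2 <;> rcases h3 with h3 | h3 <;> simp [Q, h2, h3, Pe, Te])
    (by intro u; simp [Q, xG, xb, triv])
    (fun g h => half (b * xG g * triv h + a * xG g * xG h))
    (by
      intro g h u
      have e1 : xG (g * h) = xG g + xG h := rfl
      have e2 : triv (g * h) = triv g + triv h := rfl
      have e3 : (1 + 1 : ZMod 2) = 0 := rfl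
      rw [phaseFactor_half, sgn_cast_smul, sgn_add, mul_smul]
      simp only [Q, e1, e2]
      rcases zmod_two_cases (xG g) with h1 | h1 <;> rcases zmod_two_cases (xG h) with h2 | h2 <;>
      rcases zmod_two_cases (triv g) with h3 | h3 <;>
      rcases zmod_two_cases (triv h) with h4 | h4 <;>
      simp [h1, h2, h3, h4, e3, Pe, Te, m.P_P, m.T_T, m.T_P, map_sgn_smul, -zsmul_eq_mul])
  have hV : ∀ g h, V.ω g h = half (b * xG g * triv h + a * xG g * xG h) := fun g h => by rw [hω]
  refine Or.inl ⟨V, alphaCocycle a, betaClass b, ⟨m.iso (a' := a) (b' := b)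
    { U := V.U
      φ := evenAlgEval V
      bijective := Function.bijective_id
      P := V.linearOp p xG_p
      T := V.antilinearOp (tb 0) (xG_tb 0)
      P_P := fun u => ?_
      T_T := fun u => ?_
      T_P := fun u => ?_
      P_φ := evenAlgEval_act V p
      T_φ := evenAlgEval_act V (tb 0) } S (fun u => ?_) (fun u => ?_)⟩, fun g h => ?_,
      fun g => ?_, ?_⟩
  · obtain ⟨u, rfl⟩ := S.surjective u
    simp [← hS, Q, Pe, xG, xb, triv, p, m.P_P]
  · obtain ⟨u, rfl⟩ := S.surjective u
    simp [← hS, Q, Te, xG, xb, triv, tb, m.T_T]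
  · obtain ⟨u, rfl⟩ := S.surjective u
    simp [← hS, Q, Te, Pe, xG, xb, triv, tb, m.T_P, p]
  · exact (by simp [Q, Pe, xG, xb, triv, p] : S (m.P u) = S (Q p u)).trans (hS p u)
  · exact (by simp [Q, Te, xG, xb, triv, tb] : S (m.T u) = S (Q (tb 0) u)).trans (hS (tb 0) u)
  · rw [alphaCocycle_apply, hV]
    simp [s, xG, triv]
  · rw [hV, hV, hV, betaClass_apply]
    simp [p, triv, xG, xb, half]
  · rw [H2π_alphaCocycle]

lemma OddModel.hasInvariants {A : EqAlg} {a b : ZMod 2} (m : OddModel A a b) :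
    HasInvariants A (alphaClass a, betaClass b, 1) := by
  let Te : m.U ≃+ m.U := addEquivOfSq m.T a m.T_T
  let Q : Gb → m.U ≃+ m.U := fun g => if xb g = 0 then AddEquiv.refl m.U else Te
  obtain ⟨V, hω, S, hS⟩ := exists_projRep xb Q
    (by
      intro g c u
      rcases zmod_two_cases (xb g) with h2 | h2 <;> simp [Q, h2, Te])
    (by intro u; simp [Q, xb])
    (fun g h => half (a * xb g * xb h))
    (by
      intro g h u
      have e1 : xb (g * h) = xb g + xb h := rfl
      have e3 : (1 + 1 : ZMod 2) = 0 := rfl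
      rw [phaseFactor_half, sgn_cast_smul]
      simp only [Q, e1]
      rcases zmod_two_cases (xb g) with h1 | h1 <;> rcases zmod_two_cases (xb h) with h2 | h2 <;>
      simp [h1, h2, e3, Te, m.T_T])
  have hV : ∀ g h, V.ω g h = half (a * xb g * xb h) := fun g h => by rw [hω]
  refine Or.inr ⟨V, alphaCocycle a, betaClass b, ⟨m.iso (a' := a) (b := b)
    { U := V.U
      φ := oddAlgEval V
      bijective := oddAlgEval_bijective V (betaClass b)
      T := V.timeReversal
      T_T := fun u => ?_
      T_φ := timeReversal_oddAlgEval V (betaClass b) b (betaClass_tGen b) } S (fun u => ?_)⟩,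
      fun g h => ?_, ?_⟩
  · obtain ⟨u, rfl⟩ := S.surjective u
    simp [← hS, Q, Te, xb, m.T_T]
  · exact (by simp [Q, Te, xb, tGen] : S (m.T u) = S (Q tGen u)).trans (hS tGen u)
  · rw [alphaCocycle_apply, hV]
  · rw [H2π_alphaCocycle]

lemma hasInvariants_iff {A : EqAlg} {a b c : ZMod 2} :
    HasInvariants A (alphaClass a, betaClass b, c) ↔ HasType A a b c := by
  refine ⟨HasInvariants.hasType, fun h => ?_⟩
  rcases zmod_two_cases c with rfl | rfl
  · exact (hasType_zero.mp h).elim fun m => m.hasInvariants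
  · exact (hasType_one.mp h).elim fun m => m.hasInvariants

lemma HasType.isSRE {A : EqAlg} {a b c : ZMod 2} (h : HasType A a b c) : IsSRE A := by
  rcases hasInvariants_iff.mpr h with ⟨V, -, -, e, -⟩ | ⟨V, -, β, e, -⟩
  exacts [Or.inl ⟨V, e⟩, Or.inr ⟨V, β, e⟩]

/-! ### Algebras of the same type are Morita equivalent -/

/-- An algebra with the underlying complex algebra `I → End U` on which fermion parity permutes the
factors through `σ` and `tb e` preserves them. -/
structure SplitModel (A : EqAlg) (I : Type) (σ : I → I) (e a b : ZMod 2) where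
  U : Type
  [addCommGroup : AddCommGroup U]
  [module : Module ℂ U]
  [finiteDimensional : FiniteDimensional ℂ U]
  [nontrivial : Nontrivial U]
  φ : I → A.carrier →ₐ[ℂ] Module.End ℂ U
  bijective : Function.Bijective (fun x i => φ i x)
  P : U →ₗ[ℂ] U
  T : U →ₛₗ[starRingEnd ℂ] U
  P_P : ∀ u, P (P u) = u
  T_T : ∀ u, T (T u) = sgn a • u
  T_P : ∀ u, T (P u) = sgn b • P (T u)
  P_φ : ∀ i x u, P (φ i x u) = φ (σ i) (A.act p x) (P u)
  T_φ : ∀ i x u, T (φ i x u) = φ i (A.act (tb e) x) (T u)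

attribute [instance] SplitModel.addCommGroup SplitModel.module SplitModel.finiteDimensional
  SplitModel.nontrivial

/-- An even model as a model with one factor. -/
def EvenModel.toSplit {A : EqAlg} {a b : ZMod 2} (m : EvenModel A a b) :
    SplitModel A Unit id 0 a b where
  U := m.U
  φ _ := m.φ
  bijective := ⟨fun x y h => m.bijective.1 (congrFun h ()), fun f => by
    obtain ⟨x, hx⟩ := m.bijective.2 (f ())
    exact ⟨x, funext fun _ => hx⟩⟩
  P := m.P
  T := m.T
  P_P := m.P_P
  T_T := m.T_T
  T_P := m.T_P
  P_φ _ := m.P_φ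
  T_φ _ := m.T_φ

/-- An odd model as a model with two factors. -/
def OddModel.toSplit {A : EqAlg} {a b : ZMod 2} (m : OddModel A a b) :
    SplitModel A Bool not b a 0 where
  U := m.U
  φ i := if i then m.φ.comp A.parity else m.φ
  bijective := ⟨fun x y h => m.ext_φ (congrFun h false) (congrFun h true), fun f => by
    obtain ⟨x, hx, hx'⟩ := m.exists_φ (f false) (f true)
    refine ⟨x, funext fun i => ?_⟩
    cases i
    exacts [hx, hx']⟩
  -- Both factors act on the same space, the second one through parity, so the exchange of the
  -- indices already accounts for parity. This is why the commutation sign is `0` here, while `b`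
  -- appears as the choice of `tb b`.
  P := LinearMap.id
  T := m.T
  P_P _ := rfl
  T_T := m.T_T
  T_P _ := by simp
  P_φ i x u := by cases i <;> simp [A.act_p_act_p]
  T_φ i x u := by cases i <;> simp [m.T_φ, A.act_p_tb, A.act_tb_p]

namespace SplitModel

variable {A B : EqAlg} {I : Type} {σ : I → I} {e a b : ZMod 2}

/-- The algebra isomorphism to `I → End U`. -/
def equiv (m : SplitModel A I σ e a b) : A.carrier ≃+ (I → Module.End ℂ m.U) where
  __ := Equiv.ofBijective _ m.bijective
  map_add' x y := by ext1 i; simp [Equiv.ofBijective]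

lemma φ_equiv_symm (m : SplitModel A I σ e a b) (i : I) (f : I → Module.End ℂ m.U) :
    m.φ i (m.equiv.symm f) = f i :=
  congrFun (m.equiv.apply_symm_apply f) i

lemma ext_φ (m : SplitModel A I σ e a b) {x y : A.carrier} (h : ∀ i, m.φ i x = m.φ i y) : x = y :=
  m.bijective.1 (funext h)

/-- The families of homomorphisms between the spaces of two models. -/
def HomSpace (m : SplitModel A I σ e a b) (m' : SplitModel B I σ e a b) : Type :=
  I → m'.U →ₗ[ℂ] m.U

instance (m : SplitModel A I σ e a b) (m' : SplitModel B I σ e a b) :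
    AddCommGroup (m.HomSpace m') := inferInstanceAs (AddCommGroup (I → m'.U →ₗ[ℂ] m.U))

lemma homSpace_ext {m : SplitModel A I σ e a b} {m' : SplitModel B I σ e a b}
    {X Y : m.HomSpace m'} (h : ∀ i u, X i u = Y i u) : X = Y :=
  funext fun i => LinearMap.ext (h i)

/-- The action of fermion parity on `HomSpace`. -/
def homP (m : SplitModel A I σ e a b) (m' : SplitModel B I σ e a b) :
    AddMonoid.End (m.HomSpace m') where
  toFun X i := m.P ∘ₗ X (σ i) ∘ₗ m'.P
  map_zero' := homSpace_ext fun _ _ => map_zero m.P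
  map_add' _ _ := homSpace_ext fun _ _ => map_add m.P _ _

/-- The action of time reversal on `HomSpace`. -/
def homT (m : SplitModel A I σ e a b) (m' : SplitModel B I σ e a b) :
    AddMonoid.End (m.HomSpace m') where
  -- The inverse of `m'.T` is `sgn a • m'.T`, so this is conjugation of `X` by the two antilinear
  -- operators.
  toFun X i := sgn a • ((m.T.comp (X i)).comp m'.T : m'.U →ₗ[ℂ] m.U)
  map_zero' := homSpace_ext fun i u => show sgn a • m.T 0 = 0 by rw [map_zero, smul_zero]
  map_add' X Y := homSpace_ext fun i u =>
    show sgn a • m.T (X i _ + Y i _) = sgn a • m.T _ + sgn a • m.T _ by rw [map_add, smul_add]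

lemma homP_apply (m : SplitModel A I σ e a b) (m' : SplitModel B I σ e a b) (X : m.HomSpace m')
    (i : I) (u : m'.U) : m.homP m' X i u = m.P (X (σ i) (m'.P u)) := rfl

lemma homT_apply (m : SplitModel A I σ e a b) (m' : SplitModel B I σ e a b) (X : m.HomSpace m')
    (i : I) (u : m'.U) : m.homT m' X i u = sgn a • m.T (X i (m'.T u)) := rfl

instance (m : SplitModel A I σ e a b) (m' : SplitModel B I σ e a b) :
    Module A.carrier (m.HomSpace m') where
  smul x X i := m.φ i x ∘ₗ X i
  one_smul X := homSpace_ext fun i u => show m.φ i 1 _ = _ by rw [map_one]; rfl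
  mul_smul x y X := homSpace_ext fun i u => show m.φ i (x * y) _ = _ by rw [map_mul]; rfl
  smul_zero x := homSpace_ext fun i u => map_zero (m.φ i x)
  smul_add x X Y := homSpace_ext fun i u => map_add (m.φ i x) _ _
  add_smul x y X := homSpace_ext fun i u => show m.φ i (x + y) _ = _ by rw [map_add]; rfl
  zero_smul X := homSpace_ext fun i u => show m.φ i 0 _ = _ by rw [map_zero]; rfl

instance (m : SplitModel A I σ e a b) (m' : SplitModel B I σ e a b) :
    Module (B.carrier)ᵐᵒᵖ (m.HomSpace m') where
  smul y X i := X i ∘ₗ m'.φ i y.unop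
  one_smul X := homSpace_ext fun i u => show X i (m'.φ i 1 u) = _ by rw [map_one]; rfl
  mul_smul x y X := homSpace_ext fun i u =>
    show X i (m'.φ i (y.unop * x.unop) u) = _ by rw [map_mul]; rfl
  smul_zero x := rfl
  smul_add x X Y := rfl
  add_smul x y X := homSpace_ext fun i u =>
    show X i (m'.φ i (x.unop + y.unop) u) = _ by
      rw [map_add, LinearMap.add_apply, map_add]; rfl
  zero_smul X := homSpace_ext fun i u => show X i (m'.φ i 0 u) = _ by
    rw [map_zero, LinearMap.zero_apply, map_zero]; rfl

lemma smul_apply (m : SplitModel A I σ e a b) (m' : SplitModel B I σ e a b) (x : A.carrier)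
    (X : m.HomSpace m') (i : I) (u : m'.U) : (x • X) i u = m.φ i x (X i u) := rfl

lemma op_smul_apply (m : SplitModel A I σ e a b) (m' : SplitModel B I σ e a b) (y : B.carrier)
    (X : m.HomSpace m') (i : I) (u : m'.U) :
    (MulOpposite.op y • X) i u = X i (m'.φ i y u) := rfl

lemma homP_homP (hσ : ∀ i, σ (σ i) = i) (m : SplitModel A I σ e a b)
    (m' : SplitModel B I σ e a b) : m.homP m' * m.homP m' = 1 :=
  AddMonoidHom.ext fun X => homSpace_ext fun i u => by
    change m.homP m' (m.homP m' X) i u = X i u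
    rw [homP_apply, homP_apply, m.P_P, m'.P_P, hσ]

lemma homT_homT (m : SplitModel A I σ e a b) (m' : SplitModel B I σ e a b) :
    m.homT m' * m.homT m' = 1 :=
  AddMonoidHom.ext fun X => homSpace_ext fun i u => by
    change m.homT m' (m.homT m' X) i u = X i u
    rw [homT_apply, homT_apply, map_sgn_smul, sgn_smul_smul, m.T_T, m'.T_T, map_sgn_smul,
      sgn_smul_smul]

/-- The sign `b` arises once from each model and cancels. Operators with different signs would give
only a projective action on `HomSpace`; this is where equality of the types enters. -/
lemma homT_homP (m : SplitModel A I σ e a b) (m' : SplitModel B I σ e a b) :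
    m.homT m' * m.homP m' = m.homP m' * m.homT m' :=
  AddMonoidHom.ext fun X => homSpace_ext fun i u => by
    change m.homT m' (m.homP m' X) i u = m.homP m' (m.homT m' X) i u
    rw [homT_apply, homP_apply, homP_apply, homT_apply, m'.T_P, map_sgn_smul (X (σ i)),
      m.T_P, map_sgn_smul m.P, map_sgn_smul m.T, map_sgn_smul m.P]

/-- `HomSpace` as an equivariant bimodule. -/
def homBimodule (hσ : ∀ i, σ (σ i) = i) (m : SplitModel A I σ e a b)
    (m' : SplitModel B I σ e a b) : EquivariantBimodule A B where
  carrier := m.HomSpace m'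
  smulComm := ⟨fun x y X => rfl⟩
  scalar c X := homSpace_ext fun i u =>
    show m.φ i (algebraMap ℂ _ c) (X i u) = X i (m'.φ i (algebraMap ℂ _ c) u) by
      simp
  act := actOfInvolutions e (m.homP m') (m.homT m') (homP_homP hσ m m') (homT_homT m m')
    (homT_homP m m')
  act_smul g := by
    induction g using group_induction e with
    | h1 => intro x X; rw [map_one, map_one]; rfl
    | hp =>
      intro x X
      rw [actOfInvolutions_p]
      exact homSpace_ext fun i u => show m.P (m.φ (σ i) x _) = m.φ i _ (m.P _) by
        rw [m.P_φ, hσ]; rfl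
    | ht =>
      intro x X
      rw [actOfInvolutions_tb]
      exact homSpace_ext fun i u => show sgn a • m.T (m.φ i x _) = m.φ i _ (sgn a • m.T _) by
        rw [m.T_φ, map_sgn_smul]
    | hmul g h hg hh =>
      intro x X
      have key : ∀ (f : G →* AddMonoid.End (m.HomSpace m')) Y, f (g * h) Y = f g (f h Y) :=
        fun f Y => by rw [map_mul]; rfl
      rw [A.act_mul_apply, key, key, hh, hg]
  act_op_smul g := by
    induction g using group_induction e with
    | h1 => intro x X; rw [map_one, map_one]; rfl
    | hp =>
      intro x X
      rw [actOfInvolutions_p]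
      exact homSpace_ext fun i u =>
        show m.P (X (σ i) (m'.φ (σ i) x (m'.P u))) = m.P (X (σ i) (m'.P (m'.φ i (B.act p x) u))) by
          rw [m'.P_φ, B.act_p_act_p]
    | ht =>
      intro x X
      rw [actOfInvolutions_tb]
      exact homSpace_ext fun i u =>
        show sgn a • m.T (X i (m'.φ i x (m'.T u))) = sgn a • m.T (X i (m'.T (m'.φ i (B.act (tb e) x) u))) by
          rw [m'.T_φ, B.act_tb_tb]
    | hmul g h hg hh =>
      intro x X
      have key : ∀ (f : G →* AddMonoid.End (m.HomSpace m')) Y, f (g * h) Y = f g (f h Y) :=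
        fun f Y => by rw [map_mul]; rfl
      rw [B.act_mul_apply, key, key, hh, hg]

/-- The composition pairing. -/
def homPair (m : SplitModel A I σ e a b) (m' : SplitModel B I σ e a b) :
    m.HomSpace m' →+ m'.HomSpace m →+ A.carrier :=
  AddMonoidHom.mk' (fun X => AddMonoidHom.mk' (fun Y => m.equiv.symm fun i => X i ∘ₗ Y i)
    (fun Y Y' => by
      rw [← map_add]
      exact congrArg _ (funext fun i => LinearMap.ext fun u => map_add (X i) _ _)))
    (fun X X' => AddMonoidHom.ext fun Y => by
      simp only [AddMonoidHom.mk'_apply, AddMonoidHom.add_apply]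
      rw [← map_add]
      congr 1)

lemma φ_homPair (m : SplitModel A I σ e a b) (m' : SplitModel B I σ e a b) (X : m.HomSpace m')
    (Y : m'.HomSpace m) (i : I) (u : m.U) : m.φ i (m.homPair m' X Y) u = X i (Y i u) := by
  change m.φ i (m.equiv.symm fun i => X i ∘ₗ Y i) u = _
  rw [φ_equiv_symm]; rfl

lemma homPair_act (hσ : ∀ i, σ (σ i) = i) (m : SplitModel A I σ e a b)
    (m' : SplitModel B I σ e a b) (g : G) : ∀ (X : m.HomSpace m') (Y : m'.HomSpace m),
    A.act g (m.homPair m' X Y) =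
      m.homPair m' (actOfInvolutions e (m.homP m') (m.homT m') (homP_homP hσ m m')
        (homT_homT m m') (homT_homP m m') g X) (actOfInvolutions e (m'.homP m) (m'.homT m)
        (homP_homP hσ m' m) (homT_homT m' m) (homT_homP m' m) g Y) := by
  induction g using group_induction e with
  | h1 => intro X Y; rw [map_one, map_one, map_one]; rfl
  | hp =>
    intro X Y
    rw [actOfInvolutions_p, actOfInvolutions_p]
    refine m.ext_φ fun i => LinearMap.ext fun u => ?_
    rw [φ_homPair, homP_apply, homP_apply, m'.P_P, ← m.φ_homPair m', m.P_φ, hσ, m.P_P]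
  | ht =>
    intro X Y
    rw [actOfInvolutions_tb, actOfInvolutions_tb]
    refine m.ext_φ fun i => LinearMap.ext fun u => ?_
    rw [φ_homPair, homT_apply, homT_apply, map_sgn_smul m'.T, m'.T_T, sgn_smul_smul,
      ← m.φ_homPair m', m.T_φ, m.T_T, map_sgn_smul, sgn_smul_smul]
  | hmul g h hg hh =>
    intro X Y
    rw [A.act_mul_apply, hh, hg, map_mul, map_mul]; rfl

lemma homPair_smul (m : SplitModel A I σ e a b) (m' : SplitModel B I σ e a b) (x : A.carrier)
    (X : m.HomSpace m') (Y : m'.HomSpace m) :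
    m.homPair m' (x • X) Y = x * m.homPair m' X Y :=
  m.ext_φ fun i => LinearMap.ext fun u => by
    rw [map_mul, Module.End.mul_apply, φ_homPair, φ_homPair, smul_apply]

lemma homPair_op_smul (m : SplitModel A I σ e a b) (m' : SplitModel B I σ e a b) (x : A.carrier)
    (X : m.HomSpace m') (Y : m'.HomSpace m) :
    m.homPair m' X (MulOpposite.op x • Y) = m.homPair m' X Y * x :=
  m.ext_φ fun i => LinearMap.ext fun u => by
    rw [map_mul, Module.End.mul_apply, φ_homPair, φ_homPair, op_smul_apply]

lemma homPair_balanced (m : SplitModel A I σ e a b) (m' : SplitModel B I σ e a b) (y : B.carrier)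
    (X : m.HomSpace m') (Y : m'.HomSpace m) :
    m.homPair m' (MulOpposite.op y • X) Y = m.homPair m' X (y • Y) :=
  m.ext_φ fun i => LinearMap.ext fun u => by
    rw [φ_homPair, φ_homPair, op_smul_apply, smul_apply]

lemma homPair_assoc (m : SplitModel A I σ e a b) (m' : SplitModel B I σ e a b)
    (X : m.HomSpace m') (Y : m'.HomSpace m) (X' : m.HomSpace m') :
    m.homPair m' X Y • X' = MulOpposite.op (m'.homPair m Y X') • X :=
  homSpace_ext fun i u => by rw [smul_apply, op_smul_apply, φ_homPair, φ_homPair]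

/-- Write `x` as the sum of the rank-one operators `u ↦ u_j • x(c_j)` over a basis `c` of `m.U`.
Each of them factors through the line spanned by a vector `u'` of `m'.U`, simultaneously in all
factors of the algebra. -/
lemma homPair_surjective [Finite I] [DecidableEq I] (m : SplitModel A I σ e a b)
    (m' : SplitModel B I σ e a b) :
    AddSubgroup.closure {x | ∃ X Y, m.homPair m' X Y = x} = ⊤ := by
  refine (AddSubgroup.eq_top_iff' _).mpr fun x => ?_
  have := Fintype.ofFinite I
  obtain ⟨u', hu'⟩ := exists_ne (0 : m'.U)
  obtain ⟨f, hf⟩ := Module.Projective.exists_dual_eq_one ℂ hu'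
  let c := Module.finBasis ℂ m.U
  let X : Fin (Module.finrank ℂ m.U) → m.HomSpace m' :=
    fun j i => f.smulRight (m.φ i x (c j))
  let Y : Fin (Module.finrank ℂ m.U) → m'.HomSpace m := fun j _ => (c.coord j).smulRight u'
  have key : ∀ j i u, m.φ i (m.homPair m' (X j) (Y j)) u = c.repr u j • m.φ i x (c j) := by
    intro j i u
    rw [φ_homPair]
    change f (c.repr u j • u') • m.φ i x (c j) = _
    rw [map_smul, hf, smul_eq_mul, mul_one]
  have hx : x = ∑ j, m.homPair m' (X j) (Y j) := by
    refine m.ext_φ fun i => LinearMap.ext fun u => ?_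
    rw [map_sum, LinearMap.sum_apply]
    conv_lhs => rw [← c.sum_repr u, map_sum]
    exact Finset.sum_congr rfl fun j _ => by rw [key, map_smul]
  rw [hx]
  exact AddSubgroup.sum_mem _ fun j _ => AddSubgroup.subset_closure ⟨_, _, rfl⟩

/-- Algebras with models of the same shape are Morita equivalent. -/
def moritaContext [Finite I] [DecidableEq I] (hσ : ∀ i, σ (σ i) = i)
    (m : SplitModel A I σ e a b) (m' : SplitModel B I σ e a b) : MoritaContext A B where
  M := homBimodule hσ m m'
  N := homBimodule hσ m' m
  pair := m.homPair m'
  copair := m'.homPair m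
  pair_smul := m.homPair_smul m'
  pair_op_smul := m.homPair_op_smul m'
  pair_balanced := m.homPair_balanced m'
  copair_smul := m'.homPair_smul m
  copair_op_smul := m'.homPair_op_smul m
  copair_balanced := m'.homPair_balanced m
  assoc := m.homPair_assoc m'
  coassoc := m'.homPair_assoc m
  pair_act := homPair_act hσ m m'
  copair_act := homPair_act hσ m' m
  pair_surjective := homPair_surjective m m'
  copair_surjective := homPair_surjective m' m

end SplitModel

lemma HasType.moritaEquivalent {A B : EqAlg} {a b c : ZMod 2} (hA : HasType A a b c)
    (hB : HasType B a b c) : MoritaEquivalent A B := by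
  rcases zmod_two_cases c with rfl | rfl
  · obtain ⟨m⟩ := hasType_zero.mp hA
    obtain ⟨m'⟩ := hasType_zero.mp hB
    exact ⟨m.toSplit.moritaContext (fun _ => rfl) m'.toSplit⟩
  · obtain ⟨m⟩ := hasType_one.mp hA
    obtain ⟨m'⟩ := hasType_one.mp hB
    exact ⟨m.toSplit.moritaContext Bool.not_not m'.toSplit⟩

/-! ### The type is invariant under Morita equivalence -/

namespace MoritaContext

section

variable {k H : Type} [CommRing k] [Group H] {σ : H → k →+* k} {A B : EquivariantAlgebra σ}

/-- The opposite Morita context. -/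
def symm (c : MoritaContext A B) : MoritaContext B A where
  M := c.N
  N := c.M
  pair := c.copair
  copair := c.pair
  pair_smul := c.copair_smul
  pair_op_smul := c.copair_op_smul
  pair_balanced := c.copair_balanced
  copair_smul := c.pair_smul
  copair_op_smul := c.pair_op_smul
  copair_balanced := c.pair_balanced
  assoc := c.coassoc
  coassoc := c.assoc
  pair_act := c.copair_act
  copair_act := c.pair_act
  pair_surjective := c.copair_surjective
  copair_surjective := c.pair_surjective

lemma exists_sum_pair (c : MoritaContext A B) (x : A.carrier) :
    ∃ (n : ℕ) (f : Fin n → c.M.carrier) (g : Fin n → c.N.carrier),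
      x = ∑ i, c.pair (f i) (g i) := by
  have hx : x ∈ AddSubgroup.closure {a | ∃ m n, c.pair m n = a} := by
    rw [c.pair_surjective]; trivial
  induction hx using AddSubgroup.closure_induction with
  | mem x hx =>
    obtain ⟨m, n, rfl⟩ := hx
    exact ⟨1, fun _ => m, fun _ => n, by simp⟩
  | zero => exact ⟨0, Fin.elim0, Fin.elim0, by simp⟩
  | add x y _ _ hx hy =>
    obtain ⟨n, f, g, rfl⟩ := hx
    obtain ⟨n', f', g', rfl⟩ := hy
    exact ⟨n + n', Fin.append f f', Fin.append g g', by simp [Fin.sum_univ_add]⟩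
  | neg x _ hx =>
    obtain ⟨n, f, g, rfl⟩ := hx
    exact ⟨n, fun i => -f i, g, by simp⟩

/-- Nondegeneracy follows from surjectivity: with `1 = ∑ ⟨f_i, g_i⟩`, associativity gives `n = n · 1
= ∑ ⟨n, f_i⟩ g_i`. -/
lemma eq_zero_of_copair (c : MoritaContext A B) (n : c.N.carrier)
    (h : ∀ m, c.copair n m = 0) : n = 0 := by
  obtain ⟨k, f, g, hfg⟩ := c.exists_sum_pair 1
  rw [← one_smul (A.carrier)ᵐᵒᵖ n, ← MulOpposite.op_one, hfg, Finset.op_sum, Finset.sum_smul]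
  exact Finset.sum_eq_zero fun i _ => by rw [← c.coassoc, h, zero_smul]

lemma eq_zero_of_copair_op_smul (c : MoritaContext A B) (x : A.carrier)
    (h : ∀ n m, c.copair (MulOpposite.op x • n) m = 0) : x = 0 := by
  obtain ⟨k, f, g, hfg⟩ := c.exists_sum_pair 1
  rw [← one_mul x, hfg, Finset.sum_mul]
  refine Finset.sum_eq_zero fun i _ => ?_
  rw [← c.pair_op_smul, c.eq_zero_of_copair _ (h (g i)), map_zero]

end

variable {A B : EqAlg} (c : MoritaContext A B) {U : Type} [AddCommGroup U] [Module ℂ U]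
  (φ : B.carrier →ₐ[ℂ] Module.End ℂ U)

/-- The `B`-linear maps from `N` to `U`. -/
def homSpace : Submodule ℂ (c.N.carrier → U) where
  carrier := {f | (∀ n n', f (n + n') = f n + f n') ∧ ∀ (y : B.carrier) n, f (y • n) = φ y (f n)}
  add_mem' := by
    rintro f g ⟨hf, hf'⟩ ⟨hg, hg'⟩
    refine ⟨fun n n' => ?_, fun y n => ?_⟩
    · simp only [Pi.add_apply, hf, hg]; abel
    · simp only [Pi.add_apply, hf', hg', map_add]
  zero_mem' := ⟨fun n n' => by simp, fun y n => by simp⟩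
  smul_mem' := by
    rintro r f ⟨hf, hf'⟩
    refine ⟨fun n n' => ?_, fun y n => ?_⟩
    · simp only [Pi.smul_apply, hf, smul_add]
    · simp only [Pi.smul_apply, hf', map_smul]

variable {c φ}

lemma homSpace_add (f : c.homSpace φ) (n n' : c.N.carrier) :
    f.1 (n + n') = f.1 n + f.1 n' := f.2.1 n n'

lemma homSpace_smul (f : c.homSpace φ) (y : B.carrier) (n : c.N.carrier) :
    f.1 (y • n) = φ y (f.1 n) := f.2.2 y n

lemma homSpace_sum (f : c.homSpace φ) {ι : Type*} (s : Finset ι) (g : ι → c.N.carrier) :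
    f.1 (∑ i ∈ s, g i) = ∑ i ∈ s, f.1 (g i) :=
  map_sum (AddMonoidHom.mk' f.1 (homSpace_add f)) g s

lemma homSpace_ext {f g : c.homSpace φ} (h : ∀ n, f.1 n = g.1 n) : f = g :=
  Subtype.ext (funext h)

variable (c φ)

/-- The element `n ↦ φ ⟨n, m⟩ u` of `homSpace`. -/
def homMk (m : c.M.carrier) : U →ₗ[ℂ] c.homSpace φ where
  toFun u := ⟨fun n => φ (c.copair n m) u,
    fun n n' => by simp only [map_add, AddMonoidHom.add_apply, LinearMap.add_apply],
    fun y n => by simp only [c.copair_smul, map_mul, Module.End.mul_apply]⟩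
  map_add' u v := homSpace_ext fun n => map_add _ _ _
  map_smul' r u := homSpace_ext fun n => map_smul _ _ _

lemma homMk_apply (m : c.M.carrier) (u : U) (n : c.N.carrier) :
    (c.homMk φ m u).1 n = φ (c.copair n m) u := rfl

/-- The action of an element of `A` on `homSpace`. -/
def homRepOp (x : A.carrier) : Module.End ℂ (c.homSpace φ) where
  toFun f := ⟨fun n => f.1 (MulOpposite.op x • n),
    fun n n' => by simp only [smul_add, homSpace_add],
    fun y n => by simp only [← homSpace_smul, smul_comm]⟩
  map_add' _ _ := rfl
  map_smul' _ _ := rfl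

lemma homRepOp_apply (x : A.carrier) (f : c.homSpace φ) (n : c.N.carrier) :
    (c.homRepOp φ x f).1 n = f.1 (MulOpposite.op x • n) := rfl

/-- The action of `A` on `homSpace`. -/
def homRep : A.carrier →ₐ[ℂ] Module.End ℂ (c.homSpace φ) where
  toFun := c.homRepOp φ
  map_one' := LinearMap.ext fun f => homSpace_ext fun n => by
    rw [homRepOp_apply, MulOpposite.op_one, one_smul, Module.End.one_apply]
  map_mul' x y := LinearMap.ext fun f => homSpace_ext fun n => by
    rw [Module.End.mul_apply, homRepOp_apply, homRepOp_apply, homRepOp_apply, MulOpposite.op_mul,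
      mul_smul]
  map_zero' := LinearMap.ext fun f => homSpace_ext fun n => by
    rw [homRepOp_apply, MulOpposite.op_zero, zero_smul, ← zero_smul B.carrier n, homSpace_smul,
      map_zero, LinearMap.zero_apply]
    rfl
  map_add' x y := LinearMap.ext fun f => homSpace_ext fun n => by
    rw [LinearMap.add_apply, homRepOp_apply, MulOpposite.op_add, add_smul, homSpace_add,
      ← homRepOp_apply, ← homRepOp_apply]
    rfl
  commutes' r := LinearMap.ext fun f => homSpace_ext fun n => by
    rw [homRepOp_apply, ← c.N.scalar, homSpace_smul, AlgHom.commutes,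
      Module.algebraMap_end_apply, Module.algebraMap_end_apply]
    rfl

lemma homRep_apply (x : A.carrier) (f : c.homSpace φ) (n : c.N.carrier) :
    (c.homRep φ x f).1 n = f.1 (MulOpposite.op x • n) := rfl

/-- An operator that is compatible with an involution `g` acts on `homSpace`. -/
def homOp {τ : ℂ →+* ℂ} (g : G) (hg : g * g = 1) (R : U →ₛₗ[τ] U)
    (hR : ∀ y u, R (φ y u) = φ (B.act g y) (R u)) : c.homSpace φ →ₛₗ[τ] c.homSpace φ where
  toFun f := ⟨fun n => R (f.1 (c.N.act g n)),
    fun n n' => by simp only [map_add, homSpace_add],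
    fun y n => by
      simp only
      rw [c.N.act_smul, homSpace_smul, hR, ← B.act_mul_apply, hg, B.act_one_apply]⟩
  map_add' f f' := homSpace_ext fun n => map_add _ _ _
  map_smul' r f := homSpace_ext fun n => map_smulₛₗ _ _ _

lemma homOp_apply {τ : ℂ →+* ℂ} (g : G) (hg : g * g = 1) (R : U →ₛₗ[τ] U)
    (hR : ∀ y u, R (φ y u) = φ (B.act g y) (R u)) (f : c.homSpace φ) (n : c.N.carrier) :
    (c.homOp φ g hg R hR f).1 n = R (f.1 (c.N.act g n)) := rfl

lemma act_act (N : EquivariantBimodule B A) (g h : G) (n : N.carrier) :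
    N.act g (N.act h n) = N.act (g * h) n := by
  rw [map_mul]; rfl

lemma homOp_homRep {τ : ℂ →+* ℂ} (g : G) (hg : g * g = 1) (R : U →ₛₗ[τ] U)
    (hR : ∀ y u, R (φ y u) = φ (B.act g y) (R u)) (x : A.carrier) (f : c.homSpace φ) :
    c.homOp φ g hg R hR (c.homRep φ x f) =
      c.homRep φ (A.act g x) (c.homOp φ g hg R hR f) := homSpace_ext fun n => by
  rw [homOp_apply, homRep_apply, homRep_apply, homOp_apply, c.N.act_op_smul, ← A.act_mul_apply,
    hg, A.act_one_apply]

/-- A finite dual basis: for `1 = ∑ ⟨m_i, n_i⟩`, linearity of `f` gives `f(n) = ∑ φ⟨n, m_i⟩ f(n_i)`.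
Hence `f` is determined by finitely many values, which also bounds the dimension of `homSpace`. -/
lemma exists_eq_sum_homMk : ∃ (k : ℕ) (m : Fin k → c.M.carrier) (n : Fin k → c.N.carrier),
    ∀ f : c.homSpace φ, f = ∑ i, c.homMk φ (m i) (f.1 (n i)) := by
  obtain ⟨k, m, n, h⟩ := c.exists_sum_pair 1
  refine ⟨k, m, n, fun f => homSpace_ext fun n' => ?_⟩
  conv_lhs => rw [← one_smul (A.carrier)ᵐᵒᵖ n', ← MulOpposite.op_one, h, Finset.op_sum,
    Finset.sum_smul, homSpace_sum]
  rw [Submodule.coe_sum, Finset.sum_apply]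
  exact Finset.sum_congr rfl fun i _ => by rw [← c.coassoc, homSpace_smul, homMk_apply]

instance [FiniteDimensional ℂ U] : FiniteDimensional ℂ (c.homSpace φ) := by
  obtain ⟨k, m, n, h⟩ := c.exists_eq_sum_homMk φ
  let F : c.homSpace φ →ₗ[ℂ] (Fin k → U) :=
    { toFun := fun f i => f.1 (n i), map_add' := fun _ _ => rfl, map_smul' := fun _ _ => rfl }
  refine FiniteDimensional.of_injective F fun f g hfg => ?_
  rw [h f, h g]
  exact Finset.sum_congr rfl fun i _ => congrArg _ (congrFun hfg i)

/-- If `homSpace` vanished, all `φ⟨n, m⟩` would vanish, whereas `1` is a sum of such pairings. -/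
instance [Nontrivial U] : Nontrivial (c.homSpace φ) := by
  obtain ⟨u, hu⟩ := exists_ne (0 : U)
  by_contra h
  rw [not_nontrivial_iff_subsingleton] at h
  obtain ⟨k, f, g, hfg⟩ := c.symm.exists_sum_pair 1
  refine hu ?_
  rw [← Module.End.one_apply (R := ℂ) u, ← map_one φ, hfg, map_sum, LinearMap.sum_apply]
  refine Finset.sum_eq_zero fun i _ => ?_
  exact congrFun (congrArg Subtype.val (Subsingleton.elim (c.homMk φ (g i) u) 0)) (f i)

/-- The rank-one operator `f ↦ e_j(f(n_i)) • homMk (m_l) w` is the action of `⟨m_l y, n_i⟩`, where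
`φ y` is the rank-one operator of `e_j` and `w`. By the dual basis, every endomorphism is a sum of
these. The sets `K` and `J` carry a side condition along: odd models need preimages that vanish in
the second factor. -/
lemma exists_homRep_eq [FiniteDimensional ℂ U] (K : Set B.carrier)
    (hK : ∀ M, ∃ y ∈ K, φ y = M) (J : AddSubgroup A.carrier)
    (hJ : ∀ m n, ∀ y ∈ K, c.pair (MulOpposite.op y • m) n ∈ J)
    (F : Module.End ℂ (c.homSpace φ)) : ∃ x ∈ J, c.homRep φ x = F := by
  obtain ⟨k, m, n, h⟩ := c.exists_eq_sum_homMk φ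
  let e := Module.finBasis ℂ U
  have rank1 : ∀ (i l : Fin k) (w : U) (j), ∃ x ∈ J, ∀ f,
      c.homRep φ x f = e.coord j (f.1 (n i)) • c.homMk φ (m l) w := by
    intro i l w j
    obtain ⟨y, hy, hy'⟩ := hK ((e.coord j).smulRight w)
    refine ⟨_, hJ (m l) (n i) y hy, fun f => homSpace_ext fun n' => ?_⟩
    rw [homRep_apply, ← c.coassoc, homSpace_smul, c.copair_op_smul, map_mul, hy',
      Module.End.mul_apply, LinearMap.smulRight_apply, map_smul]
    rfl
  choose x hx hx' using rank1
  refine ⟨∑ i, ∑ j, ∑ l, x i l ((F (c.homMk φ (m i) (e j))).1 (n l)) j,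
    J.sum_mem fun i _ => J.sum_mem fun j _ => J.sum_mem fun l _ => hx _ _ _ _,
    LinearMap.ext fun f => ?_⟩
  conv_rhs => rw [h f, map_sum]
  rw [map_sum, LinearMap.sum_apply]
  refine Finset.sum_congr rfl fun i _ => ?_
  conv_rhs => rw [← e.sum_repr (f.1 (n i)), map_sum, map_sum]
  rw [map_sum, LinearMap.sum_apply]
  refine Finset.sum_congr rfl fun j _ => ?_
  rw [map_smul, map_smul, map_sum, LinearMap.sum_apply]
  conv_rhs => rw [h (F _), Finset.smul_sum]
  exact Finset.sum_congr rfl fun l _ => hx' _ _ _ _ _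

lemma φ_copair_eq_zero {x : A.carrier} (hx : c.homRep φ x = 0) (n : c.N.carrier)
    (m : c.M.carrier) : φ (c.copair (MulOpposite.op x • n) m) = 0 := LinearMap.ext fun u => by
  rw [← homMk_apply, ← homRep_apply, hx]; rfl

/-- Transport of an even model along a Morita context. -/
def evenModel {a b : ZMod 2} (m : EvenModel B a b) : EvenModel A a b where
  U := c.homSpace m.φ
  φ := c.homRep m.φ
  bijective := by
    refine ⟨(injective_iff_map_eq_zero _).mpr fun x hx => ?_, fun F => ?_⟩
    · exact c.eq_zero_of_copair_op_smul x fun n l =>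
        m.bijective.1 ((c.φ_copair_eq_zero m.φ hx n l).trans (map_zero _).symm)
    · obtain ⟨x, -, hx⟩ := c.exists_homRep_eq m.φ Set.univ
        (fun M => (m.bijective.2 M).imp fun _ h => ⟨trivial, h⟩) ⊤ (fun _ _ _ _ => trivial) F
      exact ⟨x, hx⟩
  P := c.homOp m.φ p p_mul_p m.P m.P_φ
  T := c.homOp m.φ (tb 0) (tb_mul_tb 0) m.T m.T_φ
  P_P f := homSpace_ext fun n => by
    rw [homOp_apply, homOp_apply, m.P_P, act_act, p_mul_p, map_one]; rfl
  T_T f := homSpace_ext fun n => by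
    rw [homOp_apply, homOp_apply, m.T_T, act_act, tb_mul_tb, map_one]; rfl
  T_P f := homSpace_ext fun n => by
    change _ = sgn b • (c.homOp m.φ p p_mul_p m.P m.P_φ _).1 n
    rw [homOp_apply, homOp_apply, homOp_apply, homOp_apply, m.T_P, act_act, act_act, p_mul_tb,
      tb_mul_p]
  P_φ := c.homOp_homRep m.φ _ _ _ _
  T_φ := c.homOp_homRep m.φ _ _ _ _

/-- Transport of an odd model along a Morita context. -/
def oddModel {a b : ZMod 2} (m : OddModel B a b) : OddModel A a b where
  U := c.homSpace m.φ
  φ := c.homRep m.φ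
  bijective := by
    constructor
    · intro x y hxy
      have h1 : c.homRep m.φ (x - y) = 0 := by
        rw [map_sub, sub_eq_zero]; exact congrArg Prod.fst hxy
      have h2 : c.homRep m.φ (A.act p (x - y)) = 0 := by
        rw [map_sub, map_sub, sub_eq_zero]; exact congrArg Prod.snd hxy
      rw [← sub_eq_zero]
      refine c.eq_zero_of_copair_op_smul _ fun n l => m.ext_φ ?_ ?_
      · rw [c.φ_copair_eq_zero m.φ h1, map_zero]
      · rw [c.copair_act, c.N.act_op_smul, c.φ_copair_eq_zero m.φ h2, map_zero, map_zero]
    · let J : AddSubgroup A.carrier :=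
        (((c.homRep m.φ).comp A.parity).toLinearMap.ker).toAddSubgroup
      have hJ : ∀ x, x ∈ J ↔ c.homRep m.φ (A.act p x) = 0 := fun x => Iff.rfl
      have key : ∀ F, ∃ x ∈ J, c.homRep m.φ x = F := c.exists_homRep_eq m.φ
        {y | m.φ (B.act p y) = 0} (fun M => (m.exists_φ M 0).imp fun y hy => ⟨hy.2, hy.1⟩) J
        (fun l n y hy => (hJ _).mpr (LinearMap.ext fun f => homSpace_ext fun n' => by
          change m.φ (B.act p y) = 0 at hy
          rw [c.pair_act, c.M.act_op_smul, homRep_apply, ← c.coassoc, homSpace_smul,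
            c.copair_op_smul, map_mul, hy, mul_zero]
          rfl))
      rintro ⟨F, F'⟩
      obtain ⟨x, hx, hx'⟩ := key F
      obtain ⟨y, hy, hy'⟩ := key F'
      rw [hJ] at hx hy
      -- Both `x` and `y` live in the first factor, and parity moves `y` to the second.
      refine ⟨x + A.act p y, ?_⟩
      simp only [map_add, A.act_p_act_p, hx, hx', hy, hy', add_zero, zero_add]
  T := c.homOp m.φ (tb b) (tb_mul_tb b) m.T m.T_φ
  T_T f := homSpace_ext fun n => by
    rw [homOp_apply, homOp_apply, m.T_T, act_act, tb_mul_tb, map_one]; rfl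
  T_φ := c.homOp_homRep m.φ _ _ _ _

end MoritaContext

lemma HasType.of_moritaEquivalent {A B : EqAlg} {a b c : ZMod 2} (h : MoritaEquivalent A B)
    (hB : HasType B a b c) : HasType A a b c := by
  obtain ⟨C⟩ := h
  rcases zmod_two_cases c with rfl | rfl
  · rw [hasType_zero] at *
    exact hB.map C.evenModel
  · rw [hasType_one] at *
    exact hB.map C.oddModel

/-! ### Uniqueness of the type -/

/-- By Schur's lemma `S⁻¹T'ST` is a scalar `d`. Comparing squares gives `(-1)^a' = |d|² (-1)^a`, and
positivity of `|d|²` forces the signs to agree. -/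
lemma antilinear_unique {R U U' : Type} [AddCommGroup U] [Module ℂ U] [AddCommGroup U']
    [Module ℂ U'] [Nontrivial U] {φ : R → Module.End ℂ U} {φ' : R → Module.End ℂ U'}
    (hφ : Function.Surjective φ) (S : U ≃ₗ[ℂ] U') (hS : ∀ x u, S (φ x u) = φ' x (S u))
    (τ : R → R) (hτ : ∀ x, τ (τ x) = x) {a a' : ZMod 2} (T : U →ₛₗ[starRingEnd ℂ] U)
    (T' : U' →ₛₗ[starRingEnd ℂ] U')
    (hT : ∀ u, T (T u) = sgn a • u) (hT' : ∀ u, T' (T' u) = sgn a' • u)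
    (hTφ : ∀ x u, T (φ x u) = φ (τ x) (T u)) (hTφ' : ∀ x u, T' (φ' x u) = φ' (τ x) (T' u)) :
    a = a' ∧ ∃ d : ℂ, d ≠ 0 ∧ ∀ u, T' (S u) = d • S (T u) := by
  have hS' : ∀ x u, S.symm (φ' x u) = φ x (S.symm u) := by
    intro x u
    rw [LinearEquiv.symm_apply_eq, hS, LinearEquiv.apply_symm_apply]
  obtain ⟨d, hd⟩ := exists_scalar_of_commute_surjective hφ
    (S.symm.toLinearMap ∘ₗ ((T'.comp S.toLinearMap).comp T : U →ₗ[ℂ] U'))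
    (fun x u => by simp [hS, hS', hTφ, hTφ', hτ])
  have hd' : ∀ u, T' (S (T u)) = d • S u := by
    intro u
    have := hd u
    simp only [LinearMap.comp_apply, LinearEquiv.coe_coe, LinearEquiv.symm_apply_eq,
      map_smul] at this
    exact this
  have hdd : ((sgn a' : ℤ) : ℂ) = (Complex.normSq d : ℂ) * ((sgn a : ℤ) : ℂ) := by
    refine smul_right_cancel_of_nontrivial (U := U) fun u => S.injective ?_
    have h1 := hT' (S (T (T u)))
    rw [hd', map_smulₛₗ, hd', smul_smul, hT, map_sgn_smul,
      ← Complex.normSq_eq_conj_mul_self] at h1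
    rw [mul_smul, sgn_cast_smul, sgn_cast_smul, map_sgn_smul S, map_smul, map_sgn_smul S, smul_comm,
      h1, smul_comm, sgn_smul_smul]
  have hd0 : d ≠ 0 := by
    rintro rfl
    rw [map_zero, Complex.ofReal_zero, zero_mul, Int.cast_eq_zero] at hdd
    have := sgn_mul_self a'
    rw [hdd] at this
    norm_num at this
  refine ⟨?_, (sgn a : ℂ) * d, mul_ne_zero ?_ hd0, fun u => ?_⟩
  · have hr : ((sgn a' : ℤ) : ℝ) = Complex.normSq d * ((sgn a : ℤ) : ℝ) := by
      have := congrArg Complex.re hdd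
      simpa using this
    have hpos : 0 < Complex.normSq d := Complex.normSq_pos.mpr hd0
    rcases zmod_two_cases a with rfl | rfl <;> rcases zmod_two_cases a' with rfl | rfl
    · rfl
    · simp at hr; linarith
    · simp at hr; linarith
    · rfl
  · rw [Int.cast_ne_zero]
    intro h
    have := sgn_mul_self a
    rw [h] at this
    norm_num at this
  · have := hd' (T u)
    rw [hT, map_sgn_smul, map_sgn_smul] at this
    rw [mul_smul, ← this, sgn_cast_smul, sgn_smul_smul]

/-- Automorphisms of matrix algebras are inner, so the two models are intertwined by some `S`, which
carries `P` and `T` to scalar multiples `c` and `d` of their counterparts. As both parities are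
involutions, `c = ±1`; being real, it passes through the antilinear operator and drops out of the
commutation sign. -/
lemma EvenModel.type_unique {A : EqAlg} {a b a' b' : ZMod 2} (m : EvenModel A a b)
    (m' : EvenModel A a' b') : a = a' ∧ b = b' := by
  obtain ⟨S, hS⟩ := AlgEquiv.eq_linearEquivConjAlgEquiv (m.equiv.symm.trans m'.equiv)
  have hS' : ∀ x u, S (m.φ x u) = m'.φ x (S u) := by
    intro x u
    have h1 := congrArg (fun f => f (m.equiv x) (S u)) hS
    simp only [AlgEquiv.trans_apply, AlgEquiv.symm_apply_apply,
      LinearEquiv.conjAlgEquiv_apply] at h1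
    simpa [EvenModel.equiv] using h1.symm
  obtain ⟨ha, d, hd, hT⟩ := antilinear_unique m.bijective.2 S hS' (A.act (tb 0)) (A.act_tb_tb 0)
    m.T m'.T m.T_T m'.T_T m.T_φ m'.T_φ
  have hSs : ∀ x u, S.symm (m'.φ x u) = m.φ x (S.symm u) := by
    intro x u
    rw [LinearEquiv.symm_apply_eq, hS', LinearEquiv.apply_symm_apply]
  obtain ⟨c, hc⟩ := exists_scalar_of_commute_surjective m.bijective.2
    (S.symm.toLinearMap ∘ₗ m'.P ∘ₗ S.toLinearMap ∘ₗ m.P)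
    (fun x u => by simp [hS', hSs, m.P_φ, m'.P_φ, A.act_p_act_p])
  have hP : ∀ u, m'.P (S u) = c • S (m.P u) := by
    intro u
    have := hc (m.P u)
    simp only [LinearMap.comp_apply, LinearEquiv.coe_coe, LinearEquiv.symm_apply_eq,
      map_smul, m.P_P] at this
    exact this
  have hcc : c * c = 1 := by
    refine smul_right_cancel_of_nontrivial (U := m.U) fun u => S.injective ?_
    have h1 := m'.P_P (S u)
    rw [hP, map_smul, hP, m.P_P, smul_smul] at h1
    rw [map_smul, one_smul, h1]
  refine ⟨ha, sgn_smul_injective (U := m.U) fun u => S.injective ?_⟩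
  obtain ⟨u, rfl⟩ : ∃ v, u = m.P (m.T v) := ⟨sgn a • m.T (m.P u), by
    rw [map_sgn_smul m.T, map_sgn_smul m.P, m.T_T, map_sgn_smul m.P, sgn_smul_smul, m.P_P]⟩
  obtain ⟨e, rfl⟩ := exists_sgn_of_sq_eq_one hcc
  have h1 := m'.T_P (S u)
  simp only [hP, hT, sgn_cast_smul, map_sgn_smul, map_smul, m.T_P] at h1
  simp only [smul_comm _ d] at h1
  have h2 := smul_right_injective _ hd h1
  rw [smul_comm (sgn b')] at h2
  have h3 := congrArg (sgn e • ·) h2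
  simp only [sgn_smul_smul] at h3
  rw [map_sgn_smul, map_sgn_smul, h3]

/-- Equal kernels let `φ x ↦ φ' x` descend to an algebra isomorphism `End U ≅ End U'`, and such
isomorphisms are conjugations. The section `g` of `φ` is merely set-theoretic; the choice disappears
after applying `φ'`. -/
lemma exists_intertwiner {R U U' : Type} [Ring R] [Algebra ℂ R] [AddCommGroup U] [Module ℂ U]
    [AddCommGroup U'] [Module ℂ U'] (φ : R →ₐ[ℂ] Module.End ℂ U)
    (φ' : R →ₐ[ℂ] Module.End ℂ U') (hφ : Function.Surjective φ) (hφ' : Function.Surjective φ')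
    (h : ∀ x, φ x = 0 ↔ φ' x = 0) : ∃ S : U ≃ₗ[ℂ] U', ∀ x u, S (φ x u) = φ' x (S u) := by
  choose g hg using hφ
  have key : ∀ x, φ' (g (φ x)) = φ' x := by
    intro x
    rw [← sub_eq_zero, ← map_sub, ← h, map_sub, hg, sub_self]
  have key' : ∀ x M, φ x = M → φ' (g M) = φ' x := by
    rintro x _ rfl
    exact key x
  let θ : Module.End ℂ U →ₐ[ℂ] Module.End ℂ U' := AlgHom.ofLinearMap
    { toFun := fun M => φ' (g M)
      map_add' := fun M N => by rw [← map_add]; exact key' _ _ (by rw [map_add, hg, hg])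
      map_smul' := fun c M => by
        rw [RingHom.id_apply, ← map_smul]; exact key' _ _ (by rw [map_smul, hg]) }
    ((key' 1 1 (map_one φ)).trans (map_one φ'))
    (fun M N => by
      simp only [LinearMap.coe_mk, AddHom.coe_mk]
      rw [← map_mul]; exact key' _ _ (by rw [map_mul, hg, hg]))
  have hθ : ∀ x, θ (φ x) = φ' x := key
  have hb : Function.Bijective θ := by
    refine ⟨(injective_iff_map_eq_zero _).mpr fun M hM => ?_, fun N => ?_⟩
    · rw [← hg M, h]; exact hM
    · obtain ⟨x, rfl⟩ := hφ' N
      exact ⟨φ x, hθ x⟩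
  obtain ⟨S, hS⟩ := AlgEquiv.eq_linearEquivConjAlgEquiv (AlgEquiv.ofBijective θ hb)
  refine ⟨S, fun x u => ?_⟩
  have h1 := congrArg (fun f => f (φ x) (S u)) hS
  simp only [LinearEquiv.conjAlgEquiv_apply] at h1
  simpa [hθ] using h1.symm

namespace OddModel

variable {A : EqAlg} {a b a' b' : ZMod 2}

lemma surjective (m : OddModel A a b) : Function.Surjective m.φ := fun M =>
  (m.exists_φ M 0).imp fun _ h => h.1

/-- The same algebra with the two factors exchanged. -/
def swap (m : OddModel A a b) : OddModel A a b where
  U := m.U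
  φ := m.φ.comp A.parity
  bijective := by
    refine ⟨fun x y h => m.ext_φ ?_ (congrArg Prod.fst h), fun ⟨M, N⟩ => ?_⟩
    · simpa [A.act_p_act_p] using congrArg Prod.snd h
    · obtain ⟨x, hx, hx'⟩ := m.exists_φ N M
      exact ⟨x, by simp [hx, hx', A.act_p_act_p]⟩
  T := m.T
  T_T := m.T_T
  T_φ x u := by simp [m.T_φ, A.act_p_tb, A.act_tb_p]

/-- The odd central element. -/
lemma exists_central (m : OddModel A a b) : ∃ z : A.carrier, m.φ z = 1 ∧ A.act p z = -z ∧
    z * z = 1 ∧ ∀ x, z * x = x * z := by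
  obtain ⟨z, hz, hz'⟩ := m.exists_φ 1 (-1)
  refine ⟨z, hz, m.ext_φ ?_ ?_, m.ext_φ ?_ ?_, fun x => m.ext_φ ?_ ?_⟩ <;>
  simp [hz, hz', A.act_p_act_p]

/-- Under `m` the element `z` is `(1, -1)`, so `φ x = 0` means `xz = -x`. Applying `φ'`, for which
`z` also acts as `1`, gives `φ' x = -φ' x`. -/
lemma φ_eq_zero (m : OddModel A a b) (m' : OddModel A a' b') {z : A.carrier} (hz : m.φ z = 1)
    (hz' : m'.φ z = 1) (hp : A.act p z = -z) {x : A.carrier} (hx : m.φ x = 0) : m'.φ x = 0 := by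
  have h : x * z = -x := m.ext_φ (by simp [hx]) (by simp [hp, hz])
  have h1 := congrArg m'.φ h
  rw [map_mul, hz', mul_one, map_neg] at h1
  have h2 : (2 : ℂ) • m'.φ x = 0 := by rw [two_smul, ← eq_neg_iff_add_eq_zero]; exact h1
  exact (smul_eq_zero.mp h2).resolve_left two_ne_zero

lemma T_eq_zero (m : OddModel A a b) {u : m.U} (h : m.T u = 0) : u = 0 := by
  have h1 := m.T_T u
  rw [h, map_zero] at h1
  rw [← sgn_smul_smul a u, ← h1, smul_zero]

lemma φ_act_tb_eq_zero (m : OddModel A a b) (x : A.carrier) :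
    m.φ (A.act (tb b) x) = 0 ↔ m.φ x = 0 := by
  constructor
  · intro h
    refine LinearMap.ext fun u => m.T_eq_zero ?_
    rw [m.T_φ, h]; rfl
  · intro h
    refine LinearMap.ext fun u => m.T_eq_zero ?_
    rw [m.T_φ, A.act_tb_tb, h]; rfl

/-- The value of `z` fixes which factor is the first, so `φ` and `φ'` have the same kernel. If `b`
and `b'` differed, both time reversals would preserve this kernel, hence so would their product `p`;
but `p` moves it to the other factor. -/
lemma type_unique_of_central (m : OddModel A a b) (m' : OddModel A a' b') {z : A.carrier}
    (hz : m.φ z = 1) (hz' : m'.φ z = 1) (hp : A.act p z = -z) : a = a' ∧ b = b' := by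
  have hker : ∀ x, m.φ x = 0 ↔ m'.φ x = 0 :=
    fun x => ⟨m.φ_eq_zero m' hz hz' hp, m'.φ_eq_zero m hz' hz hp⟩
  obtain ⟨S, hS⟩ := exists_intertwiner m.φ m'.φ m.surjective m'.surjective hker
  have hb : b = b' := by
    by_contra hne
    have hb' : ∀ b b' : ZMod 2, ¬b = b' → b' = b + 1 := by decide
    obtain rfl := hb' _ _ hne
    obtain ⟨x, hx, hx'⟩ := m.exists_φ 0 1
    rw [hker, ← m'.φ_act_tb_eq_zero, ← hker, ← A.act_tb_p, m.φ_act_tb_eq_zero, hx'] at hx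
    exact one_ne_zero hx
  subst hb
  exact ⟨(antilinear_unique m.surjective S hS (A.act (tb b)) (A.act_tb_tb b) m.T m'.T m.T_T m'.T_T
    m.T_φ m'.T_φ).1, rfl⟩

lemma type_unique (m : OddModel A a b) (m' : OddModel A a' b') : a = a' ∧ b = b' := by
  obtain ⟨z, hz, hp, hzz, hc⟩ := m.exists_central
  obtain ⟨c, hc'⟩ := exists_scalar_of_commute_surjective m'.surjective (m'.φ z) (fun x u => by
    rw [← Module.End.mul_apply, ← map_mul, hc, map_mul, Module.End.mul_apply])
  have hcc : c * c = 1 := smul_right_cancel_of_nontrivial (U := m'.U) fun u => by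
    rw [mul_smul, ← hc', ← hc', ← Module.End.mul_apply, ← map_mul, hzz, map_one]
    simp
  obtain ⟨e, rfl⟩ := exists_sgn_of_sq_eq_one hcc
  -- The two models may number the factors differently; in that case `z` acts as `-1` and one model
  -- is swapped.
  rcases zmod_two_cases e with rfl | rfl
  · exact m.type_unique_of_central m' hz (LinearMap.ext fun u => by simp [hc']) hp
  · have key : m'.φ (A.act p z) = 1 := LinearMap.ext fun u => by
      rw [hp, map_neg, LinearMap.neg_apply, hc']
      simp
    exact m.type_unique_of_central m'.swap hz key hp

end OddModel

/-- An odd algebra contains an odd central element with nonzero image. Central elements of `End U`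
are scalars, and these are fixed by parity. -/
lemma EvenModel.not_odd {A : EqAlg} {a b a' b' : ZMod 2} (m : EvenModel A a b)
    (m' : OddModel A a' b') : False := by
  obtain ⟨z, hz, hp, -, hc⟩ := m'.exists_central
  obtain ⟨c, hc'⟩ := exists_scalar_of_commute_surjective m.bijective.2 (m.φ z) (fun x u => by
    rw [← Module.End.mul_apply, ← map_mul, hc, map_mul, Module.End.mul_apply])
  have hc0 : c = 0 := by
    have : c = -c := smul_right_cancel_of_nontrivial (U := m.U) fun u => by
      obtain ⟨u, rfl⟩ : ∃ v, u = m.P v := ⟨m.P u, (m.P_P u).symm⟩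
      rw [← map_smul, ← hc', m.P_φ, hp, map_neg, LinearMap.neg_apply, hc', neg_smul]
    linear_combination this / 2
  have : z = 0 := m.bijective.1 (LinearMap.ext fun u => by simp [hc', hc0])
  rw [this, map_zero] at hz
  exact zero_ne_one hz

lemma HasType.unique {A : EqAlg} {a b c a' b' c' : ZMod 2} (h : HasType A a b c)
    (h' : HasType A a' b' c') : a = a' ∧ b = b' ∧ c = c' := by
  rcases zmod_two_cases c with rfl | rfl <;> rcases zmod_two_cases c' with rfl | rfl
  · obtain ⟨m⟩ := hasType_zero.mp h
    obtain ⟨m'⟩ := hasType_zero.mp h'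
    exact ⟨(m.type_unique m').1, (m.type_unique m').2, rfl⟩
  · obtain ⟨m⟩ := hasType_zero.mp h
    obtain ⟨m'⟩ := hasType_one.mp h'
    exact (m.not_odd m').elim
  · obtain ⟨m⟩ := hasType_one.mp h
    obtain ⟨m'⟩ := hasType_zero.mp h'
    exact (m'.not_odd m).elim
  · obtain ⟨m⟩ := hasType_one.mp h
    obtain ⟨m'⟩ := hasType_one.mp h'
    exact ⟨(m.type_unique m').1, (m.type_unique m').2, rfl⟩

/-! ### Types of supertensor products -/

section StackRep

variable {A B : EqAlg} {V U : Type} [AddCommGroup V] [Module ℂ V] [AddCommGroup U] [Module ℂ U]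

lemma parityGrading_zero {a : A.carrier} (h : a ∈ A.parityGrading 0) : A.act p a = a := by
  simpa using A.mem_parityGrading.mp h

lemma parityGrading_one {a : A.carrier} (h : a ∈ A.parityGrading 1) : A.act p a = -a := by
  simpa using A.mem_parityGrading.mp h

/-- A pure element of the supertensor product. -/
def stackTmul (a : A.carrier) (b : B.carrier) : (A.stack B).carrier :=
  (a ᵍ⊗ₜ[ℂ] b : EquivariantAlgebra.StackCarrier A B)

/-- The universal property of the supertensor product. -/
def stackLift {C : Type} [Ring C] [Algebra ℂ C] (f : A.carrier →ₐ[ℂ] C) (g : B.carrier →ₐ[ℂ] C)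
    (h : ∀ ⦃i j⦄ (a : A.parityGrading i) (b : B.parityGrading j),
      f a * g b = (-1 : ℤˣ) ^ (j * i) • (g b * f a)) : (A.stack B).carrier →ₐ[ℂ] C :=
  GradedTensorProduct.lift A.parityGrading B.parityGrading f g h

lemma stackLift_tmul {C : Type} [Ring C] [Algebra ℂ C] (f : A.carrier →ₐ[ℂ] C)
    (g : B.carrier →ₐ[ℂ] C)
    (h : ∀ ⦃i j⦄ (a : A.parityGrading i) (b : B.parityGrading j),
      f a * g b = (-1 : ℤˣ) ^ (j * i) • (g b * f a)) (a : A.carrier) (b : B.carrier) :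
    stackLift f g h (stackTmul a b) = f a * g b :=
  GradedTensorProduct.lift_tmul A.parityGrading B.parityGrading f g h a b

/-- The homomorphism `b ↦ P ^ |b| ⊗ ψ b`. -/
def twistHom (P : Module.End ℂ V) (hP : P * P = 1) (ψ : B.carrier →ₐ[ℂ] Module.End ℂ U) :
    B.carrier →ₐ[ℂ] Module.End ℂ V ⊗[ℂ] Module.End ℂ U :=
  AlgHom.ofLinearMap
    -- The orthogonal idempotents `(1 ± P)/2` are paired with `ψ b` and `ψ (p b)`. For even `b` they
    -- add up to `1`, for odd `b` they subtract to `P`, and orthogonality makes the sum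
    -- multiplicative.
    (TensorProduct.mk ℂ _ _ ((2⁻¹ : ℂ) • (1 + P)) ∘ₗ ψ.toLinearMap +
      TensorProduct.mk ℂ _ _ ((2⁻¹ : ℂ) • (1 - P)) ∘ₗ (ψ.comp B.parity).toLinearMap)
    (by
      simp only [LinearMap.add_apply, LinearMap.comp_apply, AlgHom.toLinearMap_apply, map_one,
        TensorProduct.mk_apply, ← TensorProduct.add_tmul, ← smul_add]
      rw [add_add_sub_cancel, ← two_smul ℂ (1 : Module.End ℂ V), smul_smul]
      norm_num
      rfl)
    (fun b b' => by
      have h1 : ((2⁻¹ : ℂ) • (1 + P)) * ((2⁻¹ : ℂ) • (1 + P)) = (2⁻¹ : ℂ) • (1 + P) := by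
        rw [smul_mul_smul_comm, mul_add, add_mul, add_mul, hP, mul_one, one_mul, mul_one,
          add_comm P 1, ← two_smul ℂ (1 + P), smul_smul]
        norm_num
      have h2 : ((2⁻¹ : ℂ) • (1 - P)) * ((2⁻¹ : ℂ) • (1 - P)) = (2⁻¹ : ℂ) • (1 - P) := by
        rw [smul_mul_smul_comm, mul_sub, sub_mul, sub_mul, hP, mul_one, one_mul, mul_one,
          ← neg_sub 1 P, sub_neg_eq_add, ← two_smul ℂ (1 - P), smul_smul]
        norm_num
      have h3 : ((2⁻¹ : ℂ) • (1 + P)) * ((2⁻¹ : ℂ) • (1 - P)) = 0 := by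
        rw [smul_mul_smul_comm, mul_sub, add_mul, add_mul, hP, mul_one, one_mul, mul_one,
          add_comm P 1, sub_self, smul_zero]
      have h4 : ((2⁻¹ : ℂ) • (1 - P)) * ((2⁻¹ : ℂ) • (1 + P)) = 0 := by
        rw [smul_mul_smul_comm, mul_add, sub_mul, sub_mul, hP, mul_one, one_mul, mul_one,
          sub_add_sub_cancel, sub_self, smul_zero]
      simp only [LinearMap.add_apply, LinearMap.comp_apply, AlgHom.toLinearMap_apply, map_mul,
        TensorProduct.mk_apply, mul_add, add_mul, Algebra.TensorProduct.tmul_mul_tmul, h1, h2, h3,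
        h4, TensorProduct.zero_tmul, add_zero, zero_add])

lemma twistHom_zero (P : Module.End ℂ V) (hP : P * P = 1) (ψ : B.carrier →ₐ[ℂ] Module.End ℂ U)
    {b : B.carrier} (hb : B.act p b = b) : twistHom P hP ψ b = 1 ⊗ₜ ψ b := by
  change ((2⁻¹ : ℂ) • (1 + P)) ⊗ₜ ψ b + ((2⁻¹ : ℂ) • (1 - P)) ⊗ₜ ψ (B.act p b) = _
  rw [hb, ← TensorProduct.add_tmul, ← smul_add, add_add_sub_cancel,
    ← two_smul ℂ (1 : Module.End ℂ V), smul_smul]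
  norm_num

lemma twistHom_one (P : Module.End ℂ V) (hP : P * P = 1) (ψ : B.carrier →ₐ[ℂ] Module.End ℂ U)
    {b : B.carrier} (hb : B.act p b = -b) : twistHom P hP ψ b = P ⊗ₜ ψ b := by
  change ((2⁻¹ : ℂ) • (1 + P)) ⊗ₜ ψ b + ((2⁻¹ : ℂ) • (1 - P)) ⊗ₜ ψ (B.act p b) = _
  rw [hb, map_neg, TensorProduct.tmul_neg, ← sub_eq_add_neg, ← TensorProduct.sub_tmul, ← smul_sub,
    add_sub_sub_cancel, ← two_smul ℂ P, smul_smul]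
  norm_num

/-- An odd `b` contributes a factor `P`, and `P` commutes with even and anticommutes with odd
elements of `A`: this is the Koszul sign. -/
lemma lift_commutes (φ : A.carrier →ₐ[ℂ] Module.End ℂ V) (P : Module.End ℂ V) (hP : P * P = 1)
    (hφ : ∀ x, P * φ x = φ (A.act p x) * P) (ψ : B.carrier →ₐ[ℂ] Module.End ℂ U) ⦃i j : ZMod 2⦄
    (a : A.parityGrading i) (b : B.parityGrading j) :
    (Algebra.TensorProduct.includeLeft.comp φ) (a : A.carrier) * twistHom P hP ψ b =
      (-1 : ℤˣ) ^ (j * i) •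
        (twistHom P hP ψ b * (Algebra.TensorProduct.includeLeft.comp φ) (a : A.carrier)) := by
  rw [units_smul_eq_sgn]
  simp only [AlgHom.comp_apply, Algebra.TensorProduct.includeLeft_apply]
  rcases zmod_two_cases j with rfl | rfl
  · rw [twistHom_zero P hP ψ (parityGrading_zero b.2)]
    simp
  · rw [twistHom_one P hP ψ (parityGrading_one b.2), one_mul,
      Algebra.TensorProduct.tmul_mul_tmul, Algebra.TensorProduct.tmul_mul_tmul, hφ]
    rcases zmod_two_cases i with rfl | rfl
    · rw [parityGrading_zero a.2]; simp
    · rw [parityGrading_one a.2]; simp [TensorProduct.neg_tmul]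

/-- The representation of the supertensor product on `V ⊗ U` for a graded module `V` of `A` and
a module `U` of `B`. -/
def stackRep (φ : A.carrier →ₐ[ℂ] Module.End ℂ V) (P : Module.End ℂ V) (hP : P * P = 1)
    (hφ : ∀ x, P * φ x = φ (A.act p x) * P) (ψ : B.carrier →ₐ[ℂ] Module.End ℂ U) :
    (A.stack B).carrier →ₐ[ℂ] Module.End ℂ (V ⊗[ℂ] U) :=
  (Module.endTensorEndAlgHom (R := ℂ) (A := ℂ) (S := ℂ) (M := V) (N := U)).comp
    (stackLift
      (Algebra.TensorProduct.includeLeft.comp φ) (twistHom P hP ψ) (lift_commutes φ P hP hφ ψ))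

variable (φ : A.carrier →ₐ[ℂ] Module.End ℂ V) (P : Module.End ℂ V) (hP : P * P = 1)
    (hφ : ∀ x, P * φ x = φ (A.act p x) * P) (ψ : B.carrier →ₐ[ℂ] Module.End ℂ U)

lemma act_stackTmul (g : G) (a : A.carrier) (b : B.carrier) :
    (A.stack B).act g (stackTmul a b) = stackTmul (A.act g a) (B.act g b) := rfl

lemma stack_induction' {C : (A.stack B).carrier → Prop} (hadd : ∀ x y, C x → C y → C (x + y))
    (h0 : ∀ a b, B.act p b = b → C (stackTmul a b))
    (h1 : ∀ a b, B.act p b = -b → C (stackTmul a b)) (x : (A.stack B).carrier) : C x := by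
  refine EquivariantAlgebra.stack_induction A B (P := C) ?_ hadd (fun i j a b => ?_) x
  · have h := h0 0 0 (map_zero _)
    have e : stackTmul (0 : A.carrier) (0 : B.carrier) = 0 := by
      simp [stackTmul, GradedTensorProduct.tmul]; rfl
    rwa [e] at h
  · rcases zmod_two_cases j with rfl | rfl
    · exact h0 _ _ (parityGrading_zero b.2)
    · exact h1 _ _ (parityGrading_one b.2)

lemma stackRep_zero (a : A.carrier) {b : B.carrier} (hb : B.act p b = b) :
    stackRep φ P hP hφ ψ (stackTmul a b) = TensorProduct.map (φ a) (ψ b) := by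
  rw [stackRep, AlgHom.comp_apply, stackLift_tmul, twistHom_zero P hP ψ hb, AlgHom.comp_apply,
    Algebra.TensorProduct.includeLeft_apply, Algebra.TensorProduct.tmul_mul_tmul, mul_one, one_mul]
  rfl

lemma stackRep_one (a : A.carrier) {b : B.carrier} (hb : B.act p b = -b) :
    stackRep φ P hP hφ ψ (stackTmul a b) = TensorProduct.map (φ a * P) (ψ b) := by
  rw [stackRep, AlgHom.comp_apply, stackLift_tmul, twistHom_one P hP ψ hb, AlgHom.comp_apply,
    Algebra.TensorProduct.includeLeft_apply, Algebra.TensorProduct.tmul_mul_tmul, one_mul]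
  rfl

/-- The tool that turns operators on the two tensor factors into operators of the stacked algebra.
An odd element of `B` drags `P` along, which `S` passes with the sign `(-1)^e`; therefore `S'` has
to implement `g` on odd elements up to the same sign. -/
lemma map_stackRep {σ : ℂ →+* ℂ} (S : V →ₛₗ[σ] V) (S' : U →ₛₗ[σ] U) (g : G) (e : ZMod 2)
    (hSφ : ∀ x v, S (φ x v) = φ (A.act g x) (S v)) (hSP : ∀ v, S (P v) = sgn e • P (S v))
    (h0 : ∀ b u, B.act p b = b → S' (ψ b u) = ψ (B.act g b) (S' u))
    (h1 : ∀ b u, B.act p b = -b → S' (ψ b u) = sgn e • ψ (B.act g b) (S' u))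
    (x : (A.stack B).carrier) (w : V ⊗[ℂ] U) :
    TensorProduct.map S S' (stackRep φ P hP hφ ψ x w) =
      stackRep φ P hP hφ ψ ((A.stack B).act g x) (TensorProduct.map S S' w) := by
  have hg : ∀ b, B.act p (B.act g b) = B.act g (B.act p b) := by
    intro b
    rw [← EquivariantAlgebra.act_mul_apply, mul_comm, EquivariantAlgebra.act_mul_apply]
  induction x using stack_induction' with
  | hadd x y hx hy => simp only [map_add, LinearMap.add_apply, hx, hy]
  | h0 a b hb =>
    rw [act_stackTmul, stackRep_zero φ P hP hφ ψ a hb,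
      stackRep_zero φ P hP hφ ψ _ (show B.act p (B.act g b) = B.act g b by rw [hg, hb])]
    induction w using TensorProduct.induction_on with
    | zero => simp only [map_zero]
    | add w w' hw hw' => simp only [map_add, hw, hw']
    | tmul v u => simp only [TensorProduct.map_tmul, hSφ, h0 b u hb]
  | h1 a b hb =>
    rw [act_stackTmul, stackRep_one φ P hP hφ ψ a hb,
      stackRep_one φ P hP hφ ψ _ (show B.act p (B.act g b) = -B.act g b by rw [hg, hb, map_neg])]
    induction w using TensorProduct.induction_on with
    | zero => simp only [map_zero]
    | add w w' hw hw' => simp only [map_add, hw, hw']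
    | tmul v u =>
      simp only [TensorProduct.map_tmul, Module.End.mul_apply, hSφ, hSP, h1 b u hb, map_zsmul]
      rw [TensorProduct.tmul_smul, TensorProduct.smul_tmul', sgn_smul_smul]

end StackRep

/-! ### Surjectivity and dimension counts for representations of supertensor products -/

section StackRep

variable {A B : EqAlg} {V U : Type} [AddCommGroup V] [Module ℂ V] [AddCommGroup U] [Module ℂ U]

lemma exists_even_odd (B : EqAlg) (b : B.carrier) :
    ∃ b₀ b₁, B.act p b₀ = b₀ ∧ B.act p b₁ = -b₁ ∧ b = b₀ + b₁ := by
  refine ⟨(2⁻¹ : ℂ) • (b + B.act p b), (2⁻¹ : ℂ) • (b - B.act p b), ?_, ?_, ?_⟩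
  · rw [B.act_p_smul, map_add, B.act_p_act_p, add_comm]
  · rw [B.act_p_smul, map_sub, B.act_p_act_p, ← smul_neg, neg_sub]
  · rw [← smul_add, add_add_sub_cancel, ← two_smul ℂ b, smul_smul]
    norm_num

/-- Once all `M ⊗ 1` are in the image, so are all `M ⊗ N`: the odd part of a preimage of `N` acts
with an extra `P`, which is cancelled by using `MP ⊗ 1` instead of `M ⊗ 1`. -/
lemma stackRep_surjective [FiniteDimensional ℂ V] [FiniteDimensional ℂ U]
    (φ : A.carrier →ₐ[ℂ] Module.End ℂ V) (P : Module.End ℂ V) (hP : P * P = 1)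
    (hφ : ∀ x, P * φ x = φ (A.act p x) * P) (ψ : B.carrier →ₐ[ℂ] Module.End ℂ U)
    (hψ : Function.Surjective ψ)
    (hM : ∀ M : Module.End ℂ V, ∃ x, stackRep φ P hP hφ ψ x = TensorProduct.map M LinearMap.id) :
    Function.Surjective (stackRep φ P hP hφ ψ) := by
  intro N
  obtain ⟨y, rfl⟩ := (homTensorHomEquiv ℂ V U V U).surjective N
  rw [homTensorHomEquiv_apply]
  induction y using TensorProduct.induction_on with
  | zero => exact ⟨0, by rw [map_zero, map_zero]⟩
  | add y y' hy hy' =>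
    obtain ⟨x, hx⟩ := hy
    obtain ⟨x', hx'⟩ := hy'
    exact ⟨x + x', by rw [map_add, map_add, hx, hx']⟩
  | tmul M N =>
    obtain ⟨b, rfl⟩ := hψ N
    obtain ⟨b₀, b₁, h₀, h₁, rfl⟩ := exists_even_odd B b
    obtain ⟨x, hx⟩ := hM M
    obtain ⟨y, hy⟩ := hM (M * P)
    refine ⟨x * stackTmul 1 b₀ + y * stackTmul 1 b₁, ?_⟩
    rw [map_add, map_mul, map_mul, hx, hy, stackRep_zero φ P hP hφ ψ 1 h₀,
      stackRep_one φ P hP hφ ψ 1 h₁, TensorProduct.homTensorHomMap_apply, map_one, one_mul, map_add,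
      TensorProduct.map_add_right]
    refine TensorProduct.ext' fun v u => ?_
    have hPP : P (P v) = v := LinearMap.congr_fun hP v
    simp [hPP]

lemma finrank_stack (A B : EqAlg) : Module.finrank ℂ (A.stack B).carrier =
    Module.finrank ℂ A.carrier * Module.finrank ℂ B.carrier :=
  Module.finrank_tensorProduct (R := ℂ) (S := ℂ) (M := A.carrier) (M' := B.carrier)

lemma EvenModel.finrank_eq {a b : ZMod 2} (m : EvenModel A a b) :
    Module.finrank ℂ A.carrier = Module.finrank ℂ m.U * Module.finrank ℂ m.U := by
  rw [m.equiv.toLinearEquiv.finrank_eq, Module.finrank_linearMap]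

lemma OddModel.finrank_eq {a b : ZMod 2} (m : OddModel A a b) :
    Module.finrank ℂ A.carrier = 2 * (Module.finrank ℂ m.U * Module.finrank ℂ m.U) := by
  rw [m.equiv.toLinearEquiv.finrank_eq, Module.finrank_prod, Module.finrank_linearMap, two_mul]

lemma EvenModel.finite {a b : ZMod 2} (m : EvenModel A a b) : FiniteDimensional ℂ A.carrier :=
  m.equiv.symm.toLinearEquiv.finiteDimensional

lemma OddModel.finite {a b : ZMod 2} (m : OddModel A a b) : FiniteDimensional ℂ A.carrier :=
  m.equiv.symm.toLinearEquiv.finiteDimensional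

lemma finite_stack (hA : FiniteDimensional ℂ A.carrier) (hB : FiniteDimensional ℂ B.carrier) :
    FiniteDimensional ℂ (A.stack B).carrier :=
  Module.Finite.tensorProduct ℂ A.carrier B.carrier

lemma bijective_of_surjective {X Y : Type} [AddCommGroup X] [Module ℂ X] [AddCommGroup Y]
    [Module ℂ Y] [FiniteDimensional ℂ X] [FiniteDimensional ℂ Y] (f : X →ₗ[ℂ] Y)
    (hf : Function.Surjective f) (h : Module.finrank ℂ X = Module.finrank ℂ Y) :
    Function.Bijective f :=
  ⟨(LinearMap.injective_iff_surjective_of_finrank_eq_finrank h).mpr hf, hf⟩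

lemma bijective_of_surjective_end {R : Type} [Ring R] [Algebra ℂ R] [FiniteDimensional ℂ R]
    [FiniteDimensional ℂ U] (f : R →ₐ[ℂ] Module.End ℂ U) (hf : Function.Surjective f)
    (h : Module.finrank ℂ R = Module.finrank ℂ U * Module.finrank ℂ U) : Function.Bijective f :=
  bijective_of_surjective f.toLinearMap hf (by rw [h, Module.finrank_linearMap])

/-- The elements `(1 ± z)/2` are sent to `(1, 0)` and `(0, 1)`, so surjectivity of `φ` yields
surjectivity onto both factors, and the dimensions agree. -/
lemma odd_bijective (φ : A.carrier →ₐ[ℂ] Module.End ℂ U) [FiniteDimensional ℂ U]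
    [FiniteDimensional ℂ A.carrier] (hφ : Function.Surjective φ) {z : A.carrier} (hz : φ z = 1)
    (hp : A.act p z = -z)
    (h : Module.finrank ℂ A.carrier = 2 * (Module.finrank ℂ U * Module.finrank ℂ U)) :
    Function.Bijective (fun x => (φ x, φ (A.act p x))) := by
  refine bijective_of_surjective (φ.prod (φ.comp A.parity)).toLinearMap (fun ⟨M, N⟩ => ?_) ?_
  · obtain ⟨x, rfl⟩ := hφ M
    obtain ⟨y, rfl⟩ := hφ N
    refine ⟨(2⁻¹ : ℂ) • (x * (1 + z) + A.act p y * (1 - z)), Prod.ext ?_ ?_⟩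
    · simp [hz, ← two_smul ℂ (1 : Module.End ℂ U)]
    · simp [hz, hp, A.act_p_smul, A.act_p_act_p, ← two_smul ℂ (1 : Module.End ℂ U)]
  · rw [h, Module.finrank_prod, Module.finrank_linearMap, two_mul]

end StackRep

/-- The linear endomorphism `P ^ b`. -/
def powOp {V : Type} [AddCommGroup V] [Module ℂ V] (P : V →ₗ[ℂ] V) (b : ZMod 2) : V →ₗ[ℂ] V :=
  if b = 0 then LinearMap.id else P

lemma powOp_zero {V : Type} [AddCommGroup V] [Module ℂ V] (P : V →ₗ[ℂ] V) (v : V) :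
    powOp P 0 v = v := rfl

lemma powOp_one {V : Type} [AddCommGroup V] [Module ℂ V] (P : V →ₗ[ℂ] V) (v : V) :
    powOp P 1 v = P v := rfl

/-! ### Stacking an even algebra with an even or an odd one -/

section

variable {A B : EqAlg} {a b a' b' : ZMod 2}

lemma EvenModel.T_powOp (m : EvenModel A a b) (c : ZMod 2) (u : m.U) :
    m.T (powOp m.P c u) = sgn (b * c) • powOp m.P c (m.T u) := by
  rcases zmod_two_cases c with rfl | rfl
  · simp [powOp_zero]
  · simp [powOp_one, m.T_P]

lemma EvenModel.P_powOp (m : EvenModel A a b) (c : ZMod 2) (u : m.U) :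
    powOp m.P c (m.P u) = m.P (powOp m.P c u) := by
  rcases zmod_two_cases c with rfl | rfl <;> rfl

lemma EvenModel.powOp_powOp (m : EvenModel A a b) (c : ZMod 2) (u : m.U) :
    powOp m.P c (powOp m.P c u) = u := by
  rcases zmod_two_cases c with rfl | rfl
  · rfl
  · exact m.P_P u

lemma EvenModel.powOp_φ (m : EvenModel A a b) (c : ZMod 2) (x : A.carrier) (u : m.U) :
    powOp m.P c (m.φ x u) = m.φ (A.act (Multiplicative.ofAdd c, 1) x) (powOp m.P c u) := by
  rcases zmod_two_cases c with rfl | rfl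
  · change m.φ x u = m.φ (A.act 1 x) u
    rw [A.act_one_apply]
  · exact m.P_φ x u

lemma tb_eq (c : ZMod 2) : tb c = tb 0 * (Multiplicative.ofAdd c, 1) := by revert c; decide

lemma act_tb_of_odd (B : EqAlg) {x : B.carrier} (hx : B.act p x = -x) (c d : ZMod 2) :
    B.act (tb c) x = sgn (c + d) • B.act (tb d) x := by
  have h : ∀ c d : ZMod 2, tb c = tb d ∧ c + d = 0 ∨ tb c = tb d * p ∧ c + d = 1 := by decide
  rcases h c d with ⟨h, h'⟩ | ⟨h, h'⟩
  · rw [h, h']; simp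
  · rw [h, h', B.act_mul_apply, hx]; simp

lemma act_tb_of_even (B : EqAlg) {x : B.carrier} (hx : B.act p x = x) (c d : ZMod 2) :
    B.act (tb c) x = B.act (tb d) x := by
  have h : ∀ c d : ZMod 2, tb c = tb d ∨ tb c = tb d * p := by decide
  rcases h c d with h | h
  · rw [h]
  · rw [h, B.act_mul_apply, hx]

/-- The representation of the supertensor product. -/
def EvenModel.stackRep (m : EvenModel A a b) {U : Type} [AddCommGroup U] [Module ℂ U]
    (ψ : B.carrier →ₐ[ℂ] Module.End ℂ U) :
    (A.stack B).carrier →ₐ[ℂ] Module.End ℂ (m.U ⊗[ℂ] U) :=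
  BDI.stackRep m.φ m.P (LinearMap.ext m.P_P) (fun x => LinearMap.ext (m.P_φ x)) ψ

lemma EvenModel.stackRep_surjective (m : EvenModel A a b) {U : Type} [AddCommGroup U] [Module ℂ U]
    [FiniteDimensional ℂ U] (ψ : B.carrier →ₐ[ℂ] Module.End ℂ U) (hψ : Function.Surjective ψ) :
    Function.Surjective (m.stackRep ψ) := by
  refine BDI.stackRep_surjective _ _ _ _ ψ hψ fun M => ?_
  obtain ⟨x, rfl⟩ := m.bijective.2 M
  exact ⟨stackTmul x 1, by rw [stackRep_zero _ _ _ _ _ _ (map_one _), map_one]; rfl⟩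

/-- Time reversal acts as `T ⊗ T'P'^b`: the factor `P'^b` supplies the sign `(-1)^b` on odd elements
of `B` that makes up for `TP = (-1)^b PT`. Its square contains the exchange of `T'` with `P'^b`,
which is the cup product term `bb'`. -/
lemma EvenModel.stack_even (m : EvenModel A a b) (m' : EvenModel B a' b') :
    Nonempty (EvenModel (A.stack B) (a + a' + b * b') (b + b')) := by
  have := m.finite
  have := m'.finite
  have := finite_stack (A := A) (B := B) ‹_› ‹_›
  refine ⟨{
    U := m.U ⊗[ℂ] m'.U
    φ := m.stackRep m'.φ
    bijective := bijective_of_surjective_end (m.stackRep m'.φ)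
      (m.stackRep_surjective m'.φ m'.bijective.2) ?_
    P := TensorProduct.map m.P m'.P
    T := TensorProduct.map m.T (m'.T.comp (powOp m'.P b))
    P_P := fun w => ?_
    T_T := fun w => ?_
    T_P := fun w => ?_
    P_φ := map_stackRep _ _ _ _ _ _ _ p 0 m.P_φ (by simp) (fun x u _ => m'.P_φ x u)
      (fun x u _ => by simpa using m'.P_φ x u)
    T_φ := map_stackRep _ _ _ _ _ _ _ (tb 0) b m.T_φ m.T_P ?_ ?_ }⟩
  · rw [finrank_stack, m.finrank_eq, m'.finrank_eq, Module.finrank_tensorProduct]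
    ring
  · induction w using TensorProduct.induction_on with
    | zero => simp only [map_zero]
    | add w w' hw hw' => simp only [map_add, hw, hw']
    | tmul v u => simp only [TensorProduct.map_tmul, m.P_P, m'.P_P]
  · induction w using TensorProduct.induction_on with
    | zero => simp only [map_zero, smul_zero]
    | add w w' hw hw' => simp only [map_add, hw, hw', smul_add]
    | tmul v u =>
      simp only [TensorProduct.map_tmul, LinearMap.comp_apply, m'.T_powOp, m'.powOp_powOp, m'.T_T,
        m.T_T, map_zsmul, sgn_add, mul_comm b', TensorProduct.tmul_smul, TensorProduct.smul_tmul',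
        smul_smul]
      congr 2
      ring
  · induction w using TensorProduct.induction_on with
    | zero => simp only [map_zero, smul_zero]
    | add w w' hw hw' => simp only [map_add, hw, hw', smul_add]
    | tmul v u =>
      simp only [TensorProduct.map_tmul, LinearMap.comp_apply, m'.P_powOp, m'.T_P, m.T_P,
        sgn_add, TensorProduct.tmul_smul, TensorProduct.smul_tmul', smul_smul]
      congr 2
      ring
  · intro x u hx
    simp only [LinearMap.comp_apply]
    rw [m'.powOp_φ, m'.T_φ]
    rcases zmod_two_cases b with rfl | rfl
    · change m'.φ (B.act _ (B.act 1 x)) _ = _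
      rw [B.act_one_apply]
    · change m'.φ (B.act _ (B.act p x)) _ = _
      rw [hx]
  · intro x u hx
    simp only [LinearMap.comp_apply]
    rw [m'.powOp_φ, m'.T_φ]
    rcases zmod_two_cases b with rfl | rfl
    · change m'.φ (B.act _ (B.act 1 x)) _ = _
      rw [B.act_one_apply]
      simp
    · change m'.φ (B.act _ (B.act p x)) _ = _
      rw [hx]
      simp

/-- Let `y` represent `P` and let `z` be the odd central element of `B`; then `y ⊗ z` acts as `P² ⊗
1 = 1` and is odd. The reversal `tb (b + b')` is implemented by `TP^(b+b') ⊗ T'`: on odd elements of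
`B` it differs from `tb b'` by `(-1)^b`, as required. Squaring gives `b(b + b')`, whence both terms
`bb'` and `bb`. -/
lemma EvenModel.stack_odd (m : EvenModel A a b) (m' : OddModel B a' b') :
    Nonempty (OddModel (A.stack B) (a + a' + b * b' + b * b) (b + b')) := by
  have := m.finite
  have := m'.finite
  have := finite_stack (A := A) (B := B) ‹_› ‹_›
  obtain ⟨z, hz, hp, -, -⟩ := m'.exists_central
  obtain ⟨y, hy⟩ := m.bijective.2 m.P
  have hy' : A.act p y = y := m.bijective.1 (LinearMap.ext fun u => by
    obtain ⟨v, rfl⟩ : ∃ v, u = m.P v := ⟨m.P u, (m.P_P u).symm⟩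
    rw [← m.P_φ, hy])
  refine ⟨{
    U := m.U ⊗[ℂ] m'.U
    φ := m.stackRep m'.φ
    bijective := odd_bijective _ (m.stackRep_surjective m'.φ m'.surjective) (z := stackTmul y z)
      ?_ ?_ ?_
    T := TensorProduct.map (m.T.comp (powOp m.P (b + b'))) m'.T
    T_T := fun w => ?_
    T_φ := map_stackRep _ _ _ _ _ _ _ (tb (b + b')) b ?_ ?_ ?_ ?_ }⟩
  · refine (stackRep_one _ _ _ _ _ _ hp).trans ?_
    rw [hy, hz]
    refine TensorProduct.ext' fun v u => ?_
    simp [m.P_P]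
  · rw [act_stackTmul, hy', hp]
    exact TensorProduct.tmul_neg (R := ℂ) y z
  · rw [finrank_stack, m.finrank_eq, m'.finrank_eq, Module.finrank_tensorProduct]
    ring
  · induction w using TensorProduct.induction_on with
    | zero => simp only [map_zero, smul_zero]
    | add w w' hw hw' => simp only [map_add, hw, hw', smul_add]
    | tmul v u =>
      simp only [TensorProduct.map_tmul, LinearMap.comp_apply, m.T_powOp, m.powOp_powOp, m'.T_T,
        m.T_T, map_zsmul, mul_add, sgn_add, TensorProduct.tmul_smul, TensorProduct.smul_tmul',
        smul_smul]
      congr 2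
      ring
  · intro x v
    simp only [LinearMap.comp_apply]
    rw [m.powOp_φ, m.T_φ, ← A.act_mul_apply, ← tb_eq]
  · intro v
    simp only [LinearMap.comp_apply]
    rw [m.P_powOp, m.T_P]
  · intro x u hx
    rw [m'.T_φ, act_tb_of_even B hx]
  · intro x u hx
    rw [m'.T_φ, act_tb_of_odd B hx b' (b + b'), add_left_comm, CharTwo.add_self_eq_zero, add_zero,
      map_zsmul]
    rfl

end

/-! ### Stacking two odd algebras -/

namespace OddModel

variable {A B : EqAlg} {a b a' b' : ZMod 2} (m : OddModel A a b)

/-- The graded module `U × U` of an odd algebra. -/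
def φ₂ : A.carrier →ₐ[ℂ] Module.End ℂ (m.U × m.U) :=
  (LinearMap.prodMapAlgHom ℂ m.U m.U).comp (m.φ.prod (m.φ.comp A.parity))

@[simp] lemma φ₂_apply (x : A.carrier) (v : m.U × m.U) :
    m.φ₂ x v = (m.φ x v.1, m.φ (A.act p x) v.2) := rfl

/-- The exchange of the two summands of `U × U`. -/
def exchange : m.U × m.U →ₗ[ℂ] m.U × m.U := (LinearMap.snd ℂ m.U m.U).prod (LinearMap.fst ℂ m.U m.U)

@[simp] lemma exchange_apply (v : m.U × m.U) : m.exchange v = (v.2, v.1) := rfl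

/-- The involution `1 × (-1)` of `U × U`. -/
def signOp : m.U × m.U →ₗ[ℂ] m.U × m.U :=
  (LinearMap.fst ℂ m.U m.U).prod (-LinearMap.snd ℂ m.U m.U)

@[simp] lemma signOp_apply (v : m.U × m.U) : m.signOp v = (v.1, -v.2) := rfl

/-- Time reversal on `U × U`. -/
def T₂ : m.U × m.U →ₛₗ[starRingEnd ℂ] m.U × m.U where
  toFun v := (m.T v.1, m.T v.2)
  map_add' v w := by simp
  map_smul' c v := by simp

@[simp] lemma T₂_apply (v : m.U × m.U) : m.T₂ v = (m.T v.1, m.T v.2) := rfl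

lemma exchange_mul : (m.exchange : Module.End ℂ (m.U × m.U)) * m.exchange = 1 := rfl

lemma exchange_φ₂ (x : A.carrier) : (m.exchange : Module.End ℂ (m.U × m.U)) * m.φ₂ x =
    m.φ₂ (A.act p x) * m.exchange :=
  LinearMap.ext fun v => by simp [A.act_p_act_p]

/-- In block form, `φ₂` produces all diagonal operators, and `exchange` turns diagonal into
off-diagonal ones. -/
lemma exists_φ₂ (M : Module.End ℂ (m.U × m.U)) :
    ∃ x y, M = m.φ₂ x + m.φ₂ y * m.exchange := by
  obtain ⟨x, hx, hx'⟩ := m.exists_φ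
    (LinearMap.fst ℂ m.U m.U ∘ₗ M ∘ₗ LinearMap.inl ℂ m.U m.U)
    (LinearMap.snd ℂ m.U m.U ∘ₗ M ∘ₗ LinearMap.inr ℂ m.U m.U)
  obtain ⟨y, hy, hy'⟩ := m.exists_φ
    (LinearMap.fst ℂ m.U m.U ∘ₗ M ∘ₗ LinearMap.inr ℂ m.U m.U)
    (LinearMap.snd ℂ m.U m.U ∘ₗ M ∘ₗ LinearMap.inl ℂ m.U m.U)
  refine ⟨x, y, LinearMap.ext fun v => ?_⟩
  have h : M v = M (v.1, 0) + M (0, v.2) := by rw [← map_add]; simp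
  rw [h]
  refine Prod.ext ?_ ?_
  · simp [hx, hy]
  · simp [hx', hy', add_comm]

/-- The operator `T₂ * exchange ^ b * signOp ^ b'`. -/
def T₃ (b b' : ZMod 2) : m.U × m.U →ₛₗ[starRingEnd ℂ] m.U × m.U :=
  m.T₂.comp (powOp m.exchange b ∘ₗ powOp m.signOp b')

lemma T₃_T₃ (b' : ZMod 2) (v : m.U × m.U) :
    m.T₃ b b' (m.T₃ b b' v) = sgn (a + b * b') • v := by
  have h := m.T_T
  rcases zmod_two_cases b with rfl | rfl <;> rcases zmod_two_cases b' with rfl | rfl <;>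
    simp [T₃, powOp_zero, powOp_one, m.T_T, sgn_add, Prod.ext_iff]

/-- `T₂` implements `tb b` and `exchange` implements `p`, so `exchange ^ b` corrects `tb b` to `tb
0`. The factor `signOp ^ b'` commutes with `φ₂`; it anticommutes with `exchange` if `b' = 1` and so
creates the sign needed in the second tensor factor. -/
lemma T₃_φ₂ (b' : ZMod 2) (x : A.carrier) (v : m.U × m.U) :
    m.T₃ b b' (m.φ₂ x v) = m.φ₂ (A.act (tb 0) x) (m.T₃ b b' v) := by
  rcases zmod_two_cases b with rfl | rfl <;> rcases zmod_two_cases b' with rfl | rfl <;>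
    simp [T₃, powOp_zero, powOp_one, m.T_φ, A.act_tb_p, A.act_p_tb,
      show (1 : ZMod 2) + 1 = 0 by decide]

lemma T₃_exchange (b' : ZMod 2) (v : m.U × m.U) :
    m.T₃ b b' (m.exchange v) = sgn b' • m.exchange (m.T₃ b b' v) := by
  rcases zmod_two_cases b with rfl | rfl <;> rcases zmod_two_cases b' with rfl | rfl <;>
    simp [T₃, powOp_zero, powOp_one]

/-- Parity on `U × U` in the supertensor product. -/
def parity₂ : m.U × m.U →ₗ[ℂ] m.U × m.U := Complex.I • (m.signOp ∘ₗ m.exchange)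

lemma parity₂_apply (v : m.U × m.U) : m.parity₂ v = (Complex.I • v.2, -(Complex.I • v.1)) := by
  simp [parity₂]

/-- The summand `1` comes from the factor `i` in `parity₂`, which makes that operator an involution
and is conjugated by the antilinear `T₃`. It is the source of the extra `x` in the law for two odd
algebras. -/
lemma T₃_parity₂ (b' : ZMod 2) (v : m.U × m.U) :
    m.T₃ b b' (m.parity₂ v) = sgn (b + b' + 1) • m.parity₂ (m.T₃ b b' v) := by
  rcases zmod_two_cases b with rfl | rfl <;> rcases zmod_two_cases b' with rfl | rfl <;>
    simp [T₃, powOp_zero, powOp_one, parity₂_apply, sgn_add]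

lemma parity₂_parity₂ (v : m.U × m.U) : m.parity₂ (m.parity₂ v) = v := by
  simp [parity₂_apply, smul_smul]

lemma parity₂_φ₂ (x : A.carrier) (v : m.U × m.U) :
    m.parity₂ (m.φ₂ x v) = m.φ₂ (A.act p x) (m.parity₂ v) := by
  simp [parity₂_apply, A.act_p_act_p]

lemma parity₂_exchange (v : m.U × m.U) :
    m.parity₂ (m.exchange v) = -m.exchange (m.parity₂ v) := by
  simp [parity₂_apply]

/-- The doubled space `U × U` is needed to have an operator that grades the module of `A`, namely
`exchange`. The odd central element `z` of `B` then acts as `exchange ⊗ 1`, so all of `End (U × U) ⊗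
1` is reached. Parity acts on the first factor alone: its anticommutation with `exchange` accounts
for the odd elements of `B`. -/
lemma stack_odd (m : OddModel A a b) (m' : OddModel B a' b') :
    Nonempty (EvenModel (A.stack B) (a + a' + b * b') (b + b' + 1)) := by
  have := m.finite
  have := m'.finite
  have := finite_stack (A := A) (B := B) ‹_› ‹_›
  obtain ⟨z, hz, hp, -, -⟩ := m'.exists_central
  have hs : Function.Surjective (stackRep m.φ₂ m.exchange m.exchange_mul m.exchange_φ₂ m'.φ) := by
    refine stackRep_surjective _ _ _ _ _ m'.surjective fun M => ?_
    obtain ⟨x, y, rfl⟩ := m.exists_φ₂ M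
    refine ⟨stackTmul x 1 + stackTmul y z, ?_⟩
    rw [map_add, stackRep_zero _ _ _ _ _ _ (map_one _), stackRep_one _ _ _ _ _ _ hp, hz, map_one,
      TensorProduct.map_add_left]
    rfl
  refine ⟨{
    U := (m.U × m.U) ⊗[ℂ] m'.U
    φ := stackRep m.φ₂ m.exchange m.exchange_mul m.exchange_φ₂ m'.φ
    bijective := bijective_of_surjective_end _ hs ?_
    P := TensorProduct.map m.parity₂ LinearMap.id
    T := TensorProduct.map (m.T₃ b b') m'.T
    P_P := fun w => ?_
    T_T := fun w => ?_
    T_P := fun w => ?_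
    P_φ := map_stackRep _ _ _ _ _ _ _ p 1 m.parity₂_φ₂ ?_ ?_ ?_
    T_φ := map_stackRep _ _ _ _ _ _ _ (tb 0) b' (m.T₃_φ₂ b') (m.T₃_exchange b') ?_ ?_ }⟩
  · rw [finrank_stack, m.finrank_eq, m'.finrank_eq, Module.finrank_tensorProduct,
      Module.finrank_prod]
    ring
  · induction w using TensorProduct.induction_on with
    | zero => simp only [map_zero]
    | add w w' hw hw' => simp only [map_add, hw, hw']
    | tmul v u => simp only [TensorProduct.map_tmul, m.parity₂_parity₂, LinearMap.id_apply]
  · induction w using TensorProduct.induction_on with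
    | zero => simp only [map_zero, smul_zero]
    | add w w' hw hw' => simp only [map_add, hw, hw', smul_add]
    | tmul v u =>
      simp only [TensorProduct.map_tmul, m.T₃_T₃, m'.T_T, sgn_add, TensorProduct.tmul_smul,
        TensorProduct.smul_tmul', smul_smul]
      congr 2
      ring
  · induction w using TensorProduct.induction_on with
    | zero => simp only [map_zero, smul_zero]
    | add w w' hw hw' => simp only [map_add, hw, hw', smul_add]
    | tmul v u =>
      simp only [TensorProduct.map_tmul, m.T₃_parity₂, LinearMap.id_apply,
        TensorProduct.smul_tmul']
  · intro v
    rw [m.parity₂_exchange, sgn_one, neg_one_smul]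
  · intro x u hx
    rw [hx]; rfl
  · intro x u hx
    rw [hx]; simp
  · intro x u hx
    rw [m'.T_φ, act_tb_of_even B hx]
  · intro x u hx
    rw [m'.T_φ, act_tb_of_odd B hx b' 0, add_zero, map_zsmul]
    rfl

end OddModel

/-- The symmetry of the supertensor product. -/
def stackComm (A B : EqAlg) : (A.stack B).Iso (B.stack A) where
  toAlgEquiv := GradedTensorProduct.comm A.parityGrading B.parityGrading
  map_act g x := by
    refine EquivariantAlgebra.stack_induction A B
      (P := fun x => GradedTensorProduct.comm A.parityGrading B.parityGrading
        (EquivariantAlgebra.stackAdd A B g x) = EquivariantAlgebra.stackAdd B A g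
        (GradedTensorProduct.comm A.parityGrading B.parityGrading x)) ?_ ?_ ?_ x
    · simp only [map_zero]
    · intro x y hx hy
      simp only [map_add, hx, hy]
    · intro i j a b
      have h := GradedTensorProduct.comm_coe_tmul_coe (R := ℂ) A.parityGrading B.parityGrading
        (⟨_, A.act_mem_parityGrading g a.2⟩ : A.parityGrading i)
        (⟨_, B.act_mem_parityGrading g b.2⟩ : B.parityGrading j)
      rw [EquivariantAlgebra.stackAdd_tmul, GradedTensorProduct.comm_coe_tmul_coe, h,
        Units.smul_def, Units.smul_def, map_zsmul, EquivariantAlgebra.stackAdd_tmul]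

/-- The stacking law of types. -/
lemma HasType.stack {A B : EqAlg} {a b c a' b' c' : ZMod 2} (h : HasType A a b c)
    (h' : HasType B a' b' c') :
    HasType (A.stack B) (a + a' + b * b' + (1 + c) * c' * (b * b) + c * (1 + c') * (b' * b'))
      (b + b' + c * c') (c + c') := by
  have e : (1 + 1 : ZMod 2) = 0 := by decide
  rcases zmod_two_cases c with rfl | rfl <;> rcases zmod_two_cases c' with rfl | rfl
  · obtain ⟨m⟩ := hasType_zero.mp h
    obtain ⟨m'⟩ := hasType_zero.mp h'
    simpa [hasType_zero] using m.stack_even m'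
  · obtain ⟨m⟩ := hasType_zero.mp h
    obtain ⟨m'⟩ := hasType_one.mp h'
    simpa [hasType_one, e] using m.stack_odd m'
  · obtain ⟨m⟩ := hasType_one.mp h
    obtain ⟨m'⟩ := hasType_zero.mp h'
    -- Odd times even is reduced to even times odd by the symmetry of the supertensor product.
    refine HasType.ofIso (stackComm A B) ?_
    simpa [hasType_one, e, add_comm a, add_comm b, mul_comm b] using m'.stack_odd m
  · obtain ⟨m⟩ := hasType_one.mp h
    obtain ⟨m'⟩ := hasType_one.mp h'
    simpa [hasType_zero, e] using m.stack_odd m'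

/-! ### Recognition of supertensor products -/

/-- The kernel of `F` is an ideal, and a nonzero ideal of a matrix algebra contains the identity:
sandwich `φ x` between rank-one operators and sum over a basis. -/
lemma exists_φ_eq_one {R C U : Type} [Ring R] [Algebra ℂ R] [Ring C] [AddCommGroup U] [Module ℂ U]
    [FiniteDimensional ℂ U] (φ : R →ₐ[ℂ] Module.End ℂ U) (hφ : Function.Surjective φ)
    (F : R →+* C) {x : R} (hx : F x = 0) (hne : φ x ≠ 0) : ∃ y, F y = 0 ∧ φ y = 1 := by
  obtain ⟨u, hu⟩ : ∃ u, φ x u ≠ 0 := by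
    by_contra! h
    exact hne (LinearMap.ext h)
  obtain ⟨f, hf⟩ := Module.Projective.exists_dual_eq_one ℂ hu
  let β := Module.finBasis ℂ U
  choose r hr using fun i => hφ (f.smulRight (β i))
  choose s hs using fun i => hφ ((β.coord i).smulRight u)
  refine ⟨∑ i, r i * x * s i, ?_, ?_⟩
  · simp [hx]
  · refine LinearMap.ext fun w => ?_
    simp [hr, hs, hf, LinearMap.sum_apply, β.sum_repr w]

/-- Typed algebras are graded simple. In the odd case an element of the kernel with `φ y = 1` is cut
down by `e = (1, 0)`, and adding the parity image of `ye` gives `1`. -/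
lemma HasType.injective {S C : EqAlg} [Nontrivial C.carrier] {a b c : ZMod 2}
    (h : HasType S a b c) (F : S.carrier →ₐ[ℂ] C.carrier)
    (hF : ∀ x, F (S.act p x) = C.act p (F x)) : Function.Injective F := by
  rw [injective_iff_map_eq_zero]
  intro x hx
  by_contra hne
  rcases zmod_two_cases c with rfl | rfl
  · obtain ⟨m⟩ := hasType_zero.mp h
    obtain ⟨y, hy, hy'⟩ := exists_φ_eq_one m.φ m.bijective.2 F.toRingHom hx
      (fun h => hne (m.bijective.1 (h.trans (map_zero _).symm)))
    obtain rfl : y = 1 := m.bijective.1 (hy'.trans (map_one _).symm)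
    exact one_ne_zero ((map_one F).symm.trans hy)
  · obtain ⟨m⟩ := hasType_one.mp h
    obtain ⟨x', hx', hne'⟩ : ∃ x', F x' = 0 ∧ m.φ x' ≠ 0 := by
      by_contra! h'
      exact hne (m.ext_φ ((h' x hx).trans (map_zero _).symm)
        ((h' _ (by rw [hF, hx, map_zero])).trans (by simp)))
    obtain ⟨y, hy, hy'⟩ := exists_φ_eq_one m.φ m.surjective F.toRingHom hx' hne'
    obtain ⟨e, he, he'⟩ := m.exists_φ 1 0
    have h1 : y * e + S.act p (y * e) = 1 := m.ext_φ
      (by simp [hy', he, he']) (by simp [hy', he, he', S.act_p_act_p])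
    have h2 : F (y * e) = 0 := by
      rw [map_mul, show F y = 0 from hy, zero_mul]
    have h3 := congrArg F h1
    rw [map_add, hF, h2, map_zero, add_zero, map_one] at h3
    exact zero_ne_one h3

/-- By graded simplicity a surjection suffices to recognise an algebra, so no dimension of a
Clifford algebra has to be computed. -/
lemma HasType.of_surjective {S C : EqAlg} [Nontrivial C.carrier] {a b c : ZMod 2}
    (h : HasType S a b c) (F : S.carrier →ₐ[ℂ] C.carrier)
    (hF : ∀ g x, F (S.act g x) = C.act g (F x)) (hs : Function.Surjective F) : HasType C a b c :=
  h.ofIso (EquivariantAlgebra.Iso.symm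
    { toAlgEquiv := AlgEquiv.ofBijective F ⟨h.injective F (hF p), hs⟩
      map_act := hF })

/-! ### Complexification and supercommuting generators -/

namespace RealSuperAlgebra

variable {D D' E : RealSuperAlgebra}

lemma parity_parity (D : RealSuperAlgebra) (x : D.carrier) : parity D (parity D x) = x := by
  have h : (Multiplicative.ofAdd 1 : Multiplicative (ZMod 2)) * Multiplicative.ofAdd 1 = 1 := by
    decide
  rw [parity, ← EquivariantAlgebra.act_mul_apply, h, EquivariantAlgebra.act_one_apply]

lemma parity_smul (D : RealSuperAlgebra) (r : ℝ) (x : D.carrier) :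
    parity D (r • x) = r • parity D x := D.act_smul _ _ _

lemma act_cases (g : Multiplicative (ZMod 2)) : g = 1 ∨ g = Multiplicative.ofAdd 1 := by
  revert g; decide

/-- The complexification of a homomorphism. -/
def complexifyHom (f : D.carrier →ₐ[ℝ] E.carrier) :
    (complexify D).carrier →ₐ[ℂ] (complexify E).carrier :=
  Algebra.TensorProduct.map (AlgHom.id ℂ ℂ) f

/-- A pure tensor in the complexification. -/
def cTmul (D : RealSuperAlgebra) (c : ℂ) (x : D.carrier) : (complexify D).carrier :=
  (c ⊗ₜ x : ℂ ⊗[ℝ] D.carrier)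

lemma complexifyHom_cTmul (f : D.carrier →ₐ[ℝ] E.carrier) (c : ℂ) (x : D.carrier) :
    complexifyHom f (cTmul D c x) = cTmul E c (f x) := rfl

lemma act_cTmul (g : G) (c : ℂ) (x : D.carrier) :
    (complexify D).act g (cTmul D c x) = cTmul D (conj (xG g) c) (D.act g.1 x) := rfl

lemma act_p_cTmul (c : ℂ) (x : D.carrier) :
    (complexify D).act p (cTmul D c x) = cTmul D c (parity D x) := rfl

lemma cTmul_add (c : ℂ) (x y : D.carrier) : cTmul D c (x + y) = cTmul D c x + cTmul D c y :=
  TensorProduct.tmul_add _ _ _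

lemma cTmul_sub (c : ℂ) (x y : D.carrier) : cTmul D c (x - y) = cTmul D c x - cTmul D c y :=
  TensorProduct.tmul_sub _ _ _

lemma cTmul_neg (c : ℂ) (x : D.carrier) : cTmul D c (-x) = -cTmul D c x :=
  TensorProduct.tmul_neg _ _

lemma cTmul_zero (c : ℂ) : cTmul D c 0 = 0 := TensorProduct.tmul_zero _ _

lemma add_cTmul (c d : ℂ) (x : D.carrier) : cTmul D (c + d) x = cTmul D c x + cTmul D d x :=
  TensorProduct.add_tmul _ _ _

lemma cTmul_mul_cTmul (c d : ℂ) (x y : D.carrier) :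
    cTmul D c x * cTmul D d y = cTmul D (c * d) (x * y) :=
  Algebra.TensorProduct.tmul_mul_tmul _ _ _ _

lemma cTmul_one_one : cTmul D 1 1 = 1 := rfl

lemma smul_cTmul (c d : ℂ) (x : D.carrier) : c • cTmul D d x = cTmul D (c * d) x := rfl

lemma cTmul_smul (c : ℂ) (r : ℝ) (x : D.carrier) : cTmul D c (r • x) = cTmul D (r * c) x := by
  rw [cTmul, TensorProduct.tmul_smul, TensorProduct.smul_tmul', Complex.real_smul]; rfl

lemma complexify_induction {C : (complexify D).carrier → Prop}
    (hadd : ∀ x y, C x → C y → C (x + y)) (h : ∀ c x, C (cTmul D c x)) (x : (complexify D).carrier) :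
    C x :=
  TensorProduct.induction_on (motive := C) x (by simpa [cTmul] using h 0 0) h hadd

lemma cTmul_injective : Function.Injective (cTmul D 1) :=
  Algebra.TensorProduct.includeRight_injective (R := ℝ) (A := ℂ) (B := D.carrier)
    (algebraMap ℝ ℂ).injective

instance [Nontrivial D.carrier] : Nontrivial (complexify D).carrier :=
  cTmul_injective.nontrivial

lemma complexifyHom_act (f : D.carrier →ₐ[ℝ] E.carrier)
    (hf : ∀ x, f (parity D x) = parity E (f x)) (g : G) (x : (complexify D).carrier) :
    complexifyHom f ((complexify D).act g x) = (complexify E).act g (complexifyHom f x) := by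
  induction x using complexify_induction with
  | hadd x y hx hy => simp only [map_add, hx, hy]
  | h c x =>
    rw [act_cTmul, complexifyHom_cTmul, complexifyHom_cTmul, act_cTmul]
    rcases act_cases g.1 with h | h
    · rw [h, D.act_one_apply, E.act_one_apply]
    · rw [h]; exact congrArg _ (hf x)

/-- A superalgebra that is generated by two supercommuting subalgebras is typed if these are. -/
lemma hasType_of_generators [Nontrivial E.carrier] (f : D.carrier →ₐ[ℝ] E.carrier)
    (g : D'.carrier →ₐ[ℝ] E.carrier) (hf : ∀ x, f (parity D x) = parity E (f x))
    (hg : ∀ x, g (parity D' x) = parity E (g x))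
    (h0 : ∀ x y, f x * g (y + parity D' y) = g (y + parity D' y) * f x)
    (h1 : ∀ x y, f x * g (y - parity D' y) = g (y - parity D' y) * f (parity D x))
    (hs : ∀ z, z ∈ AddSubgroup.closure {z | ∃ x y, z = f x * g y}) {a b c a' b' c' : ZMod 2}
    (hD : HasType (complexify D) a b c) (hD' : HasType (complexify D') a' b' c') :
    HasType (complexify E)
      (a + a' + b * b' + (1 + c) * c' * (b * b) + c * (1 + c') * (b' * b'))
      (b + b' + c * c') (c + c') := by
  -- The combinations `y ± p y` are twice the even and odd parts of `y`; in this form the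
  -- commutation rules are additive in `x` and `y` and extend from pure tensors.
  have k0 : ∀ (x : (complexify D).carrier) (y : (complexify D').carrier),
      complexifyHom f x * complexifyHom g (y + (complexify D').act p y) =
        complexifyHom g (y + (complexify D').act p y) * complexifyHom f x := by
    intro x y
    induction x using complexify_induction with
    | hadd x x' hx hx' => rw [map_add, add_mul, mul_add, hx, hx']
    | h c x =>
      induction y using complexify_induction with
      | hadd y y' hy hy' =>
        rw [map_add ((complexify D').act p), add_add_add_comm, map_add (complexifyHom g), mul_add, add_mul, hy, hy']
      | h d y =>
        rw [act_p_cTmul, ← cTmul_add, complexifyHom_cTmul, complexifyHom_cTmul, cTmul_mul_cTmul,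
          cTmul_mul_cTmul, h0, mul_comm c d]
  have k1 : ∀ (x : (complexify D).carrier) (y : (complexify D').carrier),
      complexifyHom f x * complexifyHom g (y - (complexify D').act p y) =
        complexifyHom g (y - (complexify D').act p y) *
          complexifyHom f ((complexify D).act p x) := by
    intro x y
    induction x using complexify_induction with
    | hadd x x' hx hx' => rw [map_add, map_add, map_add, add_mul, mul_add, hx, hx']
    | h c x =>
      induction y using complexify_induction with
      | hadd y y' hy hy' =>
        rw [map_add ((complexify D').act p), add_sub_add_comm, map_add (complexifyHom g), mul_add, add_mul, hy, hy']
      | h d y =>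
        rw [act_p_cTmul, act_p_cTmul, ← cTmul_sub, complexifyHom_cTmul, complexifyHom_cTmul,
          complexifyHom_cTmul, cTmul_mul_cTmul, cTmul_mul_cTmul, h1, mul_comm c d]
  have two : ∀ (y : (complexify D').carrier), y = (2⁻¹ : ℂ) • (y + y) := by
    intro y
    rw [← two_smul ℂ y, smul_smul]; norm_num
  have hc : ∀ ⦃i j⦄ (x : (complexify D).parityGrading i) (y : (complexify D').parityGrading j),
      complexifyHom f (x : (complexify D).carrier) * complexifyHom g y =
        (-1 : ℤˣ) ^ (j * i) • (complexifyHom g y * complexifyHom f (x : (complexify D).carrier)) := by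
    intro i j x y
    rw [units_smul_eq_sgn]
    rcases zmod_two_cases j with rfl | rfl
    · have h := k0 x y
      rw [parityGrading_zero y.2] at h
      rw [two y.1, map_smul, mul_smul_comm, smul_mul_assoc, h]
      simp
    · have h := k1 x y
      rw [parityGrading_one y.2, sub_neg_eq_add] at h
      rw [two y.1, map_smul, mul_smul_comm, smul_mul_assoc, h]
      rcases zmod_two_cases i with rfl | rfl
      · rw [parityGrading_zero x.2]; simp
      · rw [parityGrading_one x.2]; simp
  refine (hD.stack hD').of_surjective (stackLift (complexifyHom f) (complexifyHom g) hc) ?_ ?_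
  · intro g' x
    induction x using stack_induction' with
    | hadd x y hx hy => simp only [map_add, hx, hy]
    | h0 a b hb =>
      rw [act_stackTmul, stackLift_tmul, stackLift_tmul, complexifyHom_act f hf,
        complexifyHom_act g hg, map_mul]
    | h1 a b hb =>
      rw [act_stackTmul, stackLift_tmul, stackLift_tmul, complexifyHom_act f hf,
        complexifyHom_act g hg, map_mul]
  · intro z
    induction z using complexify_induction with
    | hadd x y hx hy =>
      obtain ⟨x, rfl⟩ := hx
      obtain ⟨y, rfl⟩ := hy
      exact ⟨x + y, map_add _ _ _⟩
    | h c z =>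
      induction hs z using AddSubgroup.closure_induction with
      | mem z hz =>
        obtain ⟨x, y, rfl⟩ := hz
        refine ⟨stackTmul (cTmul D c x) (cTmul D' 1 y), ?_⟩
        rw [stackLift_tmul, complexifyHom_cTmul, complexifyHom_cTmul, cTmul_mul_cTmul, mul_one]
      | zero => exact ⟨0, by rw [map_zero, cTmul_zero]⟩
      | add x y _ _ hx hy =>
        obtain ⟨x, hx⟩ := hx
        obtain ⟨y, hy⟩ := hy
        exact ⟨x + y, by rw [map_add, hx, hy, cTmul_add]⟩
      | neg x _ hx =>
        obtain ⟨x, hx⟩ := hx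
        exact ⟨-x, by rw [map_neg, hx, cTmul_neg]⟩

end RealSuperAlgebra

/-! ### Types of complexified Clifford algebras -/

namespace RealSuperAlgebra

variable {D E : RealSuperAlgebra}

lemma parity_mk {A : Type} [Ring A] [Algebra ℝ A] (P : A →ₐ[ℝ] A) (hP : ∀ a, P (P a) = a) (a : A) :
    parity (RealSuperAlgebra.mk A P hP) a = P a := by
  have h : ¬ (Multiplicative.toAdd (Multiplicative.ofAdd (1 : ZMod 2)) = 0) := by decide
  change (if Multiplicative.toAdd (Multiplicative.ofAdd (1 : ZMod 2)) = 0 then RingHom.id A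
    else P.toRingHom) a = P a
  rw [if_neg h]; rfl

lemma exists_coeff_of_line {V : Type} [AddCommGroup V] [Module ℝ V] (Q : QuadraticForm ℝ V) {v₀ : V}
    {l : V →ₗ[ℝ] ℝ} (hl : ∀ v, v = l v • v₀) (x : CliffordAlgebra Q) :
    ∃ r s : ℝ, x = algebraMap ℝ _ r + s • CliffordAlgebra.ι Q v₀ := by
  induction x using CliffordAlgebra.induction with
  | algebraMap r => exact ⟨r, 0, by simp⟩
  | ι v => exact ⟨0, l v, by rw [map_zero, zero_add, ← map_smul, ← hl]⟩
  | mul x y hx hy =>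
    obtain ⟨r, s, rfl⟩ := hx
    obtain ⟨r', s', rfl⟩ := hy
    refine ⟨r * r' + s * s' * Q v₀, r * s' + s * r', ?_⟩
    simp only [mul_add, add_mul, Algebra.algebraMap_eq_smul_one, smul_mul_smul_comm, mul_one,
      one_mul, CliffordAlgebra.ι_sq_scalar, smul_smul, add_smul]
    abel
  | add x y hx hy =>
    obtain ⟨r, s, rfl⟩ := hx
    obtain ⟨r', s', rfl⟩ := hy
    exact ⟨r + r', s + s', by rw [map_add, add_smul]; abel⟩

lemma cliff_parity_ι (m n : ℕ) (v : Fin m ⊕ Fin n → ℝ) :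
    parity (cliff m n) (CliffordAlgebra.ι (cliffordForm m n) v) =
      -CliffordAlgebra.ι (cliffordForm m n) v :=
  (parity_mk _ _ _).trans (CliffordAlgebra.involute_ι v)

/-- The element of the Clifford algebra that belongs to a vector. -/
def cliffι (m n : ℕ) (v : Fin m ⊕ Fin n → ℝ) : (cliff m n).carrier :=
  CliffordAlgebra.ι (cliffordForm m n) v

lemma parity_cliffι (m n : ℕ) (v : Fin m ⊕ Fin n → ℝ) :
    parity (cliff m n) (cliffι m n v) = -cliffι m n v := cliff_parity_ι m n v

lemma cliffι_mul_self (m n : ℕ) (v : Fin m ⊕ Fin n → ℝ) :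
    cliffι m n v * cliffι m n v = algebraMap ℝ (cliff m n).carrier (cliffordForm m n v) :=
  CliffordAlgebra.ι_sq_scalar _ v

lemma parity_algebraMap (D : RealSuperAlgebra) (r : ℝ) :
    parity D (algebraMap ℝ D.carrier r) = algebraMap ℝ D.carrier r := by
  rw [Algebra.algebraMap_eq_smul_one, parity_smul, map_one]

/-- The universal property of the Clifford algebra. -/
def cliffLift {m n : ℕ} {A : Type} [Ring A] [Algebra ℝ A] (f : (Fin m ⊕ Fin n → ℝ) →ₗ[ℝ] A)
    (hf : ∀ v, f v * f v = algebraMap ℝ A (cliffordForm m n v)) :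
    (cliff m n).carrier →ₐ[ℝ] A :=
  CliffordAlgebra.lift (cliffordForm m n) ⟨f, hf⟩

lemma cliffLift_cliffι {m n : ℕ} {A : Type} [Ring A] [Algebra ℝ A]
    (f : (Fin m ⊕ Fin n → ℝ) →ₗ[ℝ] A)
    (hf : ∀ v, f v * f v = algebraMap ℝ A (cliffordForm m n v)) (v : Fin m ⊕ Fin n → ℝ) :
    cliffLift f hf (cliffι m n v) = f v :=
  CliffordAlgebra.lift_ι_apply f hf v

lemma cliff_induction {m n : ℕ} {C : (cliff m n).carrier → Prop}
    (algebraMap : ∀ r : ℝ, C (algebraMap ℝ (cliff m n).carrier r)) (ι : ∀ v, C (cliffι m n v))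
    (mul : ∀ x y, C x → C y → C (x * y)) (add : ∀ x y, C x → C y → C (x + y))
    (x : (cliff m n).carrier) : C x :=
  CliffordAlgebra.induction (C := C) (algebraMap) (ι) (mul) (add) x

lemma zero_cTmul (x : D.carrier) : cTmul D 0 x = 0 := TensorProduct.zero_tmul _ _

/-- A generator of a Clifford algebra on one generator with square `(-1)^ε`. -/
structure CliffLine (m n : ℕ) (ε : ZMod 2) where
  v₀ : Fin m ⊕ Fin n → ℝ
  l : (Fin m ⊕ Fin n → ℝ) →ₗ[ℝ] ℝ
  l_v₀ : l v₀ = 1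
  smul_v₀ : ∀ v, v = l v • v₀
  form : cliffordForm m n v₀ = sgn ε

namespace CliffLine

/-- `Cℓ_{1,0}`. -/
def pos : CliffLine 1 0 0 where
  v₀ := fun _ => 1
  l := LinearMap.proj (Sum.inl 0)
  l_v₀ := rfl
  smul_v₀ v := by
    ext i
    rcases i with i | i
    · obtain rfl := Subsingleton.elim i 0
      simp
    · exact i.elim0
  form := by simp [cliffordForm, QuadraticMap.weightedSumSquares_apply]

/-- `Cℓ_{0,1}`. -/
def neg : CliffLine 0 1 1 where
  v₀ := fun _ => 1
  l := LinearMap.proj (Sum.inr 0)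
  l_v₀ := rfl
  smul_v₀ v := by
    ext i
    rcases i with i | i
    · exact i.elim0
    · obtain rfl := Subsingleton.elim i 0
      simp
  form := by simp [cliffordForm, QuadraticMap.weightedSumSquares_apply]

variable {m n : ℕ} {ε : ZMod 2} (L : CliffLine m n ε)

lemma form_apply (v : Fin m ⊕ Fin n → ℝ) : cliffordForm m n v = l L v * l L v * sgn ε := by
  conv_lhs => rw [L.smul_v₀ v, QuadraticMap.map_smul, L.form]
  rfl

/-- The generator. -/
def gen : (cliff m n).carrier := cliffι m n L.v₀

lemma parity_gen : parity (cliff m n) L.gen = -L.gen := parity_cliffι m n L.v₀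

lemma gen_mul_gen : L.gen * L.gen = (sgn ε : ℝ) • (1 : (cliff m n).carrier) := by
  rw [gen, cliffι_mul_self, L.form, Algebra.algebraMap_eq_smul_one]

lemma exists_coeff (x : (cliff m n).carrier) :
    ∃ r s : ℝ, x = algebraMap ℝ (cliff m n).carrier r + s • L.gen :=
  exists_coeff_of_line (cliffordForm m n) L.smul_v₀ x

/-- The homomorphism that sends the generator to `e`. -/
def lift {A : Type} [Ring A] [Algebra ℝ A] (e : A) (he : e * e = (sgn ε : ℝ) • (1 : A)) :
    (cliff m n).carrier →ₐ[ℝ] A :=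
  cliffLift ((LinearMap.toSpanSingleton ℝ A e).comp L.l) (fun v => by
    simp only [LinearMap.comp_apply, LinearMap.toSpanSingleton_apply]
    rw [L.form_apply, smul_mul_smul_comm, he, smul_smul, Algebra.algebraMap_eq_smul_one])

lemma lift_gen {A : Type} [Ring A] [Algebra ℝ A] (e : A) (he : e * e = (sgn ε : ℝ) • (1 : A)) :
    L.lift e he L.gen = e := by
  rw [lift, gen, cliffLift_cliffι]
  simp [L.l_v₀]

lemma exists_coeff_complexify (x : (complexify (cliff m n)).carrier) :
    ∃ c d : ℂ, x = cTmul _ c 1 + cTmul _ d L.gen := by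
  induction x using complexify_induction with
  | hadd x y hx hy =>
    obtain ⟨c, d, rfl⟩ := hx
    obtain ⟨c', d', rfl⟩ := hy
    exact ⟨c + c', d + d', by rw [add_cTmul, add_cTmul]; abel⟩
  | h c x =>
    obtain ⟨r, s, rfl⟩ := L.exists_coeff x
    exact ⟨r * c, s * c, by
      rw [cTmul_add, Algebra.algebraMap_eq_smul_one, cTmul_smul, cTmul_smul]⟩

/-- A square root of `(-1)^ε`. -/
def root (ε : ZMod 2) : ℂ := if ε = 0 then 1 else Complex.I

lemma root_mul_root (ε : ZMod 2) : root ε * root ε = (sgn ε : ℝ) • (1 : ℂ) := by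
  rcases zmod_two_cases ε with rfl | rfl <;> simp [root]

lemma conj_root (ε : ZMod 2) : starRingEnd ℂ (root ε) = sgn ε * root ε := by
  rcases zmod_two_cases ε with rfl | rfl <;> simp [root]

lemma root_ne_zero (ε : ZMod 2) : root ε ≠ 0 := by
  rcases zmod_two_cases ε with rfl | rfl <;> simp [root]

/-- The character of `Cℓ₁ ⊗ ℂ`. -/
def char : (complexify (cliff m n)).carrier →ₐ[ℂ] ℂ :=
  Algebra.TensorProduct.lift (AlgHom.id ℂ ℂ) (L.lift (root ε) (root_mul_root ε))
    (fun _ _ => Commute.all _ _)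

lemma char_cTmul (c : ℂ) (x : (cliff m n).carrier) :
    L.char (cTmul _ c x) = c * L.lift (root ε) (root_mul_root ε) x :=
  Algebra.TensorProduct.lift_tmul _ _ _ c x

/-- The algebra is `ℂ × ℂ` through the characters sending the generator to `± root ε`. Conjugation
fixes this root for `ε = 0` and negates it for `ε = 1`, so the reversal that preserves the
characters is `tb ε`; it acts on `ℂ` by conjugation, with square `1`. -/
lemma hasType (L : CliffLine m n ε) : HasType (complexify (cliff m n)) 0 ε 1 := by
  refine hasType_one.mpr ⟨{
    U := ℂ
    φ := (Algebra.lmul ℂ ℂ).comp L.char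
    bijective := ⟨fun x y h => ?_, fun ⟨M, N⟩ => ?_⟩
    T := { toFun := starRingEnd ℂ, map_add' := map_add _, map_smul' := fun c u => by simp }
    T_T := fun u => by simp
    T_φ := fun x u => ?_ }⟩
  · rw [← sub_eq_zero]
    obtain ⟨c, d, hcd⟩ := L.exists_coeff_complexify (x - y)
    have h1 : L.char (x - y) = 0 := by
      have := LinearMap.congr_fun (congrArg Prod.fst h) 1
      simpa [sub_eq_zero] using this
    have h2 : L.char ((complexify (cliff m n)).act p (x - y)) = 0 := by
      have := LinearMap.congr_fun (congrArg Prod.snd h) 1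
      simpa [sub_eq_zero] using this
    rw [hcd, map_add, char_cTmul, char_cTmul, map_one, lift_gen] at h1
    rw [hcd, map_add, act_p_cTmul, act_p_cTmul, L.parity_gen, map_one, map_add, char_cTmul,
      char_cTmul, map_one, map_neg, lift_gen] at h2
    have hc : c = 0 := by linear_combination (h1 + h2) / 2
    have hd : d = 0 := by
      have : d * root ε = 0 := by linear_combination (h1 - h2) / 2
      exact (mul_eq_zero.mp this).resolve_right (root_ne_zero ε)
    rw [hcd, hc, hd, zero_cTmul, zero_cTmul, add_zero]
  · refine ⟨cTmul _ ((M 1 + N 1) / 2) 1 + cTmul _ ((M 1 - N 1) / (2 * root ε)) L.gen, ?_⟩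
    have hr := root_ne_zero ε
    refine Prod.ext (LinearMap.ext_ring ?_) (LinearMap.ext_ring ?_)
    · simp only [AlgHom.comp_apply, map_add, char_cTmul, map_one, lift_gen]
      simp
      field_simp
      ring
    · simp only [AlgHom.comp_apply, map_add, act_p_cTmul, L.parity_gen, char_cTmul, map_one,
        map_neg, lift_gen]
      simp
      field_simp
      ring
  · obtain ⟨c, d, rfl⟩ := L.exists_coeff_complexify x
    have h : ∀ ε : ZMod 2, (tb ε).1 = 1 ∧ sgn ε = 1 ∨ (tb ε).1 = Multiplicative.ofAdd 1 ∧
      sgn ε = -1 := by decide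
    have hg : (cliff m n).act (tb ε).1 L.gen = (sgn ε : ℝ) • L.gen := by
      rcases h ε with ⟨h, h'⟩ | ⟨h, h'⟩
      · rw [h, EquivariantAlgebra.act_one_apply, h']; simp
      · rw [h, h']
        refine L.parity_gen.trans ?_
        simp
    simp only [AlgHom.comp_apply, map_add, char_cTmul, act_cTmul, map_one, hg, map_smul, lift_gen,
      xG_tb, conj_one]
    simp [conj_root]

end CliffLine

/-- Adjunction of an odd generator with square `(-1)^ε`. -/
lemma hasType_adjoin [Nontrivial E.carrier] (f : D.carrier →ₐ[ℝ] E.carrier)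
    (hf : ∀ x, f (parity D x) = parity E (f x)) {ε : ZMod 2} {m n : ℕ} (L : CliffLine m n ε)
    (e : E.carrier) (hp : parity E e = -e) (he : e * e = (sgn ε : ℝ) • (1 : E.carrier))
    (hc : ∀ x, f x * e = e * f (parity D x)) (hs : ∀ z, ∃ x y, z = f x + f y * e)
    {a b c : ZMod 2} (hD : HasType (complexify D) a b c) :
    HasType (complexify E) (a + b * ε + (1 + c) * (b * b)) (b + ε + c) (c + 1) := by
  have h2 : (1 + 1 : ZMod 2) = 0 := by decide
  -- The generator spans a subalgebra of type `(0, ε, 1)`, and the claim is the stacking law with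
  -- this second argument.
  have key := hasType_of_generators f (L.lift e he) hf ?_ ?_ ?_ ?_ hD L.hasType
  · simpa [h2] using key
  · intro y
    obtain ⟨r, s, rfl⟩ := L.exists_coeff y
    rw [map_add, parity_algebraMap, parity_smul, L.parity_gen, map_add, map_add, map_smul,
      map_smul, map_neg, L.lift_gen, AlgHom.commutes, map_add, parity_algebraMap, parity_smul, hp]
  · intro x y
    obtain ⟨r, s, rfl⟩ := L.exists_coeff y
    have h : algebraMap ℝ (cliff m n).carrier r + s • L.gen +
        parity (cliff m n) (algebraMap ℝ (cliff m n).carrier r + s • L.gen) =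
        algebraMap ℝ (cliff m n).carrier (r + r) := by
      rw [map_add, parity_algebraMap, parity_smul, L.parity_gen, smul_neg, add_add_add_comm,
        add_neg_cancel, add_zero, map_add]
    rw [h, AlgHom.commutes, Algebra.commutes]
  · intro x y
    obtain ⟨r, s, rfl⟩ := L.exists_coeff y
    rw [map_add, parity_algebraMap, parity_smul, L.parity_gen, smul_neg, add_sub_add_left_eq_sub,
      sub_neg_eq_add, map_add, map_smul, L.lift_gen, mul_add, add_mul, mul_smul_comm,
      smul_mul_assoc, hc]
  · intro z
    obtain ⟨x, y, rfl⟩ := hs z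
    refine add_mem (AddSubgroup.subset_closure ⟨x, 1, by rw [map_one, mul_one]⟩)
      (AddSubgroup.subset_closure ⟨y, L.gen, by rw [L.lift_gen]⟩)

end RealSuperAlgebra

namespace RealSuperAlgebra

/-! ### The purely even algebras -/

/-- The superalgebra of the real numbers. -/
def realAlg : RealSuperAlgebra :=
  RealSuperAlgebra.mk ℝ (AlgHom.id ℝ ℝ) (fun _ => rfl)

lemma parity_realAlg (x : realAlg.carrier) : parity realAlg x = x := parity_mk _ _ _

lemma realAlg_exists (x : realAlg.carrier) : ∃ r : ℝ, x = r • (1 : realAlg.carrier) :=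
  ⟨(x : ℝ), (mul_one (x : ℝ)).symm⟩

/-- The complexification of the real numbers. -/
def realChar : (complexify realAlg).carrier →ₐ[ℂ] ℂ :=
  Algebra.TensorProduct.lift (AlgHom.id ℂ ℂ) (Algebra.ofId ℝ ℂ) (fun _ _ => Commute.all _ _)

lemma realChar_cTmul (c : ℂ) : realChar (cTmul realAlg c 1) = c :=
  (Algebra.TensorProduct.lift_tmul _ _ _ c (1 : ℝ)).trans
    ((congrArg (c * ·) (map_one (Algebra.ofId ℝ ℂ))).trans (mul_one c))

lemma complexify_realAlg_exists (x : (complexify realAlg).carrier) :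
    ∃ c, x = cTmul realAlg c 1 := by
  induction x using complexify_induction with
  | hadd x y hx hy =>
    obtain ⟨c, rfl⟩ := hx
    obtain ⟨d, rfl⟩ := hy
    exact ⟨c + d, (add_cTmul _ _ _).symm⟩
  | h c r =>
    obtain ⟨r, rfl⟩ := realAlg_exists r
    exact ⟨r * c, cTmul_smul _ _ _⟩

lemma hasType_real : HasType (complexify realAlg) 0 0 0 := by
  refine hasType_zero.mpr ⟨{
    U := ℂ
    φ := (Algebra.lmul ℂ ℂ).comp realChar
    bijective := ⟨fun x y h => ?_, fun M => ?_⟩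
    P := LinearMap.id
    T := { toFun := starRingEnd ℂ, map_add' := map_add _, map_smul' := fun c u => by simp }
    P_P := fun u => rfl
    T_T := fun u => by simp
    T_P := fun u => by simp
    P_φ := fun x u => ?_
    T_φ := fun x u => ?_ }⟩
  · obtain ⟨c, rfl⟩ := complexify_realAlg_exists x
    obtain ⟨d, rfl⟩ := complexify_realAlg_exists y
    have := LinearMap.congr_fun h 1
    simp only [AlgHom.comp_apply, realChar_cTmul] at this
    simp at this
    rw [this]
  · refine ⟨cTmul realAlg (M 1) 1, LinearMap.ext_ring ?_⟩
    simp only [AlgHom.comp_apply, realChar_cTmul]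
    simp
  · obtain ⟨c, rfl⟩ := complexify_realAlg_exists x
    rw [act_p_cTmul, parity_realAlg]
    rfl
  · obtain ⟨c, rfl⟩ := complexify_realAlg_exists x
    rw [act_cTmul, map_one]
    simp only [AlgHom.comp_apply, realChar_cTmul, xG_tb, conj_one]
    simp

/-- The complex representation of the quaternions on `ℂ × ℂ`. -/
def quatBasis : QuaternionAlgebra.Basis (Module.End ℂ (ℂ × ℂ)) (-1 : ℝ) 0 (-1) where
  i := (Complex.I • LinearMap.fst ℂ ℂ ℂ).prod (-(Complex.I • LinearMap.snd ℂ ℂ ℂ))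
  j := (-(LinearMap.snd ℂ ℂ ℂ)).prod (LinearMap.fst ℂ ℂ ℂ)
  k := (-(Complex.I • LinearMap.snd ℂ ℂ ℂ)).prod (-(Complex.I • LinearMap.fst ℂ ℂ ℂ))
  i_mul_i := by
    refine LinearMap.ext fun v => Prod.ext ?_ ?_ <;> simp [← mul_assoc]
  j_mul_j := by
    refine LinearMap.ext fun v => Prod.ext ?_ ?_ <;> simp
  i_mul_j := by
    refine LinearMap.ext fun v => Prod.ext ?_ ?_ <;> simp
  j_mul_i := by
    refine LinearMap.ext fun v => Prod.ext ?_ ?_ <;> simp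

/-- The superalgebra of the quaternions. -/
def quat : RealSuperAlgebra :=
  RealSuperAlgebra.mk (Quaternion ℝ) (AlgHom.id ℝ _) (fun _ => rfl)

lemma parity_quat (x : quat.carrier) : parity quat x = x := parity_mk _ _ _

/-- The complex representation of the quaternions, as a homomorphism. -/
def quatHom : quat.carrier →ₐ[ℝ] Module.End ℂ (ℂ × ℂ) := QuaternionAlgebra.lift quatBasis

lemma quatHom_apply (q : ℍ[ℝ]) (v : ℂ × ℂ) :
    quatHom q v =
      ((q.re + q.imI * Complex.I) * v.1 - (q.imJ + q.imK * Complex.I) * v.2,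
      (q.imJ - q.imK * Complex.I) * v.1 + (q.re - q.imI * Complex.I) * v.2) := by
  have key : ∀ q : QuaternionAlgebra ℝ (-1) 0 (-1), quatBasis.lift q v =
      ((q.re + q.imI * Complex.I) * v.1 - (q.imJ + q.imK * Complex.I) * v.2,
      (q.imJ - q.imK * Complex.I) * v.1 + (q.re - q.imI * Complex.I) * v.2) := by
    intro q
    rw [QuaternionAlgebra.Basis.lift]
    refine Prod.ext ?_ ?_
    · simp [quatBasis]
      ring
    · simp [quatBasis]
      ring
  exact key q

/-- The complex representation of the complexified quaternions. -/
def quatRep : (complexify quat).carrier →ₐ[ℂ] Module.End ℂ (ℂ × ℂ) :=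
  Algebra.TensorProduct.lift (Algebra.ofId ℂ _) quatHom (fun c _ => Algebra.commutes c _)

lemma quatRep_cTmul (c : ℂ) (q : quat.carrier) (v : ℂ × ℂ) :
    quatRep (cTmul quat c q) v = c • quatHom q v := by
  have h : quatRep (cTmul quat c q) = algebraMap ℂ (Module.End ℂ (ℂ × ℂ)) c *
      quatHom q := Algebra.TensorProduct.lift_tmul _ _ _ c q
  rw [h, Module.End.mul_apply, Module.algebraMap_end_apply]

/-- The quaternionic structure. -/
def quatT : ℂ × ℂ →ₛₗ[starRingEnd ℂ] ℂ × ℂ where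
  toFun v := (-starRingEnd ℂ v.2, starRingEnd ℂ v.1)
  map_add' v w := by simp [add_comm]
  map_smul' c v := by simp

lemma quatT_apply (v : ℂ × ℂ) : quatT v = (-starRingEnd ℂ v.2, starRingEnd ℂ v.1) := rfl

lemma quatT_quatHom (q : ℍ[ℝ]) (v : ℂ × ℂ) : quatT (quatHom q v) = quatHom q (quatT v) := by
  rw [quatT_apply, quatT_apply, quatHom_apply, quatHom_apply]
  refine Prod.ext ?_ ?_
  · simp
    ring
  · simp
    ring

lemma quatRep_surjective : Function.Surjective quatRep := by
  intro M
  let q : ℝ → ℝ → ℝ → ℝ → quat.carrier := fun a b c d => (⟨a, b, c, d⟩ : ℍ[ℝ])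
  have hq : ∀ a b c d v, quatHom (q a b c d) v =
      (((a : ℂ) + b * Complex.I) * v.1 - (c + d * Complex.I) * v.2,
      (c - d * Complex.I) * v.1 + (a - b * Complex.I) * v.2) := fun a b c d v => quatHom_apply _ v
  -- The coordinates of a complex two by two matrix in the basis `1`, `i`, `j`, `k`.
  refine ⟨cTmul quat (((M (1, 0)).1 + (M (0, 1)).2) / 2) (q 1 0 0 0) +
    cTmul quat (((M (1, 0)).1 - (M (0, 1)).2) / 2 * -Complex.I) (q 0 1 0 0) +
    cTmul quat (((M (1, 0)).2 - (M (0, 1)).1) / 2) (q 0 0 1 0) +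
    cTmul quat (((M (1, 0)).2 + (M (0, 1)).1) / 2 * Complex.I) (q 0 0 0 1), ?_⟩
  have hM : ∀ v : ℂ × ℂ, M v = v.1 • M (1, 0) + v.2 • M (0, 1) := by
    intro v
    rw [← map_smul, ← map_smul, ← map_add]; simp
  refine LinearMap.ext fun v => ?_
  rw [hM v]
  simp only [map_add, LinearMap.add_apply, quatRep_cTmul, hq]
  have hI : Complex.I * Complex.I = -1 := Complex.I_mul_I
  refine Prod.ext ?_ ?_
  · simp
    linear_combination (-(1 / 2) * ((M (1, 0)).1 - (M (0, 1)).2) * v.1 -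
      (1 / 2) * ((M (1, 0)).2 + (M (0, 1)).1) * v.2) * hI
  · simp
    linear_combination ((1 / 2) * ((M (1, 0)).1 - (M (0, 1)).2) * v.2 -
      (1 / 2) * ((M (1, 0)).2 + (M (0, 1)).1) * v.1) * hI

/-- The sign `a = 1` is the square of the quaternionic structure `quatT`, which commutes with `ℍ`;
parity is trivial, so `b = 0`. -/
lemma hasType_quat : HasType (complexify quat) 1 0 0 := by
  have h4 : Module.finrank ℂ (complexify quat).carrier = 4 :=
    (Module.finrank_baseChange (R := ℂ) (S := ℝ) (M' := ℍ[ℝ])).trans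
      Quaternion.finrank_eq_four
  have : FiniteDimensional ℂ (complexify quat).carrier :=
    Module.finite_of_finrank_pos (by rw [h4]; norm_num)
  refine hasType_zero.mpr ⟨{
    U := ℂ × ℂ
    φ := quatRep
    bijective := bijective_of_surjective_end quatRep quatRep_surjective (by rw [h4]; simp)
    P := LinearMap.id
    T := quatT
    P_P := fun u => rfl
    T_T := fun u => by simp [quatT_apply, Prod.ext_iff]
    T_P := fun u => by simp
    P_φ := fun x u => ?_
    T_φ := fun x u => ?_ }⟩
  · induction x using complexify_induction with
    | hadd x y hx hy => rw [map_add, LinearMap.add_apply, map_add, hx, hy, map_add, map_add]; rfl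
    | h c q => rw [act_p_cTmul, parity_quat]; rfl
  · induction x using complexify_induction with
    | hadd x y hx hy => rw [map_add, LinearMap.add_apply, map_add, hx, hy, map_add, map_add]; rfl
    | h c q =>
      have h1 : quat.act (tb 0).1 q = q := quat.act_one_apply q
      rw [act_cTmul, quatRep_cTmul, quatRep_cTmul, map_smulₛₗ, h1]
      exact congrArg _ (quatT_quatHom q u)

end RealSuperAlgebra

/-! ### Types of the Clifford algebras and of the algebras in the table -/

namespace RealSuperAlgebra

instance (m n : ℕ) : Nontrivial (cliff m n).carrier := by
  let _ : Invertible (2 : ℝ) := invertibleOfNonzero two_ne_zero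
  exact inferInstanceAs (Nontrivial (CliffordAlgebra (cliffordForm m n)))

/-- The larger quadratic space is the orthogonal sum of the image of `j` and the line of `v₁`.
Orthogonality makes the new generator anticommute with the old ones, so it supercommutes with the
old subalgebra, and everything takes the form `x + y e`. -/
lemma hasType_cliff_adjoin {m n m' n' : ℕ} {ε : ZMod 2}
    (j : (Fin m ⊕ Fin n → ℝ) →ₗ[ℝ] (Fin m' ⊕ Fin n' → ℝ)) (v₁ : Fin m' ⊕ Fin n' → ℝ)
    (hj : ∀ v, cliffordForm m' n' (j v) = cliffordForm m n v)
    (ho : ∀ v, cliffordForm m' n' (j v + v₁) = cliffordForm m' n' (j v) + cliffordForm m' n' v₁)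
    (hv : cliffordForm m' n' v₁ = sgn ε) (hs : ∀ w, ∃ v, ∃ r : ℝ, w = j v + r • v₁)
    {m₀ n₀ : ℕ} (L : CliffLine m₀ n₀ ε) {a b c : ZMod 2}
    (h : HasType (complexify (cliff m n)) a b c) :
    HasType (complexify (cliff m' n')) (a + b * ε + (1 + c) * (b * b)) (b + ε + c) (c + 1) := by
  let f : (cliff m n).carrier →ₐ[ℝ] (cliff m' n').carrier :=
    cliffLift ({ toFun := fun v => cliffι m' n' (j v)
                 map_add' := fun v w => by rw [map_add]; exact map_add _ _ _
                 map_smul' := fun r v => by rw [map_smul]; exact map_smul _ _ _ })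
      (fun v => (cliffι_mul_self m' n' (j v)).trans (by rw [hj]))
  have hfι : ∀ v, f (cliffι m n v) = cliffι m' n' (j v) := fun v => cliffLift_cliffι _ _ v
  have hfp : ∀ x, f (parity (cliff m n) x) = parity (cliff m' n') (f x) := by
    intro x
    induction x using cliff_induction with
    | algebraMap r => rw [parity_algebraMap, AlgHom.commutes, parity_algebraMap]
    | ι v => rw [parity_cliffι, map_neg, hfι, parity_cliffι]
    | mul x y hx hy => rw [map_mul, map_mul, hx, hy, map_mul, map_mul]
    | add x y hx hy => rw [map_add, map_add, hx, hy, map_add, map_add]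
  have hc : ∀ x, f x * cliffι m' n' v₁ = cliffι m' n' v₁ * f (parity (cliff m n) x) := by
    intro x
    induction x using cliff_induction with
    | algebraMap r => rw [parity_algebraMap, AlgHom.commutes, Algebra.commutes]
    | ι v =>
      rw [parity_cliffι, map_neg, hfι, mul_neg, ← add_eq_zero_iff_eq_neg]
      exact CliffordAlgebra.ι_mul_ι_add_swap_of_isOrtho (ho v)
    | mul x y hx hy => rw [map_mul, map_mul, mul_assoc, hy, ← mul_assoc, hx, mul_assoc, map_mul]
    | add x y hx hy => rw [map_add, map_add, map_add, add_mul, mul_add, hx, hy]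
  have he : cliffι m' n' v₁ * cliffι m' n' v₁ = (sgn ε : ℝ) • (1 : (cliff m' n').carrier) := by
    rw [cliffι_mul_self, hv, Algebra.algebraMap_eq_smul_one]
  have hfp' : ∀ x, cliffι m' n' v₁ * f x = f (parity (cliff m n) x) * cliffι m' n' v₁ := by
    intro x
    rw [hc, parity_parity]
  refine hasType_adjoin f hfp L (cliffι m' n' v₁) (parity_cliffι _ _ _) he hc (fun z => ?_) h
  induction z using cliff_induction with
  | algebraMap r => exact ⟨algebraMap ℝ _ r, 0, by simp⟩
  | ι w =>
    obtain ⟨v, r, rfl⟩ := hs w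
    refine ⟨cliffι m n v, algebraMap ℝ _ r, ?_⟩
    rw [hfι, AlgHom.commutes, ← Algebra.smul_def]
    exact (map_add _ _ _).trans (congrArg _ (map_smul _ _ _))
  | mul z z' hz hz' =>
    obtain ⟨x, y, rfl⟩ := hz
    obtain ⟨x', y', rfl⟩ := hz'
    -- Multiply out with `e x' = parity(x') e` and `e² = (-1)^ε`.
    refine ⟨x * x' + (sgn ε : ℝ) • (y * parity (cliff m n) y'),
      x * y' + y * parity (cliff m n) x', ?_⟩
    have h1 : f y * cliffι m' n' v₁ * (f y' * cliffι m' n' v₁) =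
        (sgn ε : ℝ) • (f y * f (parity (cliff m n) y')) := by
      rw [mul_assoc, ← mul_assoc (cliffι m' n' v₁), hfp', mul_assoc (f (parity _ _)), he,
        mul_smul_comm, mul_smul_comm, mul_one]
    have h2 : f y * cliffι m' n' v₁ * f x' =
        f y * f (parity (cliff m n) x') * cliffι m' n' v₁ := by
      rw [mul_assoc, hfp', ← mul_assoc]
    rw [mul_add, add_mul, add_mul, h1, h2, map_add, map_smul, map_mul, map_mul, map_add, map_mul,
      map_mul, add_mul, mul_assoc (f x)]
    abel
  | add z z' hz hz' =>
    obtain ⟨x, y, rfl⟩ := hz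
    obtain ⟨x', y', rfl⟩ := hz'
    exact ⟨x + x', y + y', by rw [map_add, map_add, add_mul]; abel⟩

lemma cliffordForm_apply (m n : ℕ) (v : Fin m ⊕ Fin n → ℝ) : cliffordForm m n v =
    ∑ i, v (Sum.inl i) * v (Sum.inl i) - ∑ i, v (Sum.inr i) * v (Sum.inr i) := by
  simp [cliffordForm, QuadraticMap.weightedSumSquares_apply, sub_eq_add_neg]

lemma hasType_cliff_pos_succ (n : ℕ) {a b c : ZMod 2} (h : HasType (complexify (cliff n 0)) a b c) :
    HasType (complexify (cliff (n + 1) 0)) (a + (1 + c) * (b * b)) (b + c) (c + 1) := by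
  have key := hasType_cliff_adjoin (m' := n + 1) (n' := 0) (ε := 0)
    { toFun := fun v => Sum.elim (Fin.cons 0 (fun i => v (Sum.inl i))) Fin.elim0
      map_add' := fun v w => by
        ext i
        rcases i with i | i
        · refine Fin.cases ?_ (fun i => ?_) i <;> simp
        · exact i.elim0
      map_smul' := fun r v => by
        ext i
        rcases i with i | i
        · refine Fin.cases ?_ (fun i => ?_) i <;> simp
        · exact i.elim0 }
    (Sum.elim (Fin.cons 1 0) Fin.elim0) (fun v => ?_) (fun v => ?_) ?_ (fun w => ?_) CliffLine.pos h
  · simpa using key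
  · simp [cliffordForm_apply, Fin.sum_univ_succ]
  · simp [cliffordForm_apply, Fin.sum_univ_succ, add_comm]
  · simp [cliffordForm_apply, Fin.sum_univ_succ]
  · refine ⟨fun i => w (i.map Fin.succ id), w (Sum.inl 0), ?_⟩
    ext i
    rcases i with i | i
    · refine Fin.cases ?_ (fun i => ?_) i <;> simp
    · exact i.elim0

lemma hasType_cliff_neg_succ (n : ℕ) {a b c : ZMod 2} (h : HasType (complexify (cliff 0 n)) a b c) :
    HasType (complexify (cliff 0 (n + 1))) (a + b + (1 + c) * (b * b)) (b + 1 + c) (c + 1) := by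
  have key := hasType_cliff_adjoin (m' := 0) (n' := n + 1) (ε := 1)
    { toFun := fun v => Sum.elim Fin.elim0 (Fin.cons 0 (fun i => v (Sum.inr i)))
      map_add' := fun v w => by
        ext i
        rcases i with i | i
        · exact i.elim0
        · refine Fin.cases ?_ (fun i => ?_) i <;> simp
      map_smul' := fun r v => by
        ext i
        rcases i with i | i
        · exact i.elim0
        · refine Fin.cases ?_ (fun i => ?_) i <;> simp }
    (Sum.elim Fin.elim0 (Fin.cons 1 0)) (fun v => ?_) (fun v => ?_) ?_ (fun w => ?_) CliffLine.neg h
  · simpa using key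
  · simp [cliffordForm_apply, Fin.sum_univ_succ]
  · simp [cliffordForm_apply, Fin.sum_univ_succ, add_comm]
  · simp [cliffordForm_apply, Fin.sum_univ_succ]
  · refine ⟨fun i => w (i.map id Fin.succ), w (Sum.inr 0), ?_⟩
    ext i
    rcases i with i | i
    · exact i.elim0
    · refine Fin.cases ?_ (fun i => ?_) i <;> simp

instance (m n : ℕ) : Nontrivial (quatCliff m n).carrier :=
  (Algebra.TensorProduct.includeRight_injective (R := ℝ) (A := Quaternion ℝ)
    (B := CliffordAlgebra (cliffordForm m n)) (algebraMap ℝ (Quaternion ℝ)).injective).nontrivial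
    (α := (cliff m n).carrier)

/-- As `ℍ` is even, supercommuting with it is commuting. The same generators yield both the type of
the algebra and its super-division property. -/
lemma exists_quatCliff_generators {m n : ℕ} {ε : ZMod 2} (L : CliffLine m n ε) :
    ∃ (f : quat.carrier →ₐ[ℝ] (quatCliff m n).carrier) (e : (quatCliff m n).carrier),
      (∀ x, parity (quatCliff m n) (f x) = f x) ∧ parity (quatCliff m n) e = -e ∧
      e * e = (sgn ε : ℝ) • (1 : (quatCliff m n).carrier) ∧ (∀ x, f x * e = e * f x) ∧
      ∀ z, ∃ x y, z = f x + f y * e := by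
  have hp : ∀ x, parity (quatCliff m n) x = Algebra.TensorProduct.map (AlgHom.id ℝ _)
    CliffordAlgebra.involute x := fun x => parity_mk _ _ x
  let f : quat.carrier →ₐ[ℝ] (quatCliff m n).carrier := Algebra.TensorProduct.includeLeft
  let g : (cliff m n).carrier →ₐ[ℝ] (quatCliff m n).carrier := Algebra.TensorProduct.includeRight
  refine ⟨f, g L.gen, fun x => ?_, ?_, ?_, fun x => ?_, fun z => ?_⟩
  · rw [hp]
    exact (Algebra.TensorProduct.map_tmul _ _ _ _).trans (by rw [map_one]; rfl)
  · rw [hp]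
    refine (Algebra.TensorProduct.map_tmul _ _ _ _).trans ?_
    have h : CliffordAlgebra.involute (CliffordAlgebra.ι (cliffordForm m n) L.v₀) =
      -CliffordAlgebra.ι (cliffordForm m n) L.v₀ := CliffordAlgebra.involute_ι _
    refine (congrArg (fun y => (1 : Quaternion ℝ) ⊗ₜ[ℝ] y) h).trans ?_
    exact TensorProduct.tmul_neg _ _
  · rw [← map_mul, L.gen_mul_gen, map_smul, map_one]
  · have h : ∀ (q : Quaternion ℝ) (y : CliffordAlgebra (cliffordForm m n)),
        (q ⊗ₜ[ℝ] (1 : CliffordAlgebra (cliffordForm m n))) * ((1 : Quaternion ℝ) ⊗ₜ[ℝ] y) =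
        ((1 : Quaternion ℝ) ⊗ₜ[ℝ] y) * (q ⊗ₜ[ℝ] (1 : CliffordAlgebra (cliffordForm m n))) := by
      intro q y
      rw [Algebra.TensorProduct.tmul_mul_tmul, Algebra.TensorProduct.tmul_mul_tmul, mul_one, one_mul,
        mul_one, one_mul]
    exact h x L.gen
  · refine TensorProduct.induction_on (motive := fun z => ∃ x y, z = f x + f y * g L.gen) z
      ⟨0, 0, by rw [map_zero, zero_mul, add_zero]; rfl⟩ (fun q x => ?_) (fun z z' hz hz' => ?_)
    · obtain ⟨r, s, hx⟩ := L.exists_coeff x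
      have h1 : ((q : Quaternion ℝ) ⊗ₜ[ℝ] x : Quaternion ℝ ⊗[ℝ] CliffordAlgebra (cliffordForm m n)) =
        f q * g x := ((Algebra.TensorProduct.tmul_mul_tmul _ _ _ _).trans
          (by rw [mul_one]; exact congrArg _ (one_mul _))).symm
      refine ⟨r • (q : Quaternion ℝ), s • (q : Quaternion ℝ), h1.trans ?_⟩
      have h2 : ∀ r : ℝ, f (r • (q : Quaternion ℝ)) = r • f q := fun r => map_smul f r _
      rw [h2, h2, hx, map_add, map_smul, AlgHom.commutes, mul_add, mul_smul_comm, smul_mul_assoc,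
        ← Algebra.commutes, ← Algebra.smul_def]
    · obtain ⟨x, y, rfl⟩ := hz
      obtain ⟨x', y', rfl⟩ := hz'
      exact ⟨x + x', y + y', by rw [map_add, map_add, add_mul]; abel⟩

lemma hasType_quatCliff {m n : ℕ} {ε : ZMod 2} (L : CliffLine m n ε) :
    HasType (complexify (quatCliff m n)) 1 ε 1 := by
  obtain ⟨f, e, hf, hp, he, hc, hs⟩ := exists_quatCliff_generators L
  have key := hasType_adjoin f (fun x => by rw [parity_quat, hf]) L e hp he
    (fun x => by rw [parity_quat, hc]) hs hasType_quat
  simpa using key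

/-- The signs of the invariants in the table. -/
def typeTable : Fin 8 → ZMod 2 × ZMod 2 × ZMod 2 :=
  ![(0, 0, 0), (0, 0, 1), (0, 1, 0), (1, 1, 1), (1, 0, 0), (1, 0, 1), (1, 1, 0), (0, 1, 1)]

lemma hasType_superDiv (n : Fin 8) : HasType (complexify (superDiv n)) (typeTable n).1
    (typeTable n).2.1 (typeTable n).2.2 := by
  have h2 : (1 + 1 : ZMod 2) = 0 := by decide
  fin_cases n
  · exact hasType_real
  · exact CliffLine.pos.hasType
  · have h := hasType_cliff_pos_succ 1 CliffLine.pos.hasType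
    simp only [h2, mul_zero, zero_add, add_zero] at h
    exact h
  · exact hasType_quatCliff CliffLine.neg
  · exact hasType_quat
  · exact hasType_quatCliff CliffLine.pos
  · have h := hasType_cliff_neg_succ 1 CliffLine.neg.hasType
    simp only [h2, mul_one, zero_add, add_zero] at h
    exact h
  · exact CliffLine.neg.hasType

lemma hasType_cliff_zero : HasType (complexify (cliff 0 0)) 0 0 0 := by
  let f : realAlg.carrier →ₐ[ℝ] (cliff 0 0).carrier := Algebra.ofId ℝ _
  have hf : ∀ r : ℝ, f r = algebraMap ℝ (cliff 0 0).carrier r := fun _ => rfl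
  refine hasType_real.of_surjective (complexifyHom f) (complexifyHom_act f fun x => ?_) fun z => ?_
  · obtain ⟨r, rfl⟩ := realAlg_exists x
    rw [parity_smul, map_one, map_smul, map_one, parity_smul, map_one]
  · induction z using complexify_induction with
    | hadd x y hx hy =>
      obtain ⟨x, rfl⟩ := hx
      obtain ⟨y, rfl⟩ := hy
      exact ⟨x + y, map_add _ _ _⟩
    | h c x =>
      have hx : ∃ r : ℝ, x = algebraMap ℝ (cliff 0 0).carrier r := by
        induction x using cliff_induction with
        | algebraMap r => exact ⟨r, rfl⟩
        | ι v =>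
          obtain rfl : v = 0 := Subsingleton.elim _ _
          exact ⟨0, by rw [map_zero]; exact map_zero _⟩
        | mul x y hx hy =>
          obtain ⟨r, rfl⟩ := hx
          obtain ⟨s, rfl⟩ := hy
          exact ⟨r * s, (map_mul _ _ _).symm⟩
        | add x y hx hy =>
          obtain ⟨r, rfl⟩ := hx
          obtain ⟨s, rfl⟩ := hy
          exact ⟨r + s, (map_add _ _ _).symm⟩
      obtain ⟨r, rfl⟩ := hx
      exact ⟨cTmul realAlg c (r : ℝ), complexifyHom_cTmul _ _ _⟩

/-- The types of the Clifford algebras. -/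
lemma hasType_cliff (n : ℕ) : HasType (complexify (cliff n 0)) (typeTable (Fin.ofNat 8 n)).1
    (typeTable (Fin.ofNat 8 n)).2.1 (typeTable (Fin.ofNat 8 n)).2.2 := by
  induction n with
  | zero => exact hasType_cliff_zero
  | succ n ih =>
    have h : Fin.ofNat 8 (n + 1) = Fin.ofNat 8 n + 1 := by
      ext; simp [Fin.ofNat, Fin.val_add]
    -- Adjoining a positive generator moves one step down the table, cyclically with period eight.
    have key : ∀ k : Fin 8, (typeTable k).1 + (1 + (typeTable k).2.2) *
        ((typeTable k).2.1 * (typeTable k).2.1) = (typeTable (k + 1)).1 ∧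
        (typeTable k).2.1 + (typeTable k).2.2 = (typeTable (k + 1)).2.1 ∧
        (typeTable k).2.2 + 1 = (typeTable (k + 1)).2.2 := by decide
    have := hasType_cliff_pos_succ n ih
    rw [(key _).1, (key _).2.1, (key _).2.2] at this
    rwa [h]

end RealSuperAlgebra

/-! ### Complexified central super-division algebras are typed -/

/-- An irreducible representation of a finite-dimensional algebra. -/
lemma exists_irreducible (R : Type) [Ring R] [Nontrivial R] [Algebra ℂ R] [FiniteDimensional ℂ R] :
    ∃ (U : Type) (_ : AddCommGroup U) (_ : Module ℂ U) (_ : FiniteDimensional ℂ U)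
      (_ : Nontrivial U) (φ : R →ₐ[ℂ] Module.End ℂ U), Function.Surjective φ := by
  classical
  obtain ⟨I, hI⟩ := Ideal.exists_maximal R
  have hs : IsSimpleModule R (R ⧸ I) := isSimpleModule_iff_isCoatom.mpr hI.out
  have hf : FiniteDimensional ℂ (R ⧸ I) :=
    Module.Finite.of_surjective (I.mkQ.restrictScalars ℂ) I.mkQ_surjective
  have hn : Nontrivial (R ⧸ I) := IsSimpleModule.nontrivial R _
  refine ⟨R ⧸ I, inferInstance, inferInstance, hf, hn, Algebra.lsmul ℂ ℂ (R ⧸ I), fun M => ?_⟩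
  -- Schur's lemma: subtracting an eigenvalue from an endomorphism of the simple module leaves a
  -- noninjective one, which is zero.
  have hend : ∀ f : Module.End R (R ⧸ I), ∃ c : ℂ, ∀ u, f u = c • u := by
    intro f
    obtain ⟨c, hc⟩ := Module.End.exists_eigenvalue (f.restrictScalars ℂ : Module.End ℂ (R ⧸ I))
    obtain ⟨u, hu, hu0⟩ := hc.exists_hasEigenvector
    rw [Module.End.mem_eigenspace_iff] at hu
    let f' : Module.End R (R ⧸ I) := f - algebraMap ℂ _ c
    have hf' : ∀ u, f' u = f u - c • u := fun u => rfl
    refine ⟨c, fun v => ?_⟩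
    rcases f'.bijective_or_eq_zero with h | h
    · exact (hu0 (h.1 (by rw [hf', map_zero, sub_eq_zero]; exact hu))).elim
    · rw [← sub_eq_zero, ← hf', h]; rfl
  let M' : Module.End (Module.End R (R ⧸ I)) (R ⧸ I) :=
    { toFun := M
      map_add' := map_add M
      map_smul' := fun f u => by
        obtain ⟨c, hc⟩ := hend f
        change M (f u) = f (M u)
        rw [hc, hc, map_smul] }
  let β := Module.finBasis ℂ (R ⧸ I)
  -- Endomorphisms of the simple module are scalars, so every complex linear `M` commutes with them;
  -- density on a basis shows that it comes from the algebra.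
  obtain ⟨r, hr⟩ := jacobson_density M' (Finset.univ.image β)
  refine ⟨r, β.ext fun i => ?_⟩
  exact (hr (β i) (Finset.mem_image_of_mem _ (Finset.mem_univ i))).symm

lemma exists_conjugation (U : Type) [AddCommGroup U] [Module ℂ U] [FiniteDimensional ℂ U] :
    ∃ K : U →ₛₗ[starRingEnd ℂ] U, ∀ u, K (K u) = u := by
  let β := Module.finBasis ℂ U
  refine ⟨{
    toFun := fun u => ∑ i, starRingEnd ℂ (β.repr u i) • β i
    map_add' := fun u v => by simp [add_smul, Finset.sum_add_distrib]
    map_smul' := fun c u => by simp [Finset.smul_sum, mul_smul] }, fun u => ?_⟩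
  simp [Finsupp.single_apply, β.sum_repr u]

/-- Graded simplicity: every nonzero ideal that is stable under fermion parity is the whole
algebra. -/
def GradedSimple (A : EqAlg) : Prop :=
  ∀ I : TwoSidedIdeal A.carrier, (∀ x ∈ I, A.act p x ∈ I) → (∃ x ∈ I, x ≠ 0) → (1 : A.carrier) ∈ I

section

variable {A : EqAlg} {U : Type} [AddCommGroup U] [Module ℂ U] (φ : A.carrier →ₐ[ℂ] Module.End ℂ U)

/-- The representation `x ↦ K (φ (g x)) K`. -/
def conjRep (K : U →ₛₗ[starRingEnd ℂ] U) (hK : ∀ u, K (K u) = u) (b : ZMod 2) :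
    A.carrier →ₐ[ℂ] Module.End ℂ U :=
  AlgHom.ofLinearMap
    { toFun := fun x => (K.comp ((φ (A.act (tb b) x)).comp K) : U →ₗ[ℂ] U)
      map_add' := fun x y => LinearMap.ext fun u => by simp
      map_smul' := fun c x => LinearMap.ext fun u => by simp [A.act_tb_smul] }
    (LinearMap.ext fun u => by simp [hK])
    (fun x y => LinearMap.ext fun u => by simp [hK])

lemma conjRep_apply (K : U →ₛₗ[starRingEnd ℂ] U) (hK : ∀ u, K (K u) = u) (b : ZMod 2)
    (x : A.carrier) (u : U) : conjRep φ K hK b x u = K (φ (A.act (tb b) x) (K u)) := rfl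

lemma conjRep_surjective (hφ : Function.Surjective φ) (K : U →ₛₗ[starRingEnd ℂ] U)
    (hK : ∀ u, K (K u) = u) (b : ZMod 2) : Function.Surjective (conjRep φ K hK b) := by
  intro M
  obtain ⟨x, hx⟩ := hφ (K.comp (M.comp K))
  refine ⟨A.act (tb b) x, LinearMap.ext fun u => ?_⟩
  rw [conjRep_apply, A.act_tb_tb, hx]
  simp [hK]

lemma conjRep_eq_zero (K : U →ₛₗ[starRingEnd ℂ] U) (hK : ∀ u, K (K u) = u) (b : ZMod 2)
    (x : A.carrier) : conjRep φ K hK b x = 0 ↔ φ (A.act (tb b) x) = 0 := by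
  constructor
  · intro h
    refine LinearMap.ext fun u => ?_
    have := congrArg K (LinearMap.congr_fun h (K u))
    simpa [conjRep_apply, hK] using this
  · intro h
    refine LinearMap.ext fun u => ?_
    simp [conjRep_apply, h]

/-- The Skolem–Noether theorem for antilinear automorphisms. -/
lemma exists_antilinear [FiniteDimensional ℂ U] (hφ : Function.Surjective φ) (b : ZMod 2)
    (h : ∀ x, φ x = 0 ↔ φ (A.act (tb b) x) = 0) : ∃ T : U →ₛₗ[starRingEnd ℂ] U,
      Function.Injective T ∧ ∀ x u, T (φ x u) = φ (A.act (tb b) x) (T u) := by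
  obtain ⟨K, hK⟩ := exists_conjugation U
  obtain ⟨S, hS⟩ := exists_intertwiner φ (conjRep φ K hK b) hφ (conjRep_surjective φ hφ K hK b)
    (fun x => by rw [conjRep_eq_zero, h])
  refine ⟨K.comp S.toLinearMap, ?_, fun x u => ?_⟩
  · have hKi : Function.Injective K := Function.LeftInverse.injective hK
    exact hKi.comp S.injective
  · simp [hS, conjRep_apply, hK]

end

/-- Finite-dimensional graded simple algebras are typed. -/
lemma GradedSimple.exists_hasType {A : EqAlg} (h : GradedSimple A) [Nontrivial A.carrier]
    [FiniteDimensional ℂ A.carrier] : ∃ a b c, HasType A a b c := by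
  obtain ⟨U, _, _, _, _, φ, hφ⟩ := exists_irreducible A.carrier
  -- The intersection of the kernels of `φ` and `φ ∘ p` is stable under parity and does not contain
  -- `1`, so it vanishes.
  have hinj : ∀ x, φ x = 0 → φ (A.act p x) = 0 → x = 0 := by
    intro x hx hx'
    by_contra hne
    have h1 := h (TwoSidedIdeal.ker φ ⊓ TwoSidedIdeal.ker (φ.comp A.parity)) (fun y hy => ?_)
      ⟨x, ⟨?_, ?_⟩, hne⟩
    · have := (TwoSidedIdeal.mem_ker _).mp h1.1
      rw [map_one] at this
      exact one_ne_zero this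
    · have h1 := (TwoSidedIdeal.mem_ker _).mp hy.1
      have h2 := (TwoSidedIdeal.mem_ker _).mp hy.2
      refine ⟨(TwoSidedIdeal.mem_ker _).mpr h2, (TwoSidedIdeal.mem_ker _).mpr ?_⟩
      simpa [A.act_p_act_p] using h1
    · exact (TwoSidedIdeal.mem_ker _).mpr hx
    · exact (TwoSidedIdeal.mem_ker _).mpr hx'
  -- A faithful `φ` identifies the algebra with `End U`, the even case. Otherwise the two kernels
  -- are distinct factors, the odd case.
  by_cases hker : ∀ x, φ x = 0 → x = 0
  · have hb : Function.Bijective φ := ⟨(injective_iff_map_eq_zero φ).mpr hker, hφ⟩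
    have hz : ∀ (g : G) (x : A.carrier), φ x = 0 ↔ φ (A.act g x) = 0 := by
      intro g x
      constructor
      · intro hx
        rw [hker x hx, map_zero, map_zero]
      · intro hx
        have := congrArg (A.act g⁻¹) (hker _ hx)
        rw [← A.act_mul_apply, inv_mul_cancel, A.act_one_apply, map_zero] at this
        rw [this, map_zero]
    obtain ⟨P, hP⟩ := exists_intertwiner φ (φ.comp A.parity) hφ (fun M => by
      obtain ⟨x, rfl⟩ := hφ M
      exact ⟨A.act p x, by simp [A.act_p_act_p]⟩) (fun x => hz p x)
    obtain ⟨T, hT, hTφ⟩ := exists_antilinear φ hφ 0 (hz _)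
    obtain ⟨a, b, hm⟩ := EvenModel.exists_of_operators A φ hb P.toLinearMap T P.injective hT
      (fun x u => hP x u) hTφ
    exact ⟨a, b, 0, hasType_zero.mpr hm⟩
  · push Not at hker
    obtain ⟨x₀, hx₀, hne⟩ := hker
    -- The sum of the two kernels is a nonzero ideal stable under parity, so it contains `1`.
    -- Splitting `1` gives the idempotent `(1, 0)`, as in the Chinese remainder theorem.
    obtain ⟨y, hy, hy'⟩ : ∃ y, φ y = 1 ∧ φ (A.act p y) = 0 := by
      have h1 := h (TwoSidedIdeal.ker φ ⊔ TwoSidedIdeal.ker (φ.comp A.parity)) (fun z hz => ?_)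
        ⟨x₀, TwoSidedIdeal.mem_sup_left ((TwoSidedIdeal.mem_ker _).mpr hx₀), hne⟩
      · obtain ⟨x, hx, y, hy, hxy⟩ := TwoSidedIdeal.mem_sup.mp h1
        refine ⟨y, ?_, (TwoSidedIdeal.mem_ker (φ.comp A.parity)).mp hy⟩
        rw [← map_one φ, ← hxy, map_add, (TwoSidedIdeal.mem_ker _).mp hx, zero_add]
      · obtain ⟨x, hx, y, hy, rfl⟩ := TwoSidedIdeal.mem_sup.mp hz
        rw [map_add, add_comm]
        refine TwoSidedIdeal.mem_sup.mpr ⟨_, ?_, _, ?_, rfl⟩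
        · exact (TwoSidedIdeal.mem_ker _).mpr ((TwoSidedIdeal.mem_ker (φ.comp A.parity)).mp hy)
        · refine (TwoSidedIdeal.mem_ker _).mpr ?_
          simpa [A.act_p_act_p] using (TwoSidedIdeal.mem_ker _).mp hx
    have hext : ∀ x x', φ x = φ x' → φ (A.act p x) = φ (A.act p x') → x = x' := by
      intro x x' h1 h2
      rw [← sub_eq_zero]
      exact hinj _ (by rw [map_sub, h1, sub_self]) (by rw [map_sub, map_sub, h2, sub_self])
    have hpy : A.act p y = 1 - y := hext _ _ (by simp [hy, hy']) (by simp [hy, hy', A.act_p_act_p])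
    have hyy : y * y = y := hext _ _ (by simp [hy]) (by simp [hy'])
    have hcomm : ∀ x, y * x = x * y := fun x => hext _ _ (by simp [hy]) (by simp [hy'])
    have hzero : ∀ x, φ x = 0 → x * y = 0 := fun x hx => hinj _ (by simp [hx]) (by simp [hy'])
    have hb : Function.Bijective (fun x => (φ x, φ (A.act p x))) := by
      refine ⟨fun x x' hxx => hext x x' (congrArg Prod.fst hxx) (congrArg Prod.snd hxx),
        fun ⟨M, N⟩ => ?_⟩
      obtain ⟨m, rfl⟩ := hφ M
      obtain ⟨n, rfl⟩ := hφ N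
      exact ⟨m * y + A.act p n * A.act p y, by simp [hy, hy', A.act_p_act_p]⟩
    -- The image of the central idempotent `y` under `t` acts by a scalar idempotent. If this is
    -- `1`, then `t` preserves the factors; if it is `0`, then `pt` does.
    obtain ⟨b, hb1⟩ : ∃ b, φ (A.act (tb b) y) = 1 := by
      obtain ⟨c, hc⟩ := exists_scalar_of_commute_surjective hφ (φ (A.act (tb 0) y)) (fun x u => by
        rw [← Module.End.mul_apply, ← map_mul, ← Module.End.mul_apply, ← map_mul]
        have := hcomm (A.act (tb 0) x)
        have := congrArg (A.act (tb 0)) this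
        rw [map_mul, map_mul, A.act_tb_tb] at this
        rw [this])
      have hcc : c * c = c := smul_right_cancel_of_nontrivial (U := U) fun u => by
        rw [mul_smul, ← hc, ← hc, ← Module.End.mul_apply, ← map_mul, ← map_mul, hyy]
      rcases IsIdempotentElem.iff_eq_zero_or_one.mp hcc with rfl | rfl
      · refine ⟨1, ?_⟩
        have h1 : A.act (tb 1) y = 1 - A.act (tb 0) y := by
          have := A.act_tb_p 0 y
          rw [zero_add] at this
          rw [← this, hpy, map_sub, map_one]
        rw [h1, map_sub, map_one, sub_eq_self]
        exact LinearMap.ext fun u => by rw [hc, zero_smul]; rfl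
      · exact ⟨0, LinearMap.ext fun u => by rw [hc, one_smul]; rfl⟩
    have hstep : ∀ x, φ x = 0 → φ (A.act (tb b) x) = 0 := by
      intro x hx
      have := congrArg (fun z => φ (A.act (tb b) z)) (hzero x hx)
      simpa [hb1] using this
    obtain ⟨T, hT, hTφ⟩ := exists_antilinear φ hφ b
      (fun x => ⟨hstep x, fun hx => by simpa [A.act_tb_tb] using hstep _ hx⟩)
    obtain ⟨a, hm⟩ := OddModel.exists_of_operators A φ hb b T hT hTφ
    exact ⟨a, b, 1, hasType_one.mpr hm⟩

namespace RealSuperAlgebra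

variable {D D' : RealSuperAlgebra}

lemma parity_sgn_smul (ε : ZMod 2) (x : D.carrier) :
    parity D (sgn ε • x) = sgn ε • parity D x := map_zsmul _ _ _

lemma IsCentralSuperDivision.isUnit' (h : D.IsCentralSuperDivision) {a : D.carrier} {ε : ZMod 2}
    (ha : a ≠ 0) (hε : parity D a = sgn ε • a) : IsUnit a := by
  refine h.isUnit a ha ?_
  rcases zmod_two_cases ε with rfl | rfl
  · exact Or.inl (by simpa using hε)
  · exact Or.inr (by simpa using hε)

lemma parity_homogeneousPart (ε : ZMod 2) (x : D.carrier) :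
    parity D (x + sgn ε • parity D x) = sgn ε • (x + sgn ε • parity D x) := by
  rw [map_add, parity_sgn_smul, parity_parity, smul_add, sgn_smul_smul, add_comm]

lemma smul_eq_zero_of_two {V : Type} [AddCommGroup V] [Module ℝ V] {x : V} (h : x + x = 0) :
    x = 0 := by
  rw [← two_smul ℝ x] at h
  exact (smul_eq_zero.mp h).resolve_left two_ne_zero

lemma complexify_exists (x : (complexify D).carrier) :
    ∃ d d', x = cTmul D 1 d + cTmul D Complex.I d' := by
  induction x using complexify_induction with
  | hadd x y hx hy =>
    obtain ⟨a, b, rfl⟩ := hx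
    obtain ⟨a', b', rfl⟩ := hy
    exact ⟨a + a', b + b', by rw [cTmul_add, cTmul_add]; abel⟩
  | h c x =>
    refine ⟨c.re • x, c.im • x, ?_⟩
    rw [cTmul_smul, cTmul_smul, ← add_cTmul, mul_one, Complex.re_add_im]

/-- A homogeneous nonzero element of the ideal, divided by its real part, becomes `1 + i e` with `e`
even. If `e` is central it is a real number, and `1 + i e` is an invertible complex number. If not,
the commutator with a suitable homogeneous `a` removes the `1` and leaves `i` times a nonzero
homogeneous element, a unit. -/
lemma IsCentralSuperDivision.gradedSimple (h : D.IsCentralSuperDivision) :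
    GradedSimple (complexify D) := by
  intro J hJ ⟨x, hx, hx0⟩
  have unit_mem : ∀ (c : ℂ) (d : D.carrier), c ≠ 0 → IsUnit d → cTmul D c d ∈ J →
      (1 : (complexify D).carrier) ∈ J := by
    intro c d hc hd hm
    obtain ⟨u, rfl⟩ := hd
    have := J.mul_mem_left (cTmul D c⁻¹ ↑u⁻¹) _ hm
    rwa [cTmul_mul_cTmul, inv_mul_cancel₀ hc, Units.inv_mul, cTmul_one_one] at this
  -- The elements `x + p x` and `x - p x` of the ideal add up to `2x`, so one of them is nonzero.
  obtain ⟨ε, hy, hy0⟩ : ∃ ε : ZMod 2, x + sgn ε • (complexify D).act p x ∈ J ∧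
      x + sgn ε • (complexify D).act p x ≠ 0 := by
    have hm : ∀ ε : ZMod 2, x + sgn ε • (complexify D).act p x ∈ J := fun ε =>
      J.add_mem hx (J.zsmul_mem _ (hJ x hx))
    by_contra! hne
    have h0 := hne 0 (hm 0)
    have h1 := hne 1 (hm 1)
    have h2 : (2 : ℂ) • x = 0 := by
      rw [two_smul]
      have := congrArg₂ (· + ·) h0 h1
      simp only [sgn_zero, sgn_one, one_smul, neg_smul, add_zero] at this
      rw [← this]; abel
    exact hx0 ((smul_eq_zero.mp h2).resolve_left two_ne_zero)
  obtain ⟨d₀, d₁, rfl⟩ := complexify_exists x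
  have e1 : ∀ (n : ℤ) (c : ℂ) (d : D.carrier), n • cTmul D c d = cTmul D c (n • d) :=
    fun n c d => (TensorProduct.tmul_smul n c d).symm
  rw [map_add, act_p_cTmul, act_p_cTmul, smul_add, add_add_add_comm, e1, e1, ← cTmul_add,
    ← cTmul_add] at hy hy0
  have hd := parity_homogeneousPart ε d₀
  have hd' := parity_homogeneousPart ε d₁
  revert hy hy0 hd hd'
  generalize d₀ + sgn ε • parity D d₀ = d
  generalize d₁ + sgn ε • parity D d₁ = d'
  intro hy hy0 hd hd'
  by_cases hd0 : d = 0
  · subst hd0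
    rw [cTmul_zero, zero_add] at hy hy0
    have hd'0 : d' ≠ 0 := by
      rintro rfl
      exact hy0 (cTmul_zero _)
    exact unit_mem _ _ Complex.I_ne_zero (h.isUnit' hd'0 hd') hy
  · obtain ⟨u, rfl⟩ := h.isUnit' hd0 hd
    have hm := J.mul_mem_left (cTmul D 1 ↑u⁻¹) _ hy
    rw [mul_add, cTmul_mul_cTmul, cTmul_mul_cTmul, mul_one, one_mul, Units.inv_mul] at hm
    have hu : parity D ↑u⁻¹ = sgn ε • (↑u⁻¹ : D.carrier) := by
      have h1 : parity D ↑u⁻¹ * parity D ↑u = 1 := by rw [← map_mul, Units.inv_mul, map_one]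
      rw [hd, mul_smul_comm] at h1
      have h2 := congrArg (fun z : D.carrier => sgn ε • (z * (↑u⁻¹ : D.carrier))) h1
      simpa only [smul_mul_assoc, sgn_smul_smul, Units.mul_inv_cancel_right, one_mul] using h2
    have he : parity D (↑u⁻¹ * d') = ↑u⁻¹ * d' := by
      rw [map_mul, hu, hd', smul_mul_assoc, mul_smul_comm, sgn_smul_smul]
    revert hm he
    generalize (↑u⁻¹ * d' : D.carrier) = e
    intro hm he
    by_cases hce : ∀ a, e * a = a * e
    · obtain ⟨r, rfl⟩ := h.center_even e he hce
      rw [Algebra.algebraMap_eq_smul_one, cTmul_smul, ← add_cTmul] at hm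
      refine unit_mem _ _ ?_ isUnit_one hm
      intro h0
      have := congrArg Complex.re h0
      simp at this
    · obtain ⟨a, ha⟩ := not_forall.mp hce
      obtain ⟨δ, hδ⟩ : ∃ δ : ZMod 2,
          e * (a + sgn δ • parity D a) - (a + sgn δ • parity D a) * e ≠ 0 := by
        by_contra! hne
        refine ha (sub_eq_zero.mp (smul_eq_zero_of_two ?_))
        have h1 := congrArg₂ (· + ·) (hne 0) (hne 1)
        simp only [sgn_zero, sgn_one, one_smul, neg_smul, add_zero] at h1
        rw [← h1]
        noncomm_ring
      have hap := parity_homogeneousPart δ a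
      revert hδ hap
      generalize a + sgn δ • parity D a = a'
      intro hδ hap
      have hw : parity D (e * a' - a' * e) = sgn δ • (e * a' - a' * e) := by
        rw [map_sub, map_mul, map_mul, he, hap, mul_smul_comm, smul_mul_assoc, smul_sub]
      refine unit_mem Complex.I _ Complex.I_ne_zero (h.isUnit' hδ hw) ?_
      have hc := J.sub_mem (J.mul_mem_right _ (cTmul D 1 a') hm) (J.mul_mem_left (cTmul D 1 a') _ hm)
      rw [add_mul, mul_add, cTmul_mul_cTmul, cTmul_mul_cTmul, cTmul_mul_cTmul, cTmul_mul_cTmul,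
        one_mul, mul_one, mul_one, one_mul, one_mul, add_sub_add_left_eq_sub,
        ← cTmul_sub] at hc
      exact hc

lemma IsCentralSuperDivision.exists_hasType (h : D.IsCentralSuperDivision) :
    ∃ a b c, HasType (complexify D) a b c := by
  have := h.nontrivial
  have := h.finiteDimensional
  have : FiniteDimensional ℂ (complexify D).carrier :=
    inferInstanceAs (FiniteDimensional ℂ (ℂ ⊗[ℝ] D.carrier))
  exact h.gradedSimple.exists_hasType

/-! ### Morita equivalent super-division algebras are isomorphic -/

/-- The pairing cannot vanish on all homogeneous pairs, since it generates `D`. A nonzero value on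
such a pair is homogeneous, hence a unit, and dividing by it also makes the two degrees agree, as
`1` is even. -/
lemma exists_homogeneous_pair (hD : D.IsCentralSuperDivision) (c : MoritaContext D D') :
    ∃ (m : c.M.carrier) (n : c.N.carrier) (ε : ZMod 2), c.pair m n = 1 ∧
      c.M.act (Multiplicative.ofAdd 1) m = sgn ε • m ∧
      c.N.act (Multiplicative.ofAdd 1) n = sgn ε • n := by
  have := hD.nontrivial
  set P := c.M.act (Multiplicative.ofAdd 1) with hP
  set P' := c.N.act (Multiplicative.ofAdd 1) with hP'
  have hg : (Multiplicative.ofAdd 1 : Multiplicative (ZMod 2)) * Multiplicative.ofAdd 1 = 1 := by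
    decide
  have hPP : ∀ m, P (P m) = m := DFunLike.congr_fun (show P * P = 1 by
    rw [hP, ← map_mul, hg, map_one])
  have hPP' : ∀ n, P' (P' n) = n := DFunLike.congr_fun (show P' * P' = 1 by
    rw [hP', ← map_mul, hg, map_one])
  have hh : ∀ (ε : ZMod 2) m, P (m + sgn ε • P m) = sgn ε • (m + sgn ε • P m) := fun ε m => by
    rw [map_add, map_zsmul, hPP, smul_add, sgn_smul_smul, add_comm]
  have hh' : ∀ (ε : ZMod 2) m, P' (m + sgn ε • P' m) = sgn ε • (m + sgn ε • P' m) := fun ε m => by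
    rw [map_add, map_zsmul, hPP', smul_add, sgn_smul_smul, add_comm]
  have hpar : ∀ m n, parity D (c.pair m n) = c.pair (P m) (P' n) := fun m n => c.pair_act _ m n
  obtain ⟨m, n, ε, δ, hne, hm, hn⟩ : ∃ m n, ∃ ε δ : ZMod 2, c.pair m n ≠ 0 ∧ P m = sgn ε • m ∧
      P' n = sgn δ • n := by
    by_contra! hne
    have h0 : ∀ m n, c.pair m n = 0 := by
      intro m n
      have key : ∀ ε δ : ZMod 2, c.pair (m + sgn ε • P m) (n + sgn δ • P' n) = 0 := by
        intro ε δ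
        by_contra h
        exact hne _ _ ε δ h (hh ε m) (hh' δ n)
      have em : m + m = (m + sgn 0 • P m) + (m + sgn 1 • P m) := by simp; abel
      have en : n + n = (n + sgn 0 • P' n) + (n + sgn 1 • P' n) := by simp; abel
      have h1 : c.pair (m + m) (n + n) = 0 := by
        rw [em, en, map_add c.pair, AddMonoidHom.add_apply, map_add (c.pair (m + sgn 0 • P m)),
          map_add (c.pair (m + sgn 1 • P m)), key, key, key, key]
        simp
      rw [map_add c.pair, AddMonoidHom.add_apply, map_add] at h1
      exact smul_eq_zero_of_two (smul_eq_zero_of_two h1)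
    have h1 : (⊤ : AddSubgroup D.carrier) ≤ ⊥ := by
      rw [← c.pair_surjective, AddSubgroup.closure_le]
      rintro _ ⟨m, n, rfl⟩
      exact h0 m n
    exact one_ne_zero (α := D.carrier) (h1 (AddSubgroup.mem_top 1))
  have hu : parity D (c.pair m n) = sgn (ε + δ) • c.pair m n := by
    rw [hpar, hm, hn, map_zsmul, map_zsmul, AddMonoidHom.smul_apply, smul_smul, sgn_add, mul_comm]
  obtain ⟨u, hu'⟩ := hD.isUnit' hne hu
  have hone : c.pair ((↑u⁻¹ : D.carrier) • m) n = 1 := by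
    rw [c.pair_smul, ← hu', Units.inv_mul]
  have hui : parity D ↑u⁻¹ = sgn (ε + δ) • (↑u⁻¹ : D.carrier) := by
    have h1 : parity D ↑u⁻¹ * parity D ↑u = 1 := by rw [← map_mul, Units.inv_mul, map_one]
    rw [hu', hu, ← hu', mul_smul_comm] at h1
    have h2 := congrArg (fun z : D.carrier => sgn (ε + δ) • (z * (↑u⁻¹ : D.carrier))) h1
    simpa only [smul_mul_assoc, sgn_smul_smul, Units.mul_inv_cancel_right, one_mul] using h2
  refine ⟨(↑u⁻¹ : D.carrier) • m, n, δ, hone, ?_, hn⟩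
  refine (c.M.act_smul _ _ _).trans ?_
  change parity D _ • P m = _
  rw [hui, hm, smul_assoc, smul_comm (↑u⁻¹ : D.carrier), smul_smul, ← sgn_add, add_assoc,
    add_comm δ, ← add_assoc, CharTwo.add_self_eq_zero, zero_add]

/-- For a homogeneous pair with `⟨m, n⟩ = 1`, the element `⟨n, m⟩` is a nonzero even idempotent, and
invertibility makes it `1`. Then `d ↦ ⟨n, d m⟩` is an isomorphism with inverse `d' ↦ ⟨m, d' n⟩`; the
degrees of `m` and `n` agree, so it respects parity. -/
lemma IsCentralSuperDivision.iso_of_moritaEquivalent (hD : D.IsCentralSuperDivision)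
    (hD' : D'.IsCentralSuperDivision) (h : MoritaEquivalent D D') : Nonempty (D.Iso D') := by
  obtain ⟨c⟩ := h
  obtain ⟨m, n, ε, hmn, hm, hn⟩ := exists_homogeneous_pair hD c
  have := hD.nontrivial
  have hidem : c.copair n m * c.copair n m = c.copair n m := by
    rw [← c.copair_op_smul, ← c.assoc, hmn, one_smul]
  have hne : c.copair n m ≠ 0 := by
    intro h0
    have h1 : c.pair (c.pair m n • m) n = 1 := by rw [hmn, one_smul, hmn]
    rw [c.assoc, h0, MulOpposite.op_zero, zero_smul, map_zero] at h1
    exact zero_ne_one h1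
  have hpar : ∀ d, parity D' (c.copair n (d • m)) = c.copair n (parity D d • m) := by
    intro d
    refine (c.copair_act _ _ _).trans ?_
    rw [c.M.act_smul, hm, hn, map_zsmul, AddMonoidHom.smul_apply, smul_comm, map_zsmul,
      sgn_smul_smul]
    rfl
  have hone : c.copair n m = 1 := by
    have hp : parity D' (c.copair n m) = sgn 0 • c.copair n m := by
      have := hpar 1
      rw [one_smul, map_one, one_smul] at this
      rw [this, sgn_zero, one_smul]
    exact (hD'.isUnit' hne hp).mul_left_cancel (hidem.trans (mul_one _).symm)
  have hmul : ∀ d d' : D.carrier, c.copair n ((d * d') • m) = c.copair n (d • m) * c.copair n (d' • m) := by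
    intro d d'
    rw [← c.copair_op_smul, ← smul_comm d, ← c.assoc, hmn, one_smul, mul_smul]
  let θ : D.carrier →ₐ[ℝ] D'.carrier :=
    { toFun := fun d => c.copair n (d • m)
      map_one' := by rw [one_smul, hone]
      map_mul' := hmul
      map_zero' := by rw [zero_smul, map_zero]
      map_add' := fun d d' => by rw [add_smul, map_add]
      commutes' := fun r => by
        rw [c.M.scalar, c.copair_op_smul, hone, one_mul] }
  have hθ : ∀ d, θ d = c.copair n (d • m) := fun d => rfl
  have hb : Function.Bijective θ := by
    refine ⟨(injective_iff_map_eq_zero θ).mpr fun d hd => ?_, fun d' => ?_⟩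
    · have h1 : c.pair m (c.copair n (d • m) • n) = d := by
        rw [c.coassoc, c.pair_op_smul, c.pair_smul, hmn, one_mul, mul_one]
      rw [← h1, ← hθ, hd, zero_smul, map_zero]
    · refine ⟨c.pair m (d' • n), ?_⟩
      rw [hθ, c.assoc, c.copair_op_smul, hone, one_mul, c.copair_smul, hone, mul_one]
  refine ⟨⟨AlgEquiv.ofBijective θ hb, fun g d => ?_⟩⟩
  rcases act_cases g with rfl | rfl
  · rw [D.act_one_apply, D'.act_one_apply]
  · exact (hpar d).symm

end RealSuperAlgebra

/-! ### Descent of Morita contexts along complexification -/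

namespace RealSuperAlgebra

variable {D D' : RealSuperAlgebra}

/-- The inclusion of `D` in its complexification. -/
def incl (D : RealSuperAlgebra) : D.carrier →+* (complexify D).carrier :=
  (Algebra.TensorProduct.includeRight : D.carrier →ₐ[ℝ] ℂ ⊗[ℝ] D.carrier).toRingHom

lemma incl_eq (d : D.carrier) : incl D d = cTmul D 1 d := rfl

lemma incl_injective : Function.Injective (incl D) := cTmul_injective

lemma act_incl (g : G) (d : D.carrier) :
    (complexify D).act g (incl D d) = incl D (D.act g.1 d) := by
  rw [incl_eq, act_cTmul, map_one, incl_eq]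

/-- The real part. -/
def re (D : RealSuperAlgebra) : (complexify D).carrier →+ D.carrier :=
  (TensorProduct.lift ((LinearMap.lsmul ℝ D.carrier).comp Complex.reLm) :
    ℂ ⊗[ℝ] D.carrier →ₗ[ℝ] D.carrier).toAddMonoidHom

lemma re_cTmul (c : ℂ) (d : D.carrier) : re D (cTmul D c d) = c.re • d := by
  change (TensorProduct.lift ((LinearMap.lsmul ℝ D.carrier).comp Complex.reLm) :
    ℂ ⊗[ℝ] D.carrier →ₗ[ℝ] D.carrier) (c ⊗ₜ[ℝ] d) = _
  rw [TensorProduct.lift.tmul]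
  rfl

lemma re_incl (d : D.carrier) : re D (incl D d) = d := by
  rw [incl_eq, re_cTmul]; simp

lemma tb_zero_fst : (tb 0).1 = 1 := rfl

lemma incl_re {x : (complexify D).carrier} (h : (complexify D).act (tb 0) x = x) :
    incl D (re D x) = x := by
  obtain ⟨d, d', rfl⟩ := complexify_exists x
  rw [map_add, act_cTmul, act_cTmul, tb_zero_fst, D.act_one_apply, D.act_one_apply] at h
  simp only [xG_tb, conj_one, map_one, Complex.conj_I] at h
  have h1 : cTmul D Complex.I d' + cTmul D Complex.I d' = 0 := by
    have h2 := add_left_cancel h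
    nth_rewrite 1 [← h2]
    rw [← add_cTmul, neg_add_cancel]
    exact TensorProduct.zero_tmul _ _
  have h2 : cTmul D Complex.I d' = 0 := by
    rw [← two_smul ℂ] at h1
    exact (smul_eq_zero.mp h1).resolve_left two_ne_zero
  rw [h2, add_zero, ← incl_eq, re_incl]

/-- The imaginary unit. -/
def imag (D : RealSuperAlgebra) : (complexify D).carrier := cTmul D Complex.I 1

lemma act_imag : (complexify D).act (tb 0) (imag D) = -imag D := by
  rw [imag, act_cTmul, map_one]
  simp only [xG_tb, conj_one, Complex.conj_I]
  exact TensorProduct.neg_tmul _ _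

lemma re_imag_mul (d : D.carrier) : re D (imag D * incl D d) = 0 := by
  rw [imag, incl_eq, cTmul_mul_cTmul, re_cTmul]; simp

lemma re_imag_mul_imag (d : D.carrier) : re D (imag D * (imag D * incl D d)) = -d := by
  rw [imag, incl_eq, cTmul_mul_cTmul, cTmul_mul_cTmul, re_cTmul]; simp

lemma imag_mul_imag : imag D * imag D = -1 := by
  rw [imag, cTmul_mul_cTmul, Complex.I_mul_I, mul_one]
  exact TensorProduct.neg_tmul _ _

lemma imag_comm (x : (complexify D).carrier) : imag D * x = x * imag D := by
  have h : imag D = algebraMap ℂ (complexify D).carrier Complex.I := rfl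
  rw [h, Algebra.commutes]

end RealSuperAlgebra

open RealSuperAlgebra

/-! ### The real bimodule of time-reversal fixed points -/

namespace EquivariantBimodule

variable {D D' : RealSuperAlgebra} (M : EquivariantBimodule (complexify D) (complexify D'))

/-- The elements that are fixed by time reversal. -/
def fixed : AddSubgroup M.carrier where
  carrier := {m | M.act (tb 0) m = m}
  add_mem' := by
    intro m m' hm hm'
    simp only [Set.mem_ofPred_eq] at *
    rw [map_add, hm, hm']
  zero_mem' := by
    simp only [Set.mem_ofPred_eq]
    rw [map_zero]
  neg_mem' := by
    intro m hm
    simp only [Set.mem_ofPred_eq] at *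
    rw [map_neg, hm]

lemma mem_fixed {m : M.carrier} : m ∈ M.fixed ↔ M.act (tb 0) m = m := Iff.rfl

lemma act_act (g h : G) (m : M.carrier) : M.act g (M.act h m) = M.act (g * h) m := by
  rw [map_mul]; rfl

lemma smul_mem_fixed (d : D.carrier) {m : M.carrier} (hm : m ∈ M.fixed) :
    incl D d • m ∈ M.fixed := by
  rw [mem_fixed, M.act_smul, act_incl, (M.mem_fixed).mp hm, tb_zero_fst, D.act_one_apply]

lemma op_smul_mem_fixed (d : D'.carrier) {m : M.carrier} (hm : m ∈ M.fixed) :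
    MulOpposite.op (incl D' d) • m ∈ M.fixed := by
  rw [mem_fixed, M.act_op_smul, act_incl, (M.mem_fixed).mp hm, tb_zero_fst, D'.act_one_apply]

lemma act_mem_fixed (g : G) {m : M.carrier} (hm : m ∈ M.fixed) : M.act g m ∈ M.fixed := by
  rw [mem_fixed, act_act, mul_comm, ← act_act, (M.mem_fixed).mp hm]

instance : SMul D.carrier M.fixed := ⟨fun d m => ⟨incl D d • m.1, M.smul_mem_fixed d m.2⟩⟩

instance : SMul (D'.carrier)ᵐᵒᵖ M.fixed :=
  ⟨fun d m => ⟨MulOpposite.op (incl D' d.unop) • m.1, M.op_smul_mem_fixed _ m.2⟩⟩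

lemma coe_smul (d : D.carrier) (m : M.fixed) : ((d • m : M.fixed) : M.carrier) = incl D d • m.1 :=
  rfl

lemma coe_op_smul (d : (D'.carrier)ᵐᵒᵖ) (m : M.fixed) :
    ((d • m : M.fixed) : M.carrier) = MulOpposite.op (incl D' d.unop) • m.1 := rfl

instance : Module D.carrier M.fixed where
  one_smul m := Subtype.ext (by rw [coe_smul, map_one, one_smul])
  mul_smul d d' m := Subtype.ext (by rw [coe_smul, coe_smul, coe_smul, map_mul, mul_smul])
  smul_zero d := Subtype.ext (by rw [coe_smul]; exact smul_zero _)
  smul_add d m m' := Subtype.ext (by rw [coe_smul]; exact smul_add _ _ _)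
  add_smul d d' m := Subtype.ext (by rw [coe_smul, map_add]; exact add_smul _ _ _)
  zero_smul m := Subtype.ext (by rw [coe_smul, map_zero]; exact zero_smul _ _)

instance : Module (D'.carrier)ᵐᵒᵖ M.fixed where
  one_smul m := Subtype.ext (by
    rw [coe_op_smul, MulOpposite.unop_one, map_one, MulOpposite.op_one, one_smul])
  mul_smul d d' m := Subtype.ext (by
    rw [coe_op_smul, coe_op_smul, coe_op_smul, MulOpposite.unop_mul, map_mul, MulOpposite.op_mul,
      mul_smul])
  smul_zero d := Subtype.ext (by rw [coe_op_smul]; exact smul_zero _)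
  smul_add d m m' := Subtype.ext (by rw [coe_op_smul]; exact smul_add _ _ _)
  add_smul d d' m := Subtype.ext (by
    rw [coe_op_smul, MulOpposite.unop_add, map_add, MulOpposite.op_add]; exact add_smul _ _ _)
  zero_smul m := Subtype.ext (by
    rw [coe_op_smul, MulOpposite.unop_zero, map_zero, MulOpposite.op_zero]; exact zero_smul _ _)

instance : SMulCommClass D.carrier (D'.carrier)ᵐᵒᵖ M.fixed where
  smul_comm d d' m := Subtype.ext (by
    rw [coe_smul, coe_op_smul, coe_op_smul, coe_smul, smul_comm])

/-- The action of fermion parity on the fixed points. -/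
def fixedAct (g : Multiplicative (ZMod 2)) : AddMonoid.End M.fixed where
  toFun m := ⟨M.act (g, 1) m.1, M.act_mem_fixed _ m.2⟩
  map_zero' := Subtype.ext (map_zero _)
  map_add' _ _ := Subtype.ext (map_add _ _ _)

/-- The real bimodule of the elements that are fixed by time reversal. -/
def fixedBimodule : EquivariantBimodule D D' where
  carrier := M.fixed
  scalar c m := Subtype.ext (by
    have h := M.scalar (c : ℂ) m.1
    have h1 : ∀ E : RealSuperAlgebra, algebraMap ℂ (complexify E).carrier c =
        incl E (algebraMap ℝ E.carrier c) := by
      intro E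
      rw [incl_eq, Algebra.algebraMap_eq_smul_one, Algebra.algebraMap_eq_smul_one, cTmul_smul,
        mul_one, ← cTmul_one_one, smul_cTmul, mul_one]
    rw [h1, h1] at h
    exact h)
  act :=
    { toFun := M.fixedAct
      map_one' := AddMonoidHom.ext fun m => Subtype.ext
        (DFunLike.congr_fun (map_one M.act) m.1)
      map_mul' := fun g h => AddMonoidHom.ext fun m => Subtype.ext
        (M.act_act (g, 1) (h, 1) m.1).symm }
  act_smul g d m := Subtype.ext ((M.act_smul (g, 1) (incl D d) m.1).trans (by
    rw [act_incl]; rfl))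
  act_op_smul g d m := Subtype.ext ((M.act_op_smul (g, 1) (incl D' d) m.1).trans (by
    rw [act_incl]; rfl))

/-- Every element is a combination of fixed elements. -/
lemma exists_fixed (m : M.carrier) : ∃ m₀ m₁ : M.fixed, m = m₀.1 + imag D • m₁.1 := by
  have hi : M.act (tb 0) (imag D • m) = -(imag D • M.act (tb 0) m) := by
    rw [M.act_smul, act_imag, neg_smul]
  have h1 : M.act (tb 0) (M.act (tb 0) m) = m := by
    rw [act_act, tb_mul_tb, map_one]; rfl
  -- The bimodule carries no scalar action of its own, so the factor `1/2` in the real and imaginary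
  -- parts is taken from the algebra.
  have h2 : ∀ x : M.carrier, incl D ((2⁻¹ : ℝ) • 1) • (x + x) = x := by
    intro x
    rw [← two_smul (complexify D).carrier, smul_smul]
    have : incl D ((2⁻¹ : ℝ) • 1) * 2 = 1 := by
      rw [show (2 : (complexify D).carrier) = incl D 2 from (map_ofNat (incl D) 2).symm, ← map_mul,
        smul_one_mul, ← map_one (incl D)]
      congr 1
      rw [← one_add_one_eq_two (R := D.carrier), ← two_smul ℝ (1 : D.carrier), smul_smul]
      norm_num
    rw [this, one_smul]
  refine ⟨⟨incl D ((2⁻¹ : ℝ) • 1) • (m + M.act (tb 0) m), M.smul_mem_fixed _ ?_⟩,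
    ⟨incl D ((2⁻¹ : ℝ) • 1) • (-(imag D • m) + imag D • M.act (tb 0) m),
      M.smul_mem_fixed _ ?_⟩, ?_⟩
  · rw [mem_fixed, map_add, h1, add_comm]
  · rw [mem_fixed, map_add, map_neg, hi, M.act_smul, h1, act_imag, neg_neg, neg_smul, add_comm]
  · simp only
    rw [smul_smul, imag_comm, mul_smul, ← smul_add, smul_add (imag D), smul_neg, smul_smul,
      smul_smul, imag_mul_imag, neg_smul, neg_smul, one_smul, one_smul, neg_neg,
      add_add_add_comm, add_neg_cancel, add_zero, h2]

end EquivariantBimodule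

/-! ### Restriction of the pairings to fixed points -/

namespace MoritaContext

variable {D D' : RealSuperAlgebra} (c : MoritaContext (complexify D) (complexify D'))

lemma incl_re_pair (m : c.M.fixed) (n : c.N.fixed) :
    incl D (re D (c.pair m.1 n.1)) = c.pair m.1 n.1 :=
  incl_re (by rw [c.pair_act, (c.M.mem_fixed).mp m.2, (c.N.mem_fixed).mp n.2])

lemma incl_re_copair (n : c.N.fixed) (m : c.M.fixed) :
    incl D' (re D' (c.copair n.1 m.1)) = c.copair n.1 m.1 :=
  incl_re (by rw [c.copair_act, (c.M.mem_fixed).mp m.2, (c.N.mem_fixed).mp n.2])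

/-- The pairing of fixed elements. -/
def rePair : c.M.fixedBimodule.carrier →+ c.N.fixedBimodule.carrier →+ D.carrier :=
  ((AddMonoidHom.compHom (re D)).comp ((AddMonoidHom.compl₂ c.pair c.N.fixed.subtype))).comp
    c.M.fixed.subtype

lemma rePair_apply (m : c.M.fixed) (n : c.N.fixed) : c.rePair m n = re D (c.pair m.1 n.1) := rfl

/-- The pairing of fixed elements. -/
def reCopair : c.N.fixedBimodule.carrier →+ c.M.fixedBimodule.carrier →+ D'.carrier :=
  ((AddMonoidHom.compHom (re D')).comp ((AddMonoidHom.compl₂ c.copair c.M.fixed.subtype))).comp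
    c.N.fixed.subtype

lemma reCopair_apply (n : c.N.fixed) (m : c.M.fixed) :
    c.reCopair n m = re D' (c.copair n.1 m.1) := rfl

lemma incl_rePair (m : c.M.fixed) (n : c.N.fixed) : incl D (c.rePair m n) = c.pair m.1 n.1 := by
  rw [rePair_apply, incl_re_pair]

lemma incl_reCopair (n : c.N.fixed) (m : c.M.fixed) :
    incl D' (c.reCopair n m) = c.copair n.1 m.1 := by
  rw [reCopair_apply, incl_re_copair]

lemma imag_op_smul {A : RealSuperAlgebra} (M : EquivariantBimodule (complexify D) (complexify A))
    (m : M.carrier) : imag D • m = MulOpposite.op (imag A) • m := M.scalar Complex.I m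

/-- With `m = m₀ + i m₁` and `n = n₀ + i n₁` split into fixed elements, the real part of `⟨m, n⟩` is
`⟨m₀, n₀⟩ - ⟨m₁, n₁⟩`. Taking real parts of a sum of pairings that represents `d` therefore
represents `d` by pairings of fixed elements. -/
lemma rePair_surjective : AddSubgroup.closure {a | ∃ m n, c.rePair m n = a} = ⊤ := by
  rw [eq_top_iff]
  intro d _
  have key : ∀ z, z ∈ AddSubgroup.closure {a | ∃ m n, c.pair m n = a} →
      re D z ∈ AddSubgroup.closure {a | ∃ m n, c.rePair m n = a} := by
    intro z hz
    induction hz using AddSubgroup.closure_induction with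
    | mem z hz =>
      obtain ⟨m, n, rfl⟩ := hz
      obtain ⟨m₀, m₁, rfl⟩ := c.M.exists_fixed m
      obtain ⟨n₀, n₁, rfl⟩ := c.N.exists_fixed n
      have e : c.pair (m₀.1 + imag D • m₁.1) (n₀.1 + imag D' • n₁.1) =
          incl D (c.rePair m₀ n₀) + imag D * incl D (c.rePair m₀ n₁) +
          (imag D * incl D (c.rePair m₁ n₀) + imag D * (imag D * incl D (c.rePair m₁ n₁))) := by
        rw [imag_op_smul c.N, map_add c.pair, AddMonoidHom.add_apply, map_add, map_add, c.pair_smul,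
          c.pair_smul, c.pair_op_smul, c.pair_op_smul, ← imag_comm, ← imag_comm, incl_rePair,
          incl_rePair, incl_rePair, incl_rePair]
      rw [e, map_add, map_add, map_add, re_incl, re_imag_mul, re_imag_mul, re_imag_mul_imag,
        add_zero, zero_add]
      exact add_mem (AddSubgroup.subset_closure ⟨_, _, rfl⟩)
        (neg_mem (AddSubgroup.subset_closure ⟨_, _, rfl⟩))
    | zero => rw [map_zero]; exact zero_mem _
    | add x y _ _ hx hy => rw [map_add]; exact add_mem hx hy
    | neg x _ hx => rw [map_neg]; exact neg_mem hx
  have := key (incl D d) (by rw [c.pair_surjective]; exact AddSubgroup.mem_top _)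
  rwa [re_incl] at this

lemma reCopair_surjective : AddSubgroup.closure {a | ∃ n m, c.reCopair n m = a} = ⊤ :=
  c.symm.rePair_surjective

/-- The descent of a Morita context. -/
def descend : MoritaContext D D' where
  M := c.M.fixedBimodule
  N := c.N.fixedBimodule
  pair := c.rePair
  copair := c.reCopair
  pair_smul d m n := incl_injective (by
    rw [map_mul]
    exact (c.incl_rePair _ _).trans ((c.pair_smul _ _ _).trans
      (congrArg _ (c.incl_rePair m n).symm)))
  pair_op_smul d m n := incl_injective (by
    rw [map_mul]
    exact (c.incl_rePair _ _).trans ((c.pair_op_smul _ _ _).trans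
      (congrArg (· * incl D d) (c.incl_rePair m n).symm)))
  pair_balanced d m n := incl_injective
    ((c.incl_rePair _ _).trans ((c.pair_balanced _ _ _).trans
      (c.incl_rePair m (d • (n : c.N.fixed))).symm))
  copair_smul d m n := incl_injective (by
    rw [map_mul]
    exact (c.incl_reCopair _ _).trans ((c.copair_smul _ _ _).trans
      (congrArg _ (c.incl_reCopair m n).symm)))
  copair_op_smul d m n := incl_injective (by
    rw [map_mul]
    exact (c.incl_reCopair _ _).trans ((c.copair_op_smul _ _ _).trans
      (congrArg (· * incl D' d) (c.incl_reCopair m n).symm)))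
  copair_balanced d m n := incl_injective
    ((c.incl_reCopair _ _).trans ((c.copair_balanced _ _ _).trans
      (c.incl_reCopair m (d • (n : c.M.fixed))).symm))
  assoc m n m' := Subtype.ext ((congrArg (· • m'.1) (c.incl_rePair m n)).trans
    ((c.assoc m.1 n.1 m'.1).trans
      (congrArg (fun x => MulOpposite.op x • m.1) (c.incl_reCopair n m').symm)))
  coassoc n m n' := Subtype.ext ((congrArg (· • n'.1) (c.incl_reCopair n m)).trans
    ((c.coassoc n.1 m.1 n'.1).trans
      (congrArg (fun x => MulOpposite.op x • n.1) (c.incl_rePair m n').symm)))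
  pair_act g m n := incl_injective ((act_incl (g, 1) (c.rePair m n)).symm.trans
    ((congrArg _ (c.incl_rePair m n)).trans ((c.pair_act (g, 1) m.1 n.1).trans
      (c.incl_rePair (c.M.fixedAct g m) (c.N.fixedAct g n)).symm)))
  copair_act g n m := incl_injective ((act_incl (g, 1) (c.reCopair n m)).symm.trans
    ((congrArg _ (c.incl_reCopair n m)).trans ((c.copair_act (g, 1) n.1 m.1).trans
      (c.incl_reCopair (c.N.fixedAct g n) (c.M.fixedAct g m)).symm)))
  pair_surjective := c.rePair_surjective
  copair_surjective := c.reCopair_surjective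

end MoritaContext

lemma MoritaEquivalent.descend {D D' : RealSuperAlgebra}
    (h : MoritaEquivalent (complexify D) (complexify D')) : MoritaEquivalent D D' :=
  h.map fun c => c.descend

namespace RealSuperAlgebra

/-! ### The eight central super-division algebras -/

variable {D : RealSuperAlgebra}

lemma eq_zero_of_eq_neg_self {V : Type} [AddCommGroup V] [Module ℝ V] {v : V} (h : v = -v) :
    v = 0 := by
  have : (2 : ℝ) • v = 0 := by rw [two_smul]; nth_rewrite 1 [h]; exact neg_add_cancel v
  exact (smul_eq_zero.mp this).resolve_left two_ne_zero

/-- An odd supercentral `z` anticommutes with itself, so `z² = 0`, which is impossible for a unit.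
-/
lemma center_odd_of_isUnit [Nontrivial D.carrier]
    (h : ∀ a : D.carrier, a ≠ 0 → (parity D a = a ∨ parity D a = -a) → IsUnit a) (z : D.carrier)
    (hz : parity D z = -z) (hc : ∀ a, z * a = parity D a * z) : z = 0 := by
  by_contra h0
  have hu := h z h0 (Or.inr hz)
  have h1 : z * z = 0 := eq_zero_of_eq_neg_self (by rw [← neg_mul, ← hz]; exact hc z)
  exact h0 (hu.mul_right_eq_zero.mp h1)

lemma isCentralSuperDivision_of_even {E : Type} [DivisionRing E] [Algebra ℝ E]
    [FiniteDimensional ℝ E]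
    (hc : ∀ z : E, (∀ a, z * a = a * z) → ∃ r : ℝ, z = algebraMap ℝ E r) :
    (RealSuperAlgebra.mk E (AlgHom.id ℝ E) (fun _ => rfl)).IsCentralSuperDivision := by
  have hn : Nontrivial (RealSuperAlgebra.mk E (AlgHom.id ℝ E) (fun _ => rfl)).carrier :=
    inferInstanceAs (Nontrivial E)
  have hE : ∀ a : E, a ≠ 0 → IsUnit a := fun a ha => IsUnit.mk0 a ha
  have hu : ∀ a : (RealSuperAlgebra.mk E (AlgHom.id ℝ E) (fun _ => rfl)).carrier, a ≠ 0 →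
      IsUnit a := hE
  exact {
    nontrivial := hn
    finiteDimensional := inferInstanceAs (FiniteDimensional ℝ E)
    isUnit := fun a ha _ => hu a ha
    center_even := fun z _ h => hc z h
    center_odd := center_odd_of_isUnit fun a ha _ => hu a ha }

/-- A superalgebra whose even part is a division algebra and that has an odd unit. -/
lemma isCentralSuperDivision_of_adjoin [Nontrivial D.carrier] {E : Type} [DivisionRing E]
    [Algebra ℝ E] [FiniteDimensional ℝ E] (j : E →ₐ[ℝ] D.carrier) (hj : ∀ x, parity D (j x) = j x)
    (u : D.carrier) (hu : parity D u = -u) (hu' : IsUnit u) (hs : ∀ z, ∃ x y, z = j x + j y * u)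
    (hc : ∀ x : E, (∀ y, x * y = y * x) → j x * u = u * j x → ∃ r : ℝ, x = algebraMap ℝ E r) :
    D.IsCentralSuperDivision := by
  have hinj : Function.Injective j := j.toRingHom.injective
  have hunit : ∀ x, x ≠ 0 → IsUnit (j x) := fun x hx => (IsUnit.mk0 x hx).map j
  have heven : ∀ z, parity D z = z → ∃ x, z = j x := by
    intro z hz
    obtain ⟨x, y, rfl⟩ := hs z
    rw [map_add, map_mul, hj, hj, hu, mul_neg, add_right_inj] at hz
    exact ⟨x, by rw [eq_zero_of_eq_neg_self hz.symm, add_zero]⟩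
  have hodd : ∀ z, parity D z = -z → ∃ y, z = j y * u := by
    intro z hz
    obtain ⟨x, y, rfl⟩ := hs z
    rw [map_add, map_mul, hj, hj, hu, mul_neg, neg_add, add_left_inj] at hz
    exact ⟨y, by rw [eq_zero_of_eq_neg_self hz, zero_add]⟩
  have hun : ∀ a : D.carrier, a ≠ 0 → (parity D a = a ∨ parity D a = -a) → IsUnit a := by
    rintro a ha (h | h)
    · obtain ⟨x, rfl⟩ := heven a h
      exact hunit x (by rintro rfl; exact ha (map_zero j))
    · obtain ⟨x, rfl⟩ := hodd a h
      exact (hunit x (by rintro rfl; exact ha (by rw [map_zero, zero_mul]))).mul hu'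
  refine ⟨inferInstance, ?_, hun, fun z hz h => ?_, center_odd_of_isUnit hun⟩
  · refine Module.Finite.of_surjective
      (j.toLinearMap.coprod ((LinearMap.mulRight ℝ u).comp j.toLinearMap)) fun z => ?_
    obtain ⟨x, y, rfl⟩ := hs z
    exact ⟨(x, y), rfl⟩
  · obtain ⟨x, rfl⟩ := heven z hz
    obtain ⟨r, rfl⟩ := hc x (fun y => hinj (by rw [map_mul, map_mul, h])) (h u)
    exact ⟨r, AlgHom.commutes j r⟩

lemma isUnit_of_mul_self {A : Type} [Ring A] [Algebra ℝ A] {ε : ZMod 2} {e : A}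
    (he : e * e = (sgn ε : ℝ) • (1 : A)) : IsUnit e := by
  have h : (sgn ε : ℝ) * sgn ε = 1 := by rcases zmod_two_cases ε with rfl | rfl <;> simp
  refine isUnit_iff_exists.mpr ⟨(sgn ε : ℝ) • e, ?_, ?_⟩
  · rw [mul_smul_comm, he, smul_smul, h, one_smul]
  · rw [smul_mul_assoc, he, smul_smul, h, one_smul]

lemma CliffLine.isCentralSuperDivision {m n : ℕ} {ε : ZMod 2} (L : CliffLine m n ε) :
    (cliff m n).IsCentralSuperDivision :=
  isCentralSuperDivision_of_adjoin (Algebra.ofId ℝ _)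
    (fun r => parity_algebraMap _ r) L.gen L.parity_gen
    (isUnit_of_mul_self L.gen_mul_gen)
    (fun z => by
      obtain ⟨r, s, rfl⟩ := L.exists_coeff z
      exact ⟨r, s, by rw [Algebra.smul_def]; rfl⟩)
    (fun x _ _ => ⟨x, rfl⟩)

lemma quaternion_center (z : ℍ[ℝ]) (h : ∀ a, z * a = a * z) : ∃ r : ℝ, z = algebraMap ℝ ℍ[ℝ] r := by
  have h1 := h ⟨0, 1, 0, 0⟩
  have h2 := h ⟨0, 0, 1, 0⟩
  have h3 := congrArg QuaternionAlgebra.imJ h1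
  have h4 := congrArg QuaternionAlgebra.imK h1
  have h5 := congrArg QuaternionAlgebra.imK h2
  erw [Quaternion.imJ_mul, Quaternion.imJ_mul] at h3
  erw [Quaternion.imK_mul, Quaternion.imK_mul] at h4 h5
  simp only [mul_zero, zero_mul, mul_one, one_mul, add_zero, zero_add, sub_zero, zero_sub] at h3 h4 h5
  refine ⟨z.re, Quaternion.ext _ _ ?_ ?_ ?_ ?_⟩
  · rfl
  · change z.imI = 0
    linarith
  · change z.imJ = 0
    linarith
  · change z.imK = 0
    linarith

lemma quatCliff_isCentralSuperDivision {m n : ℕ} {ε : ZMod 2} (L : CliffLine m n ε) :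
    (quatCliff m n).IsCentralSuperDivision := by
  obtain ⟨f, e, hf, hp, he, -, hs⟩ := exists_quatCliff_generators L
  let j : ℍ[ℝ] →ₐ[ℝ] (quatCliff m n).carrier := f
  exact isCentralSuperDivision_of_adjoin j hf e hp (isUnit_of_mul_self he) hs
    fun x hx _ => quaternion_center x hx

/-- For either sign of the two generators `(VW)² = -1`, so the even part is a copy of `ℂ`. The odd
unit `V` acts on it by complex conjugation, which cuts the even centre down to `ℝ`. -/
lemma cliff_two_isCentralSuperDivision {m n : ℕ} {ε : ZMod 2} (v w : Fin m ⊕ Fin n → ℝ)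
    (hv : cliffordForm m n v = sgn ε) (hw : cliffordForm m n w = sgn ε)
    (ho : cliffordForm m n (v + w) = cliffordForm m n v + cliffordForm m n w)
    (hs : ∀ x, ∃ r s : ℝ, x = r • v + s • w) : (cliff m n).IsCentralSuperDivision := by
  have hε : (sgn ε : ℝ) * sgn ε = 1 := by rcases zmod_two_cases ε with rfl | rfl <;> simp
  have h1 : cliffι m n v * cliffι m n v = (sgn ε : ℝ) • (1 : (cliff m n).carrier) := by
    rw [cliffι_mul_self, hv, Algebra.algebraMap_eq_smul_one]
  have h2 : cliffι m n w * cliffι m n w = (sgn ε : ℝ) • (1 : (cliff m n).carrier) := by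
    rw [cliffι_mul_self, hw, Algebra.algebraMap_eq_smul_one]
  have h3 : cliffι m n w * cliffι m n v = -(cliffι m n v * cliffι m n w) := by
    rw [← add_eq_zero_iff_eq_neg, add_comm]
    exact CliffordAlgebra.ι_mul_ι_add_swap_of_isOrtho ho
  generalize hV : cliffι m n v = V at h1 h3
  generalize hW : cliffι m n w = W at h2 h3
  have hpV : parity (cliff m n) V = -V := by rw [← hV]; exact parity_cliffι _ _ _
  have hpW : parity (cliff m n) W = -W := by rw [← hW]; exact parity_cliffι _ _ _
  have h4 : V * W * (V * W) = -1 := by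
    rw [mul_assoc, ← mul_assoc W, h3, neg_mul, mul_neg, mul_assoc, h2, mul_smul_comm, mul_one,
      mul_smul_comm, h1, smul_smul, hε, one_smul]
  let j : ℂ →ₐ[ℝ] (cliff m n).carrier := Complex.lift ⟨V * W, h4⟩
  have hj : ∀ z : ℂ, j z = algebraMap ℝ _ z.re + z.im • (V * W) := fun z => rfl
  have hju : ∀ z : ℂ, V * j z = j (starRingEnd ℂ z) * V := by
    intro z
    rw [hj, hj, mul_add, add_mul, Algebra.commutes, Complex.conj_re, Complex.conj_im, neg_smul,
      neg_mul, smul_mul_assoc, mul_assoc V W V, h3, mul_neg, smul_neg, neg_neg, mul_smul_comm]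
  have hinj : Function.Injective j := j.toRingHom.injective
  have huV : IsUnit V := isUnit_of_mul_self h1
  refine isCentralSuperDivision_of_adjoin j (fun z => ?_) V hpV huV (fun z => ?_)
    (fun x _ hx => ⟨x.re, ?_⟩)
  · rw [hj, map_add, parity_algebraMap, parity_smul, map_mul, hpV, hpW, neg_mul_neg]
  · have hι : ∀ r : ℝ, r • W = j ((-(r * sgn ε) : ℝ) * Complex.I) * V := by
      intro r
      rw [hj]
      simp only [Complex.re_ofReal_mul, Complex.im_ofReal_mul, Complex.I_re, Complex.I_im, mul_zero,
        mul_one, map_zero, zero_add]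
      rw [smul_mul_assoc, mul_assoc, h3, mul_neg, ← mul_assoc, h1, smul_mul_assoc, one_mul,
        neg_smul, smul_neg, neg_neg, smul_smul, mul_assoc, hε, mul_one]
    induction z using cliff_induction with
    | algebraMap r => exact ⟨r, 0, by rw [map_zero, zero_mul, add_zero]; exact (j.commutes r).symm⟩
    | ι x =>
      obtain ⟨r, s, rfl⟩ := hs x
      refine ⟨0, algebraMap ℝ ℂ r + ((-(s * sgn ε) : ℝ) * Complex.I), ?_⟩
      rw [map_zero, zero_add, map_add, add_mul, ← hι, j.commutes, ← Algebra.smul_def, ← hV, ← hW]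
      exact (map_add _ _ _).trans (congrArg₂ _ (map_smul _ _ _) (map_smul _ _ _))
    | mul x y hx hy =>
      obtain ⟨a, b, rfl⟩ := hx
      obtain ⟨a', b', rfl⟩ := hy
      refine ⟨a * a' + (sgn ε : ℝ) • (b * starRingEnd ℂ b'), a * b' + b * starRingEnd ℂ a', ?_⟩
      have h5 : j b * V * j a' = j b * j (starRingEnd ℂ a') * V := by
        rw [mul_assoc, hju, ← mul_assoc]
      have h6 : j b * V * (j b' * V) = (sgn ε : ℝ) • (j b * j (starRingEnd ℂ b')) := by
        rw [mul_assoc, ← mul_assoc V, hju, mul_assoc (j _), h1, mul_smul_comm, mul_smul_comm,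
          mul_one]
      rw [mul_add, add_mul, add_mul, h5, h6, map_add, map_smul, map_mul, map_mul, map_add, map_mul,
        map_mul, add_mul, mul_assoc (j a)]
      abel
    | add x y hx hy =>
      obtain ⟨a, b, rfl⟩ := hx
      obtain ⟨a', b', rfl⟩ := hy
      exact ⟨a + a', b + b', by rw [map_add, map_add, add_mul]; abel⟩
  · rw [hju] at hx
    have := hinj (huV.mul_left_injective hx)
    exact (Complex.conj_eq_iff_re.mp this.symm).symm

lemma superDiv_isCentralSuperDivision (n : Fin 8) : (superDiv n).IsCentralSuperDivision := by
  fin_cases n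
  · exact isCentralSuperDivision_of_even fun z _ => ⟨z, rfl⟩
  · exact CliffLine.pos.isCentralSuperDivision
  · refine cliff_two_isCentralSuperDivision (ε := 0) (Sum.elim ![1, 0] 0) (Sum.elim ![0, 1] 0)
      ?_ ?_ ?_ fun x => ⟨x (Sum.inl 0), x (Sum.inl 1), ?_⟩
    · simp [cliffordForm_apply]
    · simp [cliffordForm_apply]
    · simp [cliffordForm_apply]
    · ext (i | i)
      · fin_cases i <;> simp
      · exact i.elim0
  · exact quatCliff_isCentralSuperDivision CliffLine.neg
  · exact isCentralSuperDivision_of_even quaternion_center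
  · exact quatCliff_isCentralSuperDivision CliffLine.pos
  · refine cliff_two_isCentralSuperDivision (ε := 1) (Sum.elim 0 ![1, 0]) (Sum.elim 0 ![0, 1])
      ?_ ?_ ?_ fun x => ⟨x (Sum.inr 0), x (Sum.inr 1), ?_⟩
    · simp [cliffordForm_apply]
    · simp [cliffordForm_apply]
    · simp [cliffordForm_apply]
    · ext (i | i)
      · exact i.elim0
      · fin_cases i <;> simp
  · exact CliffLine.neg.isCentralSuperDivision

/-- The complexification of an isomorphism. -/
def complexifyIso {D E : RealSuperAlgebra} (e : D.Iso E) : (complexify D).Iso (complexify E) where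
  toAlgEquiv := AlgEquiv.ofAlgHom (complexifyHom e.toAlgEquiv.toAlgHom)
    (complexifyHom e.toAlgEquiv.symm.toAlgHom)
    (AlgHom.ext fun x => by
      induction x using complexify_induction with
      | hadd x y hx hy => rw [map_add, map_add, hx, hy]
      | h c x => exact congrArg (cTmul E c) (e.toAlgEquiv.apply_symm_apply x))
    (AlgHom.ext fun x => by
      induction x using complexify_induction with
      | hadd x y hx hy => rw [map_add, map_add, hx, hy]
      | h c x => exact congrArg (cTmul D c) (e.toAlgEquiv.symm_apply_apply x))
  map_act := complexifyHom_act e.toAlgEquiv.toAlgHom fun x => e.map_act _ x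

lemma typeTable_injective : Function.Injective typeTable := by decide

lemma typeTable_surjective : Function.Surjective typeTable := by decide

lemma superDiv_moritaEquivalent (n : Fin 8) : MoritaEquivalent (superDiv n) (cliff n 0) := by
  have h := hasType_cliff (n : ℕ)
  rw [show Fin.ofNat 8 (n : ℕ) = n from Fin.ofNat_val_eq_self n] at h
  exact ((hasType_superDiv n).moritaEquivalent h).descend

/-- All eight types occur in the table, each once. Equal types give a Morita equivalence of
complexifications, which descends to `ℝ` and is an isomorphism by the division property; an
isomorphism in turn preserves the type. -/
lemma IsCentralSuperDivision.existsUnique_iso (hD : D.IsCentralSuperDivision) :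
    ∃! n : Fin 8, Nonempty (D.Iso (superDiv n)) := by
  obtain ⟨a, b, c, h⟩ := hD.exists_hasType
  obtain ⟨n, hn⟩ := typeTable_surjective (a, b, c)
  have hn' := hasType_superDiv n
  rw [hn] at hn'
  refine ⟨n, hD.iso_of_moritaEquivalent (superDiv_isCentralSuperDivision n)
    (h.moritaEquivalent hn').descend, ?_⟩
  rintro m ⟨e⟩
  obtain ⟨h1, h2, h3⟩ := (HasType.ofIso (complexifyIso e) (hasType_superDiv m)).unique h
  refine typeTable_injective (Eq.trans ?_ hn.symm)
  rw [← h1, ← h2, ← h3]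

end RealSuperAlgebra

/-! ### Phases -/

open RealSuperAlgebra

lemma existsUnique_type {A : EqAlg} (hA : IsSRE A) :
    ∃! t : ZMod 2 × ZMod 2 × ZMod 2, HasType A t.1 t.2.1 t.2.2 := by
  obtain ⟨a, b, c, h⟩ := hA.exists_hasType
  refine ⟨(a, b, c), h, fun t ht => ?_⟩
  obtain ⟨h1, h2, h3⟩ := ht.unique h
  exact Prod.ext h1 (Prod.ext h2 h3)

/-- The signs `(a, b, c)` of the invariants of an SRE algebra. -/
def typeOf (A : EqAlg) (hA : IsSRE A) : ZMod 2 × ZMod 2 × ZMod 2 := (existsUnique_type hA).choose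

lemma hasType_iff_typeOf {A : EqAlg} (hA : IsSRE A) (t : ZMod 2 × ZMod 2 × ZMod 2) :
    HasType A t.1 t.2.1 t.2.2 ↔ typeOf A hA = t := by
  refine ⟨fun h => ((existsUnique_type hA).choose_spec.2 t h).symm, ?_⟩
  rintro rfl
  exact (existsUnique_type hA).choose_spec.1

lemma typeOf_eq {A : EqAlg} (hA : IsSRE A) {a b c : ZMod 2} (h : HasType A a b c) :
    typeOf A hA = (a, b, c) := (hasType_iff_typeOf hA (a, b, c)).mp h

lemma typeOf_eq_iff {A B : EqAlg} (hA : IsSRE A) (hB : IsSRE B) :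
    typeOf A hA = typeOf B hB ↔ MoritaEquivalent A B := by
  have h := (hasType_iff_typeOf hB _).mpr rfl
  exact ⟨fun e => ((hasType_iff_typeOf hA _).mpr e).moritaEquivalent h,
    fun e => (hasType_iff_typeOf hA _).mp (h.of_moritaEquivalent e)⟩

/-- Phases are classified by the signs of their invariants. -/
def phaseEquiv : SREPhase ≃ ZMod 2 × ZMod 2 × ZMod 2 :=
  Equiv.ofBijective
    (Quot.lift (fun A => typeOf A.1 A.2) fun A B h => (typeOf_eq_iff A.2 B.2).mpr h) <| by
    refine ⟨?_, fun t => ?_⟩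
    · rintro ⟨A, hA⟩ ⟨B, hB⟩ h
      exact Quot.sound ((typeOf_eq_iff hA hB).mp h)
    · obtain ⟨n, rfl⟩ := typeTable_surjective t
      exact ⟨phase _ (hasType_superDiv n).isSRE, typeOf_eq _ (hasType_superDiv n)⟩

lemma phaseEquiv_phase (A : EqAlg) (hA : IsSRE A) : phaseEquiv (phase A hA) = typeOf A hA := rfl

lemma phase_eq_iff (A B : EqAlg) (hA : IsSRE A) (hB : IsSRE B) :
    phase A hA = phase B hB ↔ MoritaEquivalent A B := by
  rw [← typeOf_eq_iff hA hB, ← phaseEquiv.injective.eq_iff]; rfl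

lemma card_phase : Nat.card SREPhase = 8 := by
  rw [Nat.card_congr phaseEquiv]; simp

/-- The stacking law of the signs. -/
def typeStack (t t' : ZMod 2 × ZMod 2 × ZMod 2) : ZMod 2 × ZMod 2 × ZMod 2 :=
  (t.1 + t'.1 + t.2.1 * t'.2.1 + (1 + t.2.2) * t'.2.2 * (t.2.1 * t.2.1) +
      t.2.2 * (1 + t'.2.2) * (t'.2.1 * t'.2.1),
    t.2.1 + t'.2.1 + t.2.2 * t'.2.2, t.2.2 + t'.2.2)

lemma hasType_stack {A B : EqAlg} (hA : IsSRE A) (hB : IsSRE B) :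
    HasType (A.stack B) (typeStack (typeOf A hA) (typeOf B hB)).1
      (typeStack (typeOf A hA) (typeOf B hB)).2.1 (typeStack (typeOf A hA) (typeOf B hB)).2.2 :=
  ((hasType_iff_typeOf hA _).mpr rfl).stack ((hasType_iff_typeOf hB _).mpr rfl)

lemma IsSRE.stack {A B : EqAlg} (hA : IsSRE A) (hB : IsSRE B) : IsSRE (A.stack B) :=
  (hasType_stack hA hB).isSRE

lemma typeOf_stack {A B : EqAlg} (hA : IsSRE A) (hB : IsSRE B) :
    typeOf (A.stack B) (hA.stack hB) = typeStack (typeOf A hA) (typeOf B hB) :=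
  typeOf_eq _ (hasType_stack hA hB)

/-- The position in the table. -/
def typeEquiv : ZMod 8 ≃ ZMod 2 × ZMod 2 × ZMod 2 :=
  Equiv.ofBijective typeTable ⟨typeTable_injective, typeTable_surjective⟩

/-- A check of sixty-four cases. The group axioms for stacking need no separate proof, since they
are transported from `ℤ/8`. -/
lemma typeEquiv_add (m n : ZMod 8) :
    typeEquiv (m + n) = typeStack (typeEquiv m) (typeEquiv n) := by
  have h : ∀ m n : ZMod 8, typeTable (m + n) = typeStack (typeTable m) (typeTable n) := by decide
  exact h m n

lemma typeEquiv_natCast (n : ℕ) : typeEquiv n = typeTable (Fin.ofNat 8 n) := rfl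

/-- The polynomials `(1 + c)c'`, `c(1 + c')` and `cc'` are the indicator functions of the cases
even-odd, odd-even and odd-odd in `Invariants.stack`. -/
lemma invariantsEquiv_typeStack (t t' : ZMod 2 × ZMod 2 × ZMod 2) :
    invariantsEquiv (typeStack t t') = (invariantsEquiv t).stack (invariantsEquiv t') := by
  obtain ⟨a, b, c⟩ := t
  obtain ⟨a', b', c'⟩ := t'
  simp only [typeStack, invariantsEquiv_apply, Invariants.stack, halfCup_eq, betaClass_tGen,
    alphaClass_add, betaClass_add]
  have h0 : alphaClass 0 = 0 := rfl
  have h0' : betaClass 0 = 0 := rfl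
  have h2 : (1 + 1 : ZMod 2) = 0 := by decide
  rcases zmod_two_cases c with rfl | rfl <;> rcases zmod_two_cases c' with rfl | rfl <;>
    simp [h0, h0', h2, betaClass_one]

lemma hasInvariants_iff_phase {A : EqAlg} (hA : IsSRE A) (i : Invariants) :
    HasInvariants A i ↔ invariantsEquiv (phaseEquiv (phase A hA)) = i := by
  obtain ⟨⟨a, b, c⟩, rfl⟩ := invariantsEquiv.surjective i
  rw [invariantsEquiv.injective.eq_iff, invariantsEquiv_apply, hasInvariants_iff]
  exact hasType_iff_typeOf hA (a, b, c)

end BDI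

end

open BDI in
theorem mainTheorem3 :
    Nat.card H2 = 2 ∧ Nat.card H1 = 2 ∧ Nat.card SREPhase = 8 ∧
    -- two SRE algebras are in the same phase if and only if they are Morita equivalent
    (∀ (A B : EqAlg) (hA : IsSRE A) (hB : IsSRE B),
      phase A hA = phase B hB ↔ MoritaEquivalent A B) ∧
    -- the list contains every central real super-division algebra exactly once
    (∀ n : Fin 8, (superDiv n).IsCentralSuperDivision) ∧
    (∀ D : RealSuperAlgebra, D.IsCentralSuperDivision →
      ∃! n : Fin 8, Nonempty (D.Iso (superDiv n))) ∧
    -- it lists the Morita classes of the first eight Clifford algebras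
    (∀ n : Fin 8, MoritaEquivalent (superDiv n) (cliff n 0)) ∧
    ∃ (hstack : ∀ A B : EqAlg, IsSRE A → IsSRE B → IsSRE (A.stack B))
      (hdiv : ∀ n : Fin 8, IsSRE (complexify (superDiv n)))
      (hcliff : ∀ n : ℕ, IsSRE (complexify (cliff n 0)))
      (e : SREPhase ≃ ZMod 8) (inv : SREPhase ≃ Invariants),
      -- stacking is addition in `ℤ/8`
      (∀ (A B : EqAlg) (hA : IsSRE A) (hB : IsSRE B),
        e (phase (A.stack B) (hstack A B hA hB)) = e (phase A hA) + e (phase B hB)) ∧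
      -- `inv` is given by the invariants `(α, β, γ)`, which obey the stacking law
      (∀ (A : EqAlg) (hA : IsSRE A) (i : Invariants),
        HasInvariants A i ↔ inv (phase A hA) = i) ∧
      (∀ (A B : EqAlg) (hA : IsSRE A) (hB : IsSRE B),
        inv (phase (A.stack B) (hstack A B hA hB)) =
          (inv (phase A hA)).stack (inv (phase B hB))) ∧
      -- the table
      (∀ n : ℕ, e (phase (complexify (cliff n 0)) (hcliff n)) = n) ∧
      (∀ n : Fin 8, e (phase (complexify (superDiv n)) (hdiv n)) = (n : ℕ)) ∧
      (∀ n : Fin 8, inv (phase (complexify (superDiv n)) (hdiv n)) = tableInvariants n) := by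
  refine ⟨card_H2, card_H1, card_phase, phase_eq_iff,
    RealSuperAlgebra.superDiv_isCentralSuperDivision,
    fun D hD => RealSuperAlgebra.IsCentralSuperDivision.existsUnique_iso hD,
    RealSuperAlgebra.superDiv_moritaEquivalent, fun A B hA hB => hA.stack hB,
    fun n => (RealSuperAlgebra.hasType_superDiv n).isSRE,
    fun n => (RealSuperAlgebra.hasType_cliff n).isSRE, phaseEquiv.trans typeEquiv.symm,
    phaseEquiv.trans invariantsEquiv, fun A B hA hB => ?_, fun A hA i => hasInvariants_iff_phase hA i,
    fun A B hA hB => ?_, fun n => ?_, fun n => ?_, fun n => ?_⟩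
  · rw [Equiv.trans_apply, Equiv.symm_apply_eq, typeEquiv_add]
    simp only [Equiv.trans_apply, Equiv.apply_symm_apply]
    exact typeOf_stack hA hB
  · exact (congrArg invariantsEquiv (typeOf_stack hA hB)).trans (invariantsEquiv_typeStack _ _)
  · rw [Equiv.trans_apply, Equiv.symm_apply_eq]
    exact typeOf_eq (RealSuperAlgebra.hasType_cliff n).isSRE (RealSuperAlgebra.hasType_cliff n)
  · rw [Equiv.trans_apply, Equiv.symm_apply_eq, typeEquiv_natCast,
      show Fin.ofNat 8 (n : ℕ) = n from Fin.ofNat_val_eq_self n]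
    exact typeOf_eq (RealSuperAlgebra.hasType_superDiv n).isSRE (RealSuperAlgebra.hasType_superDiv n)
  · rw [Equiv.trans_apply, phaseEquiv_phase, typeOf_eq (RealSuperAlgebra.hasType_superDiv n).isSRE
      (RealSuperAlgebra.hasType_superDiv n)]
    fin_cases n <;> rfl
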